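/- \textbf{Setting.} Let $d\in\mathbb N$, $\beta>0$, and let $A_j,A_j^*$, $j\in\mathbb Z^d$, be the annihilation and creation operators in the occupation number representation (orthonormal basis $e_m$, $m\in\mathbb N^{\mathbb Z^d}$ finitely supported, $A_je_m=\sqrt{m_j}\,e_{m-\delta_j}$), $N_j=A_j^*A_j$. For finite $\Lambda\subset\mathbb Z^d$ let $\rho_\Lambda=\prod_{j\in\Lambda}e^{-\beta N_j}/\mathrm{Tr}(e^{-\beta N_j})$ be the density matrix of the product state $\omega_0$. Put $\langle f,g\rangle=\lim_\Lambda \mathrm{Tr}_\Lambda(\rho_\Lambda^{1/2}f^*\rho_\Lambda^{1/2}g)$, let $L^2(\omega_0)$ be the completion of the local operators of finite norm for this scalar product, $\alpha_z(X)=\lim_\Lambda\rho_\Lambda^{iz}X\rho_\Lambda^{-iz}$, $\delta_X(f)=i[X,f]$ and $\delta_X^\star(g)=i\big(g\,\alpha_{-i/2}(X^*)-\alpha_{i/2}(X^*)\,g\big)$. For $\varepsilon,\delta>0$ let $\mathcal D_\varepsilon$ be the set of all operators $F\exp\big(-\varepsilon\sum_{j\in\Lambda}N_jN_j^{\delta}\big)$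 with $\Lambda$ finite and $F$ a polynomial in $A_j,A_j^*$, $j\in\Lambda$. Let $\mathcal D_*$ be the unital $*$-algebra generated by all $A_j$, $A_j^*$ and all $\exp(-\varepsilon\sum_{j\in\Lambda}N_jN_j^{\delta})$ ($\varepsilon,\delta>0$, $\Lambda$ finite); it contains every $\mathcal D_\varepsilon$. Let $\eta$ be admissible: analytic in a neighbourhood of the strip $|\mathrm{Im}\,z|\le 1/4$, with $\eta(t)\ge0$ and $\eta(t+i/4)+\eta(t-i/4)\ge 0$ for $t\in\mathbb R$, and $|\eta(t+is)|\le M(1+|t|)^{-p}$ for $|s|\le1/4$, with some $M>0$, $p>1$. Write $\hat\eta(s)=\int_{\mathbb R}\eta(t)e^{ist}\,dt$. Let $\kappa,\xi\in\ell^1(\mathbb Z^d;\mathbb C)$ be non-zero, $Z_\kappa=\sum_j\kappa_jA_j$, $Y_{\kappa,\xi}=Z_\kappa-Z_\xi^*$, $(T_j\kappa)_l=\kappa_{l-j}$, and abbreviate $Y_j=Y_{T_j\kappa,T_j\xi}$, $Z_j=Z_{T_j\kappa}$, $W_j=Z_{T_j\xi}$. Let \[\mathcal E_Y(g,f)=\sum_{j\in\mathbb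 Z^d}\int_{\mathbb R}\langle\delta_{\alpha_t(Y_j)}(g),\delta_{\alpha_t(Y_j)}(f)\rangle\,\eta(t)\,dt ,\] let $\mathcal E_{Y^*}$ be the same form with $Y_j^*$ in place of $Y_j$, and let $\mathcal E=\mathcal E_Y+\mathcal E_{Y^*}$ be the Dirichlet form in the directions $Y_j$ and $Y_j^*$; write $\mathcal E(f)=\mathcal E(f,f)$, etc. \textbf{Theorem.} (1) All integrals and series in $\mathcal E_Y(g,f)$ and $\mathcal E_{Y^*}(g,f)$ converge for all $f,g\in\mathcal D_*$; and for all $\varepsilon,\delta>0$ the set $\mathcal D_\varepsilon\subset\mathcal D_*$ is dense in $L^2(\omega_0)$. (2) For $f\in\mathcal D_*$, with all series convergent, \[\begin{aligned}\mathcal E_Y(f)=\;&\hat\eta(0)\sum_j\langle\delta_{Z_j}(f),\delta_{Z_j}(f)\rangle+\hat\eta(0)\sum_j\langle\delta_{W_j^*}(f),\delta_{W_j^*}(f)\rangle\\&-\hat\eta(-2\beta)\sum_j\langle\delta_{Z_j}(f),\delta_{W_j^*}(f)\rangle-\hat\eta(2\beta)\sum_j\langle\delta_{W_j^*}(f),\delta_{Z_j}(f)\rangle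 ,\end{aligned}\] and $\mathcal E(f)$ is the sum of this expression and of \[\begin{aligned}&\hat\eta(0)\sum_j\langle\delta_{Z_j^*}(f),\delta_{Z_j^*}(f)\rangle+\hat\eta(0)\sum_j\langle\delta_{W_j}(f),\delta_{W_j}(f)\rangle\\&-\hat\eta(2\beta)\sum_j\langle\delta_{Z_j^*}(f),\delta_{W_j}(f)\rangle-\hat\eta(-2\beta)\sum_j\langle\delta_{W_j}(f),\delta_{Z_j^*}(f)\rangle .\end{aligned}\] (3) $\mathcal E$ defines a pre-Markov generator: the operator \[-L(f)=\sum_j\int_{\mathbb R}\big(\delta^\star_{\alpha_t(Y_j)}\delta_{\alpha_t(Y_j)}(f)+\delta^\star_{\alpha_t(Y_j^*)}\delta_{\alpha_t(Y_j^*)}(f)\big)\eta(t)\,dt\] converges (matrix element by matrix element) for $f\in\mathcal D_*$ and is a densely defined, linear, symmetric, non-positive operator from $\mathcal D_*$ to $L^2(\omega_0)$ with $\mathcal E(g,f)=\langle g,-L(f)\rangle$, $L(f^*)=L(f)^*$, $L(\mathbf 1)=0$, and it is dissipative: $L(f^*f)-f^*L(f)-L(f^*)f\ge0$ on finite linear combinations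 of the $e_m$. Moreover, for all $\varepsilon,\delta>0$ the set $\mathcal D_\varepsilon$ is a core of the form: for all $f\in\mathcal D_*$ and $r>0$ there is $g\in\mathcal D_\varepsilon$ with $\|f-g\|<r$ and $\mathcal E(f-g)<r$. -/

import Mathlib

open Filter Topology MeasureTheory

namespace YFields

noncomputable section

/-! ### Lattice, occupation numbers, operators -/

/-- The lattice `ℤᵈ`. -/
abbrev Site (d : ℕ) := Fin d → ℤ

/-- Occupation numbers `m = (m_j)` with finitely many non-zero entries: they label the orthonormal
basis `e_m` of the Hilbert space of the lattice (the closure of the union of the local spaces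
`H_Λ`, where `H_Λ` has the basis `e_m` with `m` supported in `Λ`). -/
abbrev Cfg (d : ℕ) := Site d →₀ ℕ

/-- A (possibly unbounded) operator, given by its matrix elements `X m n = ⟨e_m, X e_n⟩`. -/
abbrev Op (d : ℕ) := Cfg d → Cfg d → ℂ

variable {d : ℕ}

/-- The identity operator. -/
def one : Op d := fun m n => if m = n then 1 else 0

/-- The product of two operators. -/
def mul (X Y : Op d) : Op d := fun m n => ∑' p, X m p * Y p n

/-- The adjoint operator. -/
def adj (X : Op d) : Op d := fun m n => (starRingEnd ℂ) (X n m)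

/-- The annihilation operator `A_j`: `A_j e_n = √(n_j) e_{n - δ_j}`. The creation operator
is `adj (ann j)`. -/
def ann (j : Site d) : Op d :=
  fun m n => if n = m + Finsupp.single j 1 then (Real.sqrt (n j : ℝ) : ℂ) else 0

/-- The derivation `δ_X (f) = i [X, f]`. -/
def delta (X f : Op d) : Op d := Complex.I • (mul X f - mul f X)

/-! ### Polynomials, and the set `𝓓_ε` -/

/-- Polynomials in the creation and annihilation operators at the sites of `Λ`. -/
inductive IsPoly (Λ : Finset (Site d)) : Op d → Prop
  | one : IsPoly Λ one
  | ann (j : Site d) (hj : j ∈ Λ) : IsPoly Λ (ann j)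
  | cre (j : Site d) (hj : j ∈ Λ) : IsPoly Λ (adj (ann j))
  | add (F G : Op d) (hF : IsPoly Λ F) (hG : IsPoly Λ G) : IsPoly Λ (F + G)
  | smul (c : ℂ) (F : Op d) (hF : IsPoly Λ F) : IsPoly Λ (c • F)
  | mul (F G : Op d) (hF : IsPoly Λ F) (hG : IsPoly Λ G) : IsPoly Λ (mul F G)

/-- The operator `exp (- ∑_{j ∈ Λ} ε N_j N_j ^ δ)` (the number operator `N_j = A_j^* A_j` is
diagonal, `N_j e_n = n_j e_n`). -/
def damp (ε δ : ℝ) (Λ : Finset (Site d)) : Op d := fun m n =>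
  if m = n then ((Real.exp (-∑ j ∈ Λ, ε * ((n j : ℝ) * (n j : ℝ) ^ δ)) : ℝ) : ℂ) else 0

/-- The set `𝓓_ε` of all operators `F exp (- ∑_{j ∈ Λ} ε N_j N_j ^ δ)`, with `Λ` finite and
`F` a polynomial in the creation and annihilation operators of `Λ`. -/
def Deps (ε δ : ℝ) : Set (Op d) :=
  {f | ∃ (Λ : Finset (Site d)) (F : Op d), IsPoly Λ F ∧ f = mul F (damp ε δ Λ)}

/-- Membership in the unital `*`-algebra generated by all creation and annihilation operators and
all damping operators. -/
inductive IsObs : Op d → Prop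
  | one : IsObs one
  | ann (j : Site d) : IsObs (ann j)
  | cre (j : Site d) : IsObs (adj (ann j))
  | damp (ε δ : ℝ) (hε : 0 < ε) (hδ : 0 < δ) (Λ : Finset (Site d)) : IsObs (damp ε δ Λ)
  | add (F G : Op d) (hF : IsObs F) (hG : IsObs G) : IsObs (F + G)
  | smul (c : ℂ) (F : Op d) (hF : IsObs F) : IsObs (c • F)
  | mul (F G : Op d) (hF : IsObs F) (hG : IsObs G) : IsObs (mul F G)

/-- The linear space of the unital `*`-algebra generated by the creation, annihilation and damping
operators; it contains the polynomials and the sets `𝓓_ε`. -/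
def obs (d : ℕ) : Submodule ℂ (Op d) where
  carrier := {f | IsObs f}
  add_mem' := fun hf hg => IsObs.add _ _ hf hg
  zero_mem' := by
    have h := IsObs.smul (d := d) 0 one IsObs.one
    rwa [zero_smul] at h
  smul_mem' := fun c _ hf => IsObs.smul c _ hf

/-! ### The product state and its `L²` space -/

/-- The basis labels of `H_Λ`. -/
abbrev FinCfg (Λ : Finset (Site d)) := {m : Cfg d // m.support ⊆ Λ}

/-- The one-site partition function `Tr (exp (-β N))`. -/
def partition (β : ℝ) : ℝ := ∑' k : ℕ, Real.exp (-β * k)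

/-- The eigenvalue at `e_m` of the density matrix `ρ_Λ = ∏_{j ∈ Λ} exp (-β N_j) / Tr (exp (-β N_j))`. -/
def density (β : ℝ) (Λ : Finset (Site d)) (m : Cfg d) : ℝ :=
  ∏ j ∈ Λ, (Real.exp (-β * m j) / partition β)

/-- The summand of `Tr_Λ (ρ_Λ^{1/2} f^* ρ_Λ^{1/2} g) =
∑_{m, n} ρ_Λ(m)^{1/2} ρ_Λ(n)^{1/2} conj (f m n) (g m n)`. -/
def ipTerm (β : ℝ) (Λ : Finset (Site d)) (f g : Op d) (p : FinCfg Λ × FinCfg Λ) : ℂ :=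
  ((Real.sqrt (density β Λ p.1) * Real.sqrt (density β Λ p.2) : ℝ) : ℂ) *
    ((starRingEnd ℂ) (f p.1 p.2) * g p.1 p.2)

/-- `f` is localised in `Λ`: it is of the form (operator on `H_Λ`) `⊗` identity. -/
def IsLocal (Λ : Finset (Site d)) (f : Op d) : Prop :=
  (∀ m n : Cfg d, (∃ j, j ∉ Λ ∧ m j ≠ n j) → f m n = 0) ∧
  (∀ m n m' n' : Cfg d, (∀ j, j ∉ Λ → m j = n j) → (∀ j, j ∉ Λ → m' j = n' j) →
    (∀ j ∈ Λ, m j = m' j) → (∀ j ∈ Λ, n j = n' j) → f m n = f m' n')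

/-- `f` is localised in `Λ` and `Tr_Λ (ρ_Λ^{1/2} f^* ρ_Λ^{1/2} f)` is finite. -/
def IsLocalL2 (β : ℝ) (Λ : Finset (Site d)) (f : Op d) : Prop :=
  IsLocal Λ f ∧ Summable (ipTerm β Λ f f)

theorem IsLocal.mono {Λ Λ' : Finset (Site d)} (h : Λ ⊆ Λ') {f : Op d} (hf : IsLocal Λ f) :
    IsLocal Λ' f := by
  refine ⟨fun m n ⟨j, hj, hne⟩ => hf.1 m n ⟨j, fun hh => hj (h hh), hne⟩, ?_⟩
  intro m n m' n' h1 h2 h3 h4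
  by_cases hc : ∃ j, j ∉ Λ ∧ m j ≠ n j
  · obtain ⟨j, hj, hne⟩ := hc
    have hj' : j ∈ Λ' := by
      by_contra hh
      exact hne (h1 j hh)
    rw [hf.1 m n ⟨j, hj, hne⟩, hf.1 m' n' ⟨j, hj, by rw [← h3 j hj', ← h4 j hj']; exact hne⟩]
  · have hc1 : ∀ j, j ∉ Λ → m j = n j := fun j hj => by
      by_contra hne
      exact hc ⟨j, hj, hne⟩
    refine hf.2 m n m' n' hc1 (fun j hj => ?_) (fun j hj => h3 j (h hj)) (fun j hj => h4 j (h hj))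
    by_cases hj' : j ∈ Λ'
    · rw [← h3 j hj', ← h4 j hj']
      exact hc1 j hj
    · exact h2 j hj'

theorem IsLocal.add {Λ : Finset (Site d)} {f g : Op d} (hf : IsLocal Λ f) (hg : IsLocal Λ g) :
    IsLocal Λ (f + g) := by
  refine ⟨fun m n h => ?_, fun m n m' n' h1 h2 h3 h4 => ?_⟩
  · simp [hf.1 m n h, hg.1 m n h]
  · simp [hf.2 m n m' n' h1 h2 h3 h4, hg.2 m n m' n' h1 h2 h3 h4]

theorem IsLocal.smul {Λ : Finset (Site d)} {f : Op d} (c : ℂ) (hf : IsLocal Λ f) :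
    IsLocal Λ (c • f) := by
  refine ⟨fun m n h => ?_, fun m n m' n' h1 h2 h3 h4 => ?_⟩
  · simp [hf.1 m n h]
  · simp [hf.2 m n m' n' h1 h2 h3 h4]

theorem partition_pos {β : ℝ} (hβ : 0 < β) : 0 < partition β ∧
    HasSum (fun k : ℕ => Real.exp (-β * k) / partition β) 1 := by
  have h1 : ∀ k : ℕ, Real.exp (-β * k) = Real.exp (-β) ^ k := fun k => by
    rw [← Real.exp_nat_mul]; ring_nf
  have hs : Summable (fun k : ℕ => Real.exp (-β * k)) := by
    simp_rw [h1]
    exact summable_geometric_of_lt_one (Real.exp_pos _).le (by simpa using hβ)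
  have hp : 0 < partition β := hs.tsum_pos (fun k => (Real.exp_pos _).le) 0 (Real.exp_pos _)
  refine ⟨hp, ?_⟩
  have := hs.hasSum.div_const (partition β)
  rwa [show (∑' k : ℕ, Real.exp (-β * k)) / partition β = 1 from div_self hp.ne'] at this

theorem density_nonneg {β : ℝ} (hβ : 0 < β) (Λ : Finset (Site d)) (m : Cfg d) :
    0 ≤ density β Λ m :=
  Finset.prod_nonneg fun _ _ => div_nonneg (Real.exp_pos _).le (partition_pos hβ).1.le

/-- Splitting off the occupation number of one site. -/
def splitSite (a : Site d) (Λ : Finset (Site d)) (ha : a ∉ Λ) :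
    FinCfg Λ × ℕ ≃ FinCfg (insert a Λ) where
  toFun p := ⟨p.1.1.update a p.2, by
    intro j hj
    by_cases hja : j = a
    · simp [hja]
    · simp only [Finsupp.mem_support_iff, Finsupp.update_apply, hja, if_false] at hj
      exact Finset.mem_insert_of_mem (p.1.2 (Finsupp.mem_support_iff.2 hj))⟩
  invFun m := (⟨m.1.erase a, by
    intro j hj
    rw [Finsupp.support_erase, Finset.mem_erase] at hj
    exact (Finset.mem_insert.1 (m.2 hj.2)).resolve_left hj.1⟩, m.1 a)
  left_inv p := by
    obtain ⟨⟨m, hm⟩, k⟩ := p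
    have h0 : m a = 0 := by
      by_contra h
      exact ha (hm (Finsupp.mem_support_iff.2 h))
    refine Prod.ext (Subtype.ext ?_) ?_
    · ext j
      by_cases hja : j = a
      · simp [hja, h0]
      · simp [hja, Finsupp.erase_ne]
    · simp
  right_inv m := by
    refine Subtype.ext ?_
    ext j
    by_cases hja : j = a
    · simp [hja]
    · simp

theorem ipTerm_splitSite {β : ℝ} (hβ : 0 < β) {a : Site d} {Λ : Finset (Site d)} (ha : a ∉ Λ)
    {f g : Op d} (hf : IsLocal Λ f) (hg : IsLocal Λ g) (p q : FinCfg Λ × ℕ) :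
    ipTerm β (insert a Λ) f g (splitSite a Λ ha p, splitSite a Λ ha q) =
      ipTerm β Λ f g (p.1, q.1) *
        (if p.2 = q.2 then ((Real.exp (-β * p.2) / partition β : ℝ) : ℂ) else 0) := by
  obtain ⟨⟨m, hm⟩, k⟩ := p
  obtain ⟨⟨n, hn⟩, l⟩ := q
  have hm0 : ∀ j, j ∉ Λ → m j = 0 := fun j hj => by
    by_contra h
    exact hj (hm (Finsupp.mem_support_iff.2 h))
  have hn0 : ∀ j, j ∉ Λ → n j = 0 := fun j hj => by
    by_contra h
    exact hj (hn (Finsupp.mem_support_iff.2 h))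
  have hd : ∀ (m : Cfg d) (k : ℕ), density β (insert a Λ) (m.update a k) =
      Real.exp (-β * k) / partition β * density β Λ m := by
    intro m k
    unfold density
    rw [Finset.prod_insert ha]
    congr 1
    · simp
    · refine Finset.prod_congr rfl fun j hj => ?_
      have : j ≠ a := fun h => ha (h ▸ hj)
      simp [Finsupp.update_apply, this]
  by_cases hkl : k = l
  · subst hkl
    have key : ∀ {f : Op d}, IsLocal Λ f → f (m.update a k) (n.update a k) = f m n := by
      intro f hf
      refine hf.2 _ _ _ _ ?_ (fun j hj => by rw [hm0 j hj, hn0 j hj]) ?_ ?_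
      · intro j hj
        by_cases hja : j = a
        · simp [hja]
        · simp [Finsupp.update_apply, hja, hm0 j hj, hn0 j hj]
      · intro j hj
        have : j ≠ a := fun h => ha (h ▸ hj)
        simp [Finsupp.update_apply, this]
      · intro j hj
        have : j ≠ a := fun h => ha (h ▸ hj)
        simp [Finsupp.update_apply, this]
    have hz : 0 ≤ Real.exp (-β * k) / partition β :=
      div_nonneg (Real.exp_pos _).le (partition_pos hβ).1.le
    simp only [ipTerm, splitSite, Equiv.coe_fn_mk, key hf, key hg, hd, if_true]
    rw [Real.sqrt_mul hz, Real.sqrt_mul hz]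
    have : Real.sqrt (Real.exp (-β * k) / partition β) * Real.sqrt (density β Λ m) *
        (Real.sqrt (Real.exp (-β * k) / partition β) * Real.sqrt (density β Λ n)) =
        (Real.sqrt (density β Λ m) * Real.sqrt (density β Λ n)) *
          (Real.exp (-β * k) / partition β) := by
      nth_rewrite 3 [← Real.mul_self_sqrt hz]
      ring
    rw [this]
    push_cast
    ring
  · have hfz : f (m.update a k) (n.update a l) = 0 := by
      refine hf.1 _ _ ⟨a, ha, ?_⟩
      simpa using hkl
    simp [ipTerm, splitSite, hfz, hkl]

theorem hasSum_diag {u : ℕ → ℂ} {s : ℂ} (hu : HasSum u s) :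
    HasSum (fun p : ℕ × ℕ => if p.1 = p.2 then u p.1 else 0) s := by
  have hinj : Function.Injective (fun k : ℕ => (k, k)) := fun a b h => (Prod.ext_iff.1 h).1
  rw [← hinj.hasSum_iff]
  · simpa [Function.comp_def] using hu
  · rintro ⟨k, l⟩ h
    have : k ≠ l := by
      rintro rfl
      exact h ⟨k, rfl⟩
    simp [this]

/-- Splitting off one site in both indices. -/
def splitPair (a : Site d) (Λ : Finset (Site d)) (ha : a ∉ Λ) :
    (FinCfg Λ × FinCfg Λ) × (ℕ × ℕ) ≃ FinCfg (insert a Λ) × FinCfg (insert a Λ) :=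
  (Equiv.prodProdProdComm _ _ _ _).trans (Equiv.prodCongr (splitSite a Λ ha) (splitSite a Λ ha))

theorem hasSum_prod_mul {ι κ : Type*} {F : ι → ℂ} {G : κ → ℂ} {s t : ℂ} (hF : HasSum F s)
    (hG : HasSum G t) : HasSum (fun p : ι × κ => F p.1 * G p.2) (s * t) :=
  hF.mul hG (summable_mul_of_summable_norm hF.summable.norm hG.summable.norm)

theorem ipTerm_insert {β : ℝ} (hβ : 0 < β) {a : Site d} {Λ : Finset (Site d)} (ha : a ∉ Λ)
    {f g : Op d} (hf : IsLocal Λ f) (hg : IsLocal Λ g) {s : ℂ} (h : HasSum (ipTerm β Λ f g) s) :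
    HasSum (ipTerm β (insert a Λ) f g) s := by
  have h1 : HasSum (fun k : ℕ => ((Real.exp (-β * k) / partition β : ℝ) : ℂ)) 1 := by
    have h0 := Complex.hasSum_ofReal.2 (partition_pos hβ).2
    rwa [Complex.ofReal_one] at h0
  have h2 := hasSum_diag h1
  have h3 := hasSum_prod_mul h h2
  rw [mul_one] at h3
  exact (splitPair a Λ ha).hasSum_iff.1 (h3.congr_fun fun p =>
    ipTerm_splitSite hβ ha hf hg (p.1.1, p.2.1) (p.1.2, p.2.2))

theorem ipTerm_mono {β : ℝ} (hβ : 0 < β) {Λ Λ' : Finset (Site d)} (hΛ : Λ ⊆ Λ')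
    {f g : Op d} (hf : IsLocal Λ f) (hg : IsLocal Λ g) {s : ℂ} (h : HasSum (ipTerm β Λ f g) s) :
    HasSum (ipTerm β Λ' f g) s := by
  have : ∀ R : Finset (Site d), HasSum (ipTerm β (R ∪ Λ) f g) s := by
    intro R
    induction R using Finset.induction_on with
    | empty =>
      rw [Finset.empty_union]
      exact h
    | insert a R _ ih =>
      rw [Finset.insert_union]
      by_cases ha : a ∈ R ∪ Λ
      · rwa [Finset.insert_eq_of_mem ha]
      · exact ipTerm_insert hβ ha (hf.mono Finset.subset_union_right)
          (hg.mono Finset.subset_union_right) ih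
  have h' := this Λ'
  rwa [Finset.union_eq_left.2 hΛ] at h'

theorem IsLocalL2.mono {β : ℝ} (hβ : 0 < β) {Λ Λ' : Finset (Site d)} (hΛ : Λ ⊆ Λ')
    {f : Op d} (hf : IsLocalL2 β Λ f) : IsLocalL2 β Λ' f :=
  ⟨hf.1.mono hΛ, (ipTerm_mono hβ hΛ hf.1 hf.1 hf.2.hasSum).summable⟩

theorem ipTerm_self (β : ℝ) (Λ : Finset (Site d)) (f : Op d) (p : FinCfg Λ × FinCfg Λ) :
    ipTerm β Λ f f p =
      ((Real.sqrt (density β Λ p.1) * Real.sqrt (density β Λ p.2) * ‖f p.1 p.2‖ ^ 2 : ℝ) : ℂ) := by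
  simp only [ipTerm]
  rw [← Complex.normSq_eq_conj_mul_self, Complex.normSq_eq_norm_sq]
  push_cast
  ring

theorem ipTerm_summable {β : ℝ} {Λ : Finset (Site d)} {f g : Op d}
    (hf : Summable (ipTerm β Λ f f)) (hg : Summable (ipTerm β Λ g g)) :
    Summable (ipTerm β Λ f g) := by
  refine Summable.of_norm_bounded (hf.norm.add hg.norm) fun p => ?_
  rw [ipTerm_self, ipTerm_self, Complex.norm_real, Complex.norm_real]
  set w := Real.sqrt (density β Λ p.1) * Real.sqrt (density β Λ p.2) with hw
  have hw0 : 0 ≤ w := mul_nonneg (Real.sqrt_nonneg _) (Real.sqrt_nonneg _)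
  have : ‖ipTerm β Λ f g p‖ = w * (‖f p.1 p.2‖ * ‖g p.1 p.2‖) := by
    simp [ipTerm, hw, abs_of_nonneg (Real.sqrt_nonneg _)]
  rw [this, Real.norm_of_nonneg (by positivity), Real.norm_of_nonneg (by positivity), ← mul_add]
  refine mul_le_mul_of_nonneg_left ?_ hw0
  nlinarith [sq_nonneg (‖f p.1 p.2‖ - ‖g p.1 p.2‖), sq_nonneg ‖f p.1 p.2‖, sq_nonneg ‖g p.1 p.2‖]

theorem ipTerm_conj (β : ℝ) (Λ : Finset (Site d)) (f g : Op d) (p : FinCfg Λ × FinCfg Λ) :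
    (starRingEnd ℂ) (ipTerm β Λ g f p) = ipTerm β Λ f g p := by
  simp [ipTerm]
  ring_nf
  tauto

theorem ipTerm_add_left (β : ℝ) (Λ : Finset (Site d)) (f f' g : Op d)
    (p : FinCfg Λ × FinCfg Λ) :
    ipTerm β Λ (f + f') g p = ipTerm β Λ f g p + ipTerm β Λ f' g p := by
  simp [ipTerm]
  ring

theorem ipTerm_smul_left (β : ℝ) (Λ : Finset (Site d)) (c : ℂ) (f g : Op d)
    (p : FinCfg Λ × FinCfg Λ) :
    ipTerm β Λ (c • f) g p = (starRingEnd ℂ) c * ipTerm β Λ f g p := by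
  simp [ipTerm]
  ring

theorem ipTerm_summable_add {β : ℝ} {Λ : Finset (Site d)} {f g : Op d}
    (hf : Summable (ipTerm β Λ f f)) (hg : Summable (ipTerm β Λ g g)) :
    Summable (ipTerm β Λ (f + g) (f + g)) := by
  have hfg := ipTerm_summable hf hg
  have hgf := ipTerm_summable hg hf
  refine ((hf.add hgf).add (hfg.add hg)).congr fun p => ?_
  rw [ipTerm_add_left, ← ipTerm_conj β Λ f (f + g), ← ipTerm_conj β Λ g (f + g),
    ipTerm_add_left, ipTerm_add_left, map_add, map_add, ipTerm_conj, ipTerm_conj, ipTerm_conj,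
    ipTerm_conj]
  ring

/-- The local operators `f` with `ω₀`-finite norm `Tr_Λ (ρ_Λ^{1/2} f^* ρ_Λ^{1/2} f)`. -/
def localL2 (d : ℕ) (β : ℝ) [hβ : Fact (0 < β)] : Submodule ℂ (Op d) where
  carrier := {f | ∃ Λ, IsLocalL2 β Λ f}
  add_mem' := by
    rintro f g ⟨Λ, hf⟩ ⟨Λ', hg⟩
    have hf' := hf.mono hβ.out (Finset.subset_union_left (s₂ := Λ'))
    have hg' := hg.mono hβ.out (Finset.subset_union_right (s₁ := Λ))
    exact ⟨Λ ∪ Λ', hf'.1.add hg'.1, ipTerm_summable_add hf'.2 hg'.2⟩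
  zero_mem' := by
    refine ⟨∅, ⟨fun _ _ _ => rfl, fun _ _ _ _ _ _ _ _ => rfl⟩, ?_⟩
    have : ipTerm (d := d) β ∅ 0 0 = fun _ => 0 := by
      funext p
      simp [ipTerm]
    rw [this]
    exact summable_zero
  smul_mem' := by
    rintro c f ⟨Λ, hf⟩
    refine ⟨Λ, hf.1.smul c, (hf.2.mul_left ((starRingEnd ℂ) c * c)).congr fun p => ?_⟩
    rw [ipTerm_smul_left, ← ipTerm_conj β Λ f (c • f), ipTerm_smul_left, map_mul, ipTerm_conj,
      Complex.conj_conj]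
    ring

/-- The scalar product `⟨f, g⟩ = lim_{Λ → ℤᵈ} Tr_Λ (ρ_Λ^{1/2} f^* ρ_Λ^{1/2} g)`. -/
def ip (β : ℝ) (f g : Op d) : ℂ := limUnder atTop fun Λ : Finset (Site d) => ∑' p, ipTerm β Λ f g p

theorem tendsto_ip {β : ℝ} [hβ : Fact (0 < β)] {f g : Op d} (hf : f ∈ localL2 d β)
    (hg : g ∈ localL2 d β) :
    ∃ Λ₀, (∀ Λ, Λ₀ ⊆ Λ → HasSum (ipTerm β Λ f g) (ip β f g)) ∧
      Tendsto (fun Λ : Finset (Site d) => ∑' p, ipTerm β Λ f g p) atTop (𝓝 (ip β f g)) := by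
  obtain ⟨Λ, hf⟩ := hf
  obtain ⟨Λ', hg⟩ := hg
  have hf' := hf.mono hβ.out (Finset.subset_union_left (s₂ := Λ'))
  have hg' := hg.mono hβ.out (Finset.subset_union_right (s₁ := Λ))
  obtain ⟨s, hs⟩ := ipTerm_summable hf'.2 hg'.2
  have hall : ∀ R, Λ ∪ Λ' ⊆ R → HasSum (ipTerm β R f g) s := fun R hR =>
    ipTerm_mono hβ.out hR hf'.1 hg'.1 hs
  have ht : Tendsto (fun Λ : Finset (Site d) => ∑' p, ipTerm β Λ f g p) atTop (𝓝 s) :=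
    tendsto_const_nhds.congr' ((eventually_ge_atTop (Λ ∪ Λ')).mono fun R hR =>
      (hall R hR).tsum_eq.symm)
  have hip : ip β f g = s := ht.limUnder_eq
  rw [hip]
  exact ⟨_, hall, ht⟩

/-- The local operators as a pre-Hilbert space. -/
def LocalSpace (d : ℕ) (β : ℝ) [Fact (0 < β)] : Type := localL2 d β

instance (β : ℝ) [Fact (0 < β)] : AddCommGroup (LocalSpace d β) :=
  inferInstanceAs (AddCommGroup (localL2 d β))

instance (β : ℝ) [Fact (0 < β)] : Module ℂ (LocalSpace d β) :=
  inferInstanceAs (Module ℂ (localL2 d β))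

/-- The scalar product of the product state `ω₀` on local operators. -/
@[reducible]
def localCore (d : ℕ) (β : ℝ) [Fact (0 < β)] : PreInnerProductSpace.Core ℂ (LocalSpace d β) where
  inner f g := ip β (Subtype.val f) (Subtype.val g)
  conj_inner_symm f g := by
    obtain ⟨_, -, h1⟩ := tendsto_ip g.2 f.2
    obtain ⟨_, -, h2⟩ := tendsto_ip f.2 g.2
    refine tendsto_nhds_unique ?_ h2
    refine ((Complex.continuous_conj.tendsto _).comp h1).congr fun Λ => ?_
    simp only [Function.comp_apply]
    rw [Complex.conj_tsum]
    exact tsum_congr fun p => ipTerm_conj β Λ _ _ p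
  re_inner_nonneg f := by
    obtain ⟨Λ, h1, -⟩ := tendsto_ip f.2 f.2
    have h2 := Complex.hasSum_re (h1 Λ subset_rfl)
    refine h2.nonneg fun p => ?_
    rw [ipTerm_self, Complex.ofReal_re]
    positivity
  add_left f f' g := by
    obtain ⟨Λ₁, h1, -⟩ := tendsto_ip f.2 g.2
    obtain ⟨Λ₂, h2, -⟩ := tendsto_ip f'.2 g.2
    obtain ⟨Λ₃, h3, -⟩ := tendsto_ip (f + f').2 g.2
    have h12 := (h1 (Λ₁ ∪ Λ₂ ∪ Λ₃) (by grind)).add (h2 (Λ₁ ∪ Λ₂ ∪ Λ₃) (by grind))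
    refine (h3 (Λ₁ ∪ Λ₂ ∪ Λ₃) (by grind)).unique ?_
    have he : ipTerm β (Λ₁ ∪ Λ₂ ∪ Λ₃) (f + f').1 g.1 = fun p =>
        ipTerm β (Λ₁ ∪ Λ₂ ∪ Λ₃) f.1 g.1 p + ipTerm β (Λ₁ ∪ Λ₂ ∪ Λ₃) f'.1 g.1 p := by
      funext p
      exact ipTerm_add_left β _ f.1 f'.1 g.1 p
    rw [he]
    exact h12
  smul_left f g c := by
    obtain ⟨Λ₁, h1, -⟩ := tendsto_ip f.2 g.2
    obtain ⟨Λ₂, h2, -⟩ := tendsto_ip (c • f).2 g.2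
    have h3 := (h1 (Λ₁ ∪ Λ₂) (by grind)).mul_left ((starRingEnd ℂ) c)
    refine (h2 (Λ₁ ∪ Λ₂) (by grind)).unique ?_
    have he : ipTerm β (Λ₁ ∪ Λ₂) (c • f).1 g.1 = fun p =>
        (starRingEnd ℂ) c * ipTerm β (Λ₁ ∪ Λ₂) f.1 g.1 p := by
      funext p
      exact ipTerm_smul_left β _ c f.1 g.1 p
    rw [he]
    exact h3

instance (β : ℝ) [Fact (0 < β)] : SeminormedAddCommGroup (LocalSpace d β) :=
  @InnerProductSpace.Core.toSeminormedAddCommGroup ℂ (LocalSpace d β) _ _ _ (localCore d β)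

instance (β : ℝ) [Fact (0 < β)] : InnerProductSpace ℂ (LocalSpace d β) :=
  InnerProductSpace.ofCore (localCore d β)

/-- The Hilbert space `L²(ω₀)`: the completion of the local operators for the scalar product
`⟨f, g⟩ = lim_Λ Tr_Λ (ρ_Λ^{1/2} f^* ρ_Λ^{1/2} g)`. -/
abbrev L2 (d : ℕ) (β : ℝ) [Fact (0 < β)] : Type := UniformSpace.Completion (LocalSpace d β)

/-- The compression of `K` to `H_Λ`, regarded as a local operator
(`(P_Λ K P_Λ)` on `H_Λ`, tensored with the identity). -/
def localize (Λ : Finset (Site d)) (K : Op d) : Op d := fun m n =>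
  if m.filter (fun j => j ∉ Λ) = n.filter (fun j => j ∉ Λ) then
    K (m.filter (fun j => j ∈ Λ)) (n.filter (fun j => j ∈ Λ)) else 0

theorem localize_eq_self {Λ Λ' : Finset (Site d)} (h : Λ ⊆ Λ') {f : Op d} (hf : IsLocal Λ f) :
    localize Λ' f = f := by
  have hf' := hf.mono h
  funext m n
  unfold localize
  split_ifs with hc
  · refine hf'.2 _ _ _ _ (fun j hj => by simp [hj]) (fun j hj => ?_)
      (fun j hj => by simp [hj]) (fun j hj => by simp [hj])
    have := DFunLike.congr_fun hc j
    simpa [hj] using this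
  · refine (hf'.1 m n ?_).symm
    by_contra hne
    push Not at hne
    refine hc (Finsupp.ext fun j => ?_)
    by_cases hj : j ∈ Λ'
    · simp [hj]
    · simpa [hj] using hne j hj

/-- The element of `L²(ω₀)` given by a local operator. -/
def ofLocal (β : ℝ) [Fact (0 < β)] (f : Op d) (hf : f ∈ localL2 d β) : L2 d β :=
  UniformSpace.Completion.coe' (show LocalSpace d β from ⟨f, hf⟩)

/-- The (not necessarily local) operator `K` is the element `Ψ` of `L²(ω₀)`: the compressions of
`K` to `H_Λ` converge to `Ψ` as `Λ → ℤᵈ`. -/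
def Rep (β : ℝ) [Fact (0 < β)] (K : Op d) (Ψ : L2 d β) : Prop :=
  ∃ h : ∀ Λ, localize Λ K ∈ localL2 d β,
    Tendsto (fun Λ : Finset (Site d) => ofLocal β (localize Λ K) (h Λ)) atTop (𝓝 Ψ)

/-- The operator `K` belongs to `L²(ω₀)`. -/
def InL2 (β : ℝ) [Fact (0 < β)] (K : Op d) : Prop := ∃ Ψ : L2 d β, Rep β K Ψ

open Classical in
/-- The element of `L²(ω₀)` given by `K` (and `0` if `K` does not belong to `L²(ω₀)`). -/
def cls (β : ℝ) [Fact (0 < β)] (K : Op d) : L2 d β :=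
  if h : InL2 β K then h.choose else 0

theorem Rep.unique {β : ℝ} [Fact (0 < β)] {K : Op d} {Ψ Ψ' : L2 d β} (h : Rep β K Ψ)
    (h' : Rep β K Ψ') : Ψ = Ψ' := by
  obtain ⟨_, h⟩ := h
  obtain ⟨_, h'⟩ := h'
  exact tendsto_nhds_unique h h'

theorem Rep.cls_eq {β : ℝ} [Fact (0 < β)] {K : Op d} {Ψ : L2 d β} (h : Rep β K Ψ) :
    cls β K = Ψ := by
  have h1 : InL2 β K := ⟨Ψ, h⟩
  rw [cls, dif_pos h1]
  exact h1.choose_spec.unique h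

/-- The scalar product `⟨f, g⟩` of two operators in `L²(ω₀)`. -/
def scal (β : ℝ) [Fact (0 < β)] (f g : Op d) : ℂ := inner ℂ (cls β f) (cls β g)

/-! ### Modular dynamics, adjoint derivations -/

/-- The modular dynamics `α_z (X) = e^{-izβN} X e^{izβN}`, where `N` is the total number operator,
with eigenvalue `|m| = ∑_j m_j` at `e_m`; here `z` may be complex. It is the limit of
`ρ_Λ^{iz} X ρ_Λ^{-iz}` as `Λ → ℤᵈ`. -/
def modular (β : ℝ) (z : ℂ) (X : Op d) : Op d := fun m n =>
  Complex.exp (-(Complex.I * z * β * ((m.degree : ℂ) - (n.degree : ℂ)))) * X m n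

theorem modular_eq_limit {β : ℝ} (hβ : 0 < β) (z : ℂ) (X : Op d) (m n : Cfg d) :
    Tendsto (fun Λ : Finset (Site d) => ((density β Λ m : ℝ) : ℂ) ^ (Complex.I * z) * X m n *
      ((density β Λ n : ℝ) : ℂ) ^ (-(Complex.I * z))) atTop (𝓝 (modular β z X m n)) := by
  refine tendsto_const_nhds.congr' ((eventually_ge_atTop (m.support ∪ n.support)).mono
    fun Λ hΛ => ?_)
  beta_reduce
  have hpos := (partition_pos hβ).1
  have hd : ∀ q : Cfg d, q.support ⊆ Λ →
      density β Λ q = Real.exp (-β * q.degree - Λ.card * Real.log (partition β)) := by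
    intro q hq
    have h1 : ∀ j ∈ Λ, Real.exp (-β * q j) / partition β =
        Real.exp (-β * q j - Real.log (partition β)) := fun j _ => by
      rw [Real.exp_sub, Real.exp_log hpos]
    rw [density, Finset.prod_congr rfl h1, ← Real.exp_sum]
    congr 1
    have h2 : q.degree = ∑ j ∈ Λ, q j :=
      Finset.sum_subset hq fun j _ hj => by simpa using hj
    rw [Finset.sum_sub_distrib, ← Finset.mul_sum, h2]
    simp
  rw [hd m (Finset.subset_union_left.trans hΛ), hd n (Finset.subset_union_right.trans hΛ),
    Complex.cpow_def_of_ne_zero (by exact_mod_cast (Real.exp_pos _).ne'),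
    Complex.cpow_def_of_ne_zero (by exact_mod_cast (Real.exp_pos _).ne'),
    ← Complex.ofReal_log (Real.exp_pos _).le, ← Complex.ofReal_log (Real.exp_pos _).le,
    Real.log_exp, Real.log_exp, mul_right_comm, ← Complex.exp_add, modular]
  congr 2
  push_cast
  ring

/-- `δ_X^⋆ (g) = i (g α_{-i/2}(X^*) - α_{i/2}(X^*) g)`. -/
def deltaStar (β : ℝ) (X g : Op d) : Op d :=
  Complex.I • (mul g (modular β (-(Complex.I / 2)) (adj X)) -
    mul (modular β (Complex.I / 2) (adj X)) g)

/-! ### The fields -/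

/-- The translate `(T_j κ)_l = κ_{l - j}`. -/
def shift (j : Site d) (κ : Site d → ℂ) : Site d → ℂ := fun l => κ (l - j)

/-- The field `Z_κ = ∑_j κ_j A_j`. -/
def zField (κ : Site d → ℂ) : Op d := fun m n => ∑' j, κ j * ann j m n

/-- The field `Y_{κ, ξ} = Z_κ - Z_ξ^*`. -/
def yField (κ ξ : Site d → ℂ) : Op d := zField κ - adj (zField ξ)

/-! ### Admissible functions, Dirichlet forms, generators -/

/-- Admissible functions. -/
structure Admissible (η : ℂ → ℂ) : Prop where
  analytic : AnalyticOnNhd ℂ η {z | |z.im| ≤ 1 / 4}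
  nonneg : ∀ t : ℝ, (η t).im = 0 ∧ 0 ≤ (η t).re
  nonneg_shift : ∀ t : ℝ, (η (t + Complex.I / 4) + η (t - Complex.I / 4)).im = 0 ∧
    0 ≤ (η (t + Complex.I / 4) + η (t - Complex.I / 4)).re
  decay : ∃ M p : ℝ, 0 < M ∧ 1 < p ∧ ∀ t s : ℝ, |s| ≤ 1 / 4 →
    ‖η (t + s * Complex.I)‖ ≤ M * (1 + |t|) ^ (-p)

/-- `η̂ (s) = ∫ η(t) e^{ist} dt`. -/
def etaHat (η : ℂ → ℂ) (s : ℝ) : ℂ := ∫ t : ℝ, η t * Complex.exp (Complex.I * s * t)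

/-- The function `t ↦ ⟨δ_{α_t(X)} (g), δ_{α_t(X)} (f)⟩ η(t)`. -/
def formIntegrand (β : ℝ) [Fact (0 < β)] (η : ℂ → ℂ) (X g f : Op d) (t : ℝ) : ℂ :=
  scal β (delta (modular β t X) g) (delta (modular β t X) f) * η t

/-- The (sesquilinear) form
`E(g, f) = ∑_j ∫ ⟨δ_{α_t(X_j)} (g), δ_{α_t(X_j)} (f)⟩ η(t) dt`
in the directions `X_j`. -/
def form (β : ℝ) [Fact (0 < β)] (η : ℂ → ℂ) (X : Site d → Op d) (g f : Op d) : ℂ :=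
  ∑' j, ∫ t : ℝ, formIntegrand β η (X j) g f t

/-- Everything in the definition of `form X g f` makes sense. -/
structure FormConverges (β : ℝ) [Fact (0 < β)] (η : ℂ → ℂ) (X : Site d → Op d) (g f : Op d) :
    Prop where
  inL2_left : ∀ j (t : ℝ), InL2 β (delta (modular β t (X j)) g)
  inL2_right : ∀ j (t : ℝ), InL2 β (delta (modular β t (X j)) f)
  integrable : ∀ j, Integrable (formIntegrand β η (X j) g f)
  summable : Summable fun j => ∫ t : ℝ, formIntegrand β η (X j) g f t

/-- The Dirichlet form in the directions `X_j` and `X_j^*`. -/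
def dirichletForm (β : ℝ) [Fact (0 < β)] (η : ℂ → ℂ) (X : Site d → Op d) (g f : Op d) : ℂ :=
  form β η X g f + form β η (fun j => adj (X j)) g f

/-- `∑_j ⟨δ_{X_j} (f), δ_{W_j} (f)⟩`. -/
def pairing (β : ℝ) [Fact (0 < β)] (X W : Site d → Op d) (f : Op d) : ℂ :=
  ∑' j, scal β (delta (X j) f) (delta (W j) f)

/-- Everything in the definition of `pairing X W f` makes sense. -/
structure PairingConverges (β : ℝ) [Fact (0 < β)] (X W : Site d → Op d) (f : Op d) : Prop where
  inL2_left : ∀ j, InL2 β (delta (X j) f)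
  inL2_right : ∀ j, InL2 β (delta (W j) f)
  summable : Summable fun j => scal β (delta (X j) f) (delta (W j) f)

/-- The matrix element of
`(δ_{α_t(X)}^⋆ δ_{α_t(X)} (f) + δ_{α_t(X^*)}^⋆ δ_{α_t(X^*)} (f)) η(t)`. -/
def genIntegrand (β : ℝ) (η : ℂ → ℂ) (X f : Op d) (m n : Cfg d) (t : ℝ) : ℂ :=
  (deltaStar β (modular β t X) (delta (modular β t X) f) m n +
    deltaStar β (modular β t (adj X)) (delta (modular β t (adj X)) f) m n) * η t

/-- The operator `L` with
`-L (f) = ∑_j ∫ (δ_{α_t(X_j)}^⋆ δ_{α_t(X_j)} (f) + δ_{α_t(X_j^*)}^⋆ δ_{α_t(X_j^*)} (f)) η(t) dt`. -/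
def generator (β : ℝ) (η : ℂ → ℂ) (X : Site d → Op d) (f : Op d) : Op d :=
  fun m n => -∑' j, ∫ t : ℝ, genIntegrand β η (X j) f m n t

/-- The integrals and the series in the definition of `generator β η X f` converge. -/
def GeneratorConverges (β : ℝ) (η : ℂ → ℂ) (X : Site d → Op d) (f : Op d) : Prop :=
  ∀ m n, (∀ j, Integrable (genIntegrand β η (X j) f m n)) ∧
    Summable fun j => ∫ t : ℝ, genIntegrand β η (X j) f m n t

/-- `X` is non-negative: `⟨v, X v⟩ ≥ 0` for all finite linear combinations `v` of the `e_m`. -/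
def NonnegOp (X : Op d) : Prop := ∀ v : Cfg d →₀ ℂ,
  (v.sum fun m a => v.sum fun n b => (starRingEnd ℂ) a * X m n * b).im = 0 ∧
  0 ≤ (v.sum fun m a => v.sum fun n b => (starRingEnd ℂ) a * X m n * b).re

/-- `2 Γ₁(f) = L (f^* f) - f^* L (f) - L (f^*) f`. -/
def carreDuChamp (L : Op d → Op d) (f : Op d) : Op d :=
  L (mul (adj f) f) - mul (adj f) (L f) - mul (L (adj f)) f

/-- `L`, with domain the unital `*`-algebra `D`, is a pre-Markov generator in `L²(ω₀)`, with
the form `E`: it is a densely defined linear operator with `E (g, f) = ⟨g, -L f⟩`, it is symmetric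
and non-positive, it preserves adjoints, kills the identity, and is dissipative. -/
structure IsPreMarkovGenerator (β : ℝ) [Fact (0 < β)] (D : Submodule ℂ (Op d))
    (E : Op d → Op d → ℂ) (L : Op d → Op d) : Prop where
  one_mem : one ∈ D
  adj_mem : ∀ f ∈ D, adj f ∈ D
  mul_mem : ∀ f ∈ D, ∀ g ∈ D, mul f g ∈ D
  inL2 : ∀ f ∈ D, InL2 β f
  dense : Dense (cls β '' (D : Set (Op d)))
  map_inL2 : ∀ f ∈ D, InL2 β (L f)
  map_add : ∀ f ∈ D, ∀ g ∈ D, L (f + g) = L f + L g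
  map_smul : ∀ (c : ℂ), ∀ f ∈ D, L (c • f) = c • L f
  form_eq : ∀ f ∈ D, ∀ g ∈ D, E g f = -scal β g (L f)
  symm : ∀ f ∈ D, ∀ g ∈ D, scal β g (L f) = scal β (L g) f
  nonpos : ∀ f ∈ D, (scal β f (L f)).re ≤ 0
  map_adj : ∀ f ∈ D, L (adj f) = adj (L f)
  map_one : L one = 0
  dissipative : ∀ f ∈ D, NonnegOp (carreDuChamp L f)

end

end YFields

open YFields

/-! ### Algebra of infinite matrices, derivations and Leibniz rules. -/

namespace YFields
noncomputable section
variable {d : ℕ}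

/-! ### Matrices with finite rows and columns -/

/-! Two features make everything explicit: observables are local, and the modular dynamics
multiplies an annihilation or creation operator by a scalar phase. A ladder operator at a site
outside the region of `f` commutes with `f`, so for an observable `f` the derivation along an
infinite field `∑ c_l A_l` is a finite sum over the region (`IsLocal.delta_lin`) and is again an
observable. The phases turn the integrand of the form into a trigonometric polynomial in `t` with
frequencies `0` and `±2β`, whose integral against `η` gives values of `η̂`
(`integral_formIntegrand`). The sum over translates only produces correlations `∑_j conj (c'_{l'-j})
c_{l-j}` of `ℓ¹` functions, which converge absolutely. This proves convergence and the
representation formula.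

Finiteness of norms comes from Gaussian-free bookkeeping with the weights `exp (-θ (|m| + |n|))`: a
ladder operator costs a linear factor, absorbed by passing from `θ/2` to `θ`, so every observable
has finite weighted norms for all `θ > 0` (`tame_of_isObs`).

For the generator, `δ^⋆` is the adjoint of `δ` on ladder operators (`scal_delta_ladder`). Outside
the region of `f`, `δ^⋆ (f)` does not vanish, but by the commutation relations its norm is a fixed
multiple of the norm of `f`. With summable correlations the series for `-L f` therefore converges in
`L²(ω₀)`, and pairing it with an observable gives back the form (`genSum_inL2`). Symmetry and
non-positivity are then inherited from the form.

Dissipativity is an inequality for `η̂`. Moving the contour to the lines `Im z = ±1/4` shows that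
the non-negative function `η(t + i/4) + η(t - i/4)` has Fourier transform `2 cosh (w/4) η̂(w)`,
whence `2 cosh (β/2) |η̂(2β)| ≤ 2 η̂(0)` (`Admissible.norm_etaHat_le`). The Leibniz defects in the
directions `Y_j` and `Y_j^*` together form two Hermitian `2 × 2` quadratic expressions, and this
inequality is exactly the determinant condition for them to be non-negative
(`nonneg_genPart_leibniz`).

For density and the core property, Taylor polynomials of `sin (πx) / (πx)` in the number operators
approximate point masses on the integers; they grow at most like `exp (π|x|)`, which the damping
`exp (-ε x^{1+δ})` dominates uniformly. Hence damped polynomials approximate all matrix units, in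
every weighted norm (`exists_damped_poly`). Using the norm with `θ = β/4`, stronger than that of
`L²(ω₀)`, also controls one derivation, hence the form. -/

/-- Every row of `X` has finitely many non-zero entries. -/
def RowFin (X : Op d) : Prop := ∀ m, (Function.support (X m)).Finite

/-- Every column of `X` has finitely many non-zero entries. -/
def ColFin (X : Op d) : Prop := ∀ n, (Function.support fun m => X m n).Finite

theorem adj_adj (X : Op d) : adj (adj X) = X := by
  funext m n
  simp [adj]

theorem rowFin_adj {X : Op d} : RowFin (adj X) ↔ ColFin X := by
  refine forall_congr' fun m => ?_
  have : Function.support (adj X m) = Function.support fun p => X p m := by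
    ext p
    simp [adj]
  rw [this]

theorem colFin_adj {X : Op d} : ColFin (adj X) ↔ RowFin X := by
  rw [← rowFin_adj, adj_adj]

theorem RowFin.summable {X : Op d} (hX : RowFin X) (Y : Op d) (m n : Cfg d) :
    Summable fun p => X m p * Y p n := by
  refine summable_of_hasFiniteSupport ((hX m).subset fun p hp => ?_)
  exact left_ne_zero_of_mul hp

theorem ColFin.summable {Y : Op d} (hY : ColFin Y) (X : Op d) (m n : Cfg d) :
    Summable fun p => X m p * Y p n := by
  refine summable_of_hasFiniteSupport ((hY n).subset fun p hp => ?_)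
  exact right_ne_zero_of_mul hp

theorem adj_mul (X Y : Op d) : adj (mul X Y) = mul (adj Y) (adj X) := by
  funext m n
  simp only [adj, mul, Complex.conj_tsum, map_mul]
  exact tsum_congr fun p => mul_comm _ _

theorem adj_add (X Y : Op d) : adj (X + Y) = adj X + adj Y := by
  funext m n
  simp [adj]

theorem adj_sub (X Y : Op d) : adj (X - Y) = adj X - adj Y := by
  funext m n
  simp [adj]

theorem adj_smul (c : ℂ) (X : Op d) : adj (c • X) = (starRingEnd ℂ) c • adj X := by
  funext m n
  simp [adj]

theorem adj_one : adj (one : Op d) = one := by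
  funext m n
  by_cases h : m = n
  · simp [adj, one, h]
  · simp [adj, one, h, Ne.symm h]

theorem adj_damp (ε δ : ℝ) (Λ : Finset (Site d)) : adj (damp ε δ Λ) = damp ε δ Λ := by
  funext m n
  by_cases h : m = n
  · subst h
    simp only [adj, damp, if_true, Complex.conj_ofReal]
  · simp [adj, damp, h, Ne.symm h]

theorem one_mul_op (X : Op d) : mul one X = X := by
  funext m n
  rw [mul, tsum_eq_single m]
  · simp [one]
  · intro p hp
    simp [one, hp.symm]

theorem mul_one_op (X : Op d) : mul X one = X := by
  funext m n
  rw [mul, tsum_eq_single n]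
  · simp [one]
  · intro p hp
    simp [one, hp]

theorem smul_mul_op (c : ℂ) (X Y : Op d) : mul (c • X) Y = c • mul X Y := by
  funext m n
  simp only [mul, Pi.smul_apply, smul_eq_mul, mul_assoc, tsum_mul_left]

theorem mul_smul_op (c : ℂ) (X Y : Op d) : mul X (c • Y) = c • mul X Y := by
  funext m n
  simp only [mul, Pi.smul_apply, smul_eq_mul, mul_left_comm _ c, tsum_mul_left]

theorem ColFin.add_mul {Y : Op d} (hY : ColFin Y) (X X' : Op d) :
    mul (X + X') Y = mul X Y + mul X' Y := by
  funext m n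
  simp only [mul, Pi.add_apply, _root_.add_mul]
  exact (hY.summable X m n).tsum_add (hY.summable X' m n)

theorem RowFin.mul_add {X : Op d} (hX : RowFin X) (Y Y' : Op d) :
    mul X (Y + Y') = mul X Y + mul X Y' := by
  funext m n
  simp only [mul, Pi.add_apply, _root_.mul_add]
  exact (hX.summable Y m n).tsum_add (hX.summable Y' m n)

theorem neg_mul_op (X Y : Op d) : mul (-X) Y = -mul X Y := by
  rw [← neg_one_smul ℂ X, smul_mul_op, neg_one_smul]

theorem mul_neg_op (X Y : Op d) : mul X (-Y) = -mul X Y := by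
  rw [← neg_one_smul ℂ Y, mul_smul_op, neg_one_smul]

theorem ColFin.sub_mul {Y : Op d} (hY : ColFin Y) (X X' : Op d) :
    mul (X - X') Y = mul X Y - mul X' Y := by
  rw [sub_eq_add_neg, hY.add_mul, neg_mul_op, ← sub_eq_add_neg]

theorem RowFin.mul_sub {X : Op d} (hX : RowFin X) (Y Y' : Op d) :
    mul X (Y - Y') = mul X Y - mul X Y' := by
  rw [sub_eq_add_neg, hX.mul_add, mul_neg_op, ← sub_eq_add_neg]

/-- Products are given by `tsum`, so associativity is a change of order of summation; it is harmless
when only finitely many paths `m → p → q → n` contribute. -/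
theorem mul_assoc_of_finite {X Y Z : Op d}
    (h : ∀ m n, (Function.support fun q : Cfg d × Cfg d => X m q.1 * Y q.1 q.2 * Z q.2 n).Finite) :
    mul (mul X Y) Z = mul X (mul Y Z) := by
  funext m n
  have h1 : Summable (Function.uncurry fun p q => X m p * Y p q * Z q n) :=
    summable_of_hasFiniteSupport (h m n)
  calc ∑' q, (∑' p, X m p * Y p q) * Z q n
      = ∑' q, ∑' p, X m p * Y p q * Z q n := tsum_congr fun q => tsum_mul_right.symm
    _ = ∑' p, ∑' q, X m p * Y p q * Z q n := h1.tsum_comm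
    _ = ∑' p, X m p * ∑' q, Y p q * Z q n := tsum_congr fun p => by
        rw [← tsum_mul_left]
        exact tsum_congr fun q => mul_assoc _ _ _

/-- Rows and columns of `X` have finitely many non-zero entries. -/
structure LocFin (X : Op d) : Prop where
  row : RowFin X
  col : ColFin X

theorem RowFin.mul_assoc {X Y : Op d} (hX : RowFin X) (hY : RowFin Y) (Z : Op d) :
    mul (mul X Y) Z = mul X (mul Y Z) := by
  refine mul_assoc_of_finite fun m n => ?_
  refine ((hX m).biUnion fun p _ => (Set.finite_singleton p).prod (hY p)).subset ?_
  rintro ⟨p, q⟩ h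
  have h1 := left_ne_zero_of_mul h
  simp only [Set.mem_iUnion]
  exact ⟨p, left_ne_zero_of_mul h1, rfl, right_ne_zero_of_mul h1⟩

theorem ColFin.mul_assoc {Y Z : Op d} (hY : ColFin Y) (hZ : ColFin Z) (X : Op d) :
    mul (mul X Y) Z = mul X (mul Y Z) := by
  refine mul_assoc_of_finite fun m n => ?_
  refine ((hZ n).biUnion fun q _ => (hY q).prod (Set.finite_singleton q)).subset ?_
  rintro ⟨p, q⟩ h
  have h1 := left_ne_zero_of_mul h
  simp only [Set.mem_iUnion]
  exact ⟨q, right_ne_zero_of_mul h, right_ne_zero_of_mul h1, rfl⟩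

/-- The middle factor is arbitrary. This matters because a field with infinitely many non-zero
coefficients has infinite rows or infinite columns. -/
theorem RowFin.mul_assoc_colFin {X Z : Op d} (hX : RowFin X) (hZ : ColFin Z) (Y : Op d) :
    mul (mul X Y) Z = mul X (mul Y Z) := by
  refine mul_assoc_of_finite fun m n => ?_
  refine ((hX m).prod (hZ n)).subset ?_
  rintro ⟨p, q⟩ h
  exact ⟨left_ne_zero_of_mul (left_ne_zero_of_mul h), right_ne_zero_of_mul h⟩

theorem RowFin.add {X Y : Op d} (hX : RowFin X) (hY : RowFin Y) : RowFin (X + Y) := fun m =>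
  ((hX m).union (hY m)).subset (Function.support_add _ _)

theorem RowFin.smul {X : Op d} (c : ℂ) (hX : RowFin X) : RowFin (c • X) := fun m =>
  (hX m).subset (Function.support_const_smul_subset c _)

theorem RowFin.mul {X Y : Op d} (hX : RowFin X) (hY : RowFin Y) : RowFin (mul X Y) := fun m => by
  refine ((hX m).biUnion fun p _ => hY p).subset fun n hn => ?_
  by_contra h
  refine hn ?_
  simp only [Set.mem_iUnion, not_exists, Function.mem_support, not_not] at h
  have h0 : ∀ p, X m p * Y p n = 0 := fun p => by
    by_cases hp : X m p = 0
    · rw [hp, zero_mul]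
    · rw [h p hp, mul_zero]
  simp [YFields.mul, h0]

theorem LocFin.adj {X : Op d} (hX : LocFin X) : LocFin (adj X) :=
  ⟨rowFin_adj.2 hX.col, colFin_adj.2 hX.row⟩

theorem LocFin.add {X Y : Op d} (hX : LocFin X) (hY : LocFin Y) : LocFin (X + Y) :=
  ⟨hX.row.add hY.row, rowFin_adj.1 (by rw [adj_add]; exact hX.adj.row.add hY.adj.row)⟩

theorem LocFin.smul {X : Op d} (c : ℂ) (hX : LocFin X) : LocFin (c • X) :=
  ⟨hX.row.smul c, rowFin_adj.1 (by rw [adj_smul]; exact hX.adj.row.smul _)⟩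

theorem LocFin.comp {X Y : Op d} (hX : LocFin X) (hY : LocFin Y) : LocFin (mul X Y) :=
  ⟨hX.row.mul hY.row, rowFin_adj.1 (by rw [adj_mul]; exact hY.adj.row.mul hX.adj.row)⟩

theorem LocFin.of_diagonal {X : Op d} (h : ∀ m n, m ≠ n → X m n = 0) : LocFin X :=
  ⟨fun m => (Set.finite_singleton m).subset fun n hn => by
      by_contra hne
      exact hn (h m n fun he => hne he.symm),
    fun n => (Set.finite_singleton n).subset fun m hm => by
      by_contra hne
      exact hm (h m n hne)⟩

theorem locFin_one : LocFin (one : Op d) := .of_diagonal fun m n h => by simp [one, h]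

theorem locFin_damp (ε δ : ℝ) (Λ : Finset (Site d)) : LocFin (damp ε δ Λ) :=
  .of_diagonal fun m n h => by simp [damp, h]

theorem locFin_ann (j : Site d) : LocFin (ann j) := by
  refine ⟨fun m => (Set.finite_singleton (m + Finsupp.single j 1)).subset fun n hn => ?_,
    fun n => (Set.finite_singleton (n - Finsupp.single j 1)).subset fun m hm => ?_⟩
  · by_contra hne
    exact hn (if_neg hne)
  · by_contra hne
    refine hm (if_neg ?_)
    rintro rfl
    exact hne (by simp)

theorem IsObs.locFin {f : Op d} (hf : IsObs f) : LocFin f := by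
  induction hf with
  | one => exact locFin_one
  | ann j => exact locFin_ann j
  | cre j => exact (locFin_ann j).adj
  | damp ε δ _ _ Λ => exact locFin_damp ε δ Λ
  | add F G _ _ hF hG => exact hF.add hG
  | smul c F _ hF => exact hF.smul c
  | mul F G _ _ hF hG => exact hF.comp hG

theorem IsObs.adj {f : Op d} (hf : IsObs f) : IsObs (adj f) := by
  induction hf with
  | one => rw [adj_one]; exact .one
  | ann j => exact .cre j
  | cre j => rw [adj_adj]; exact .ann j
  | damp ε δ hε hδ Λ => rw [adj_damp]; exact .damp ε δ hε hδ Λ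
  | add F G _ _ hF hG => rw [adj_add]; exact .add _ _ hF hG
  | smul c F _ hF => rw [adj_smul]; exact .smul _ _ hF
  | mul F G _ _ hF hG => rw [adj_mul]; exact .mul _ _ hG hF

theorem IsObs.sub {f g : Op d} (hf : IsObs f) (hg : IsObs g) : IsObs (f - g) := by
  rw [sub_eq_add_neg, ← neg_one_smul ℂ g]
  exact .add _ _ hf (.smul _ _ hg)

theorem isObs_sum {ι : Type*} (s : Finset ι) {f : ι → Op d} (hf : ∀ i ∈ s, IsObs (f i)) :
    IsObs (∑ i ∈ s, f i) :=
  (obs d).sum_mem (t := s) (f := f) hf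

theorem IsPoly.isObs {Λ : Finset (Site d)} {F : Op d} (hF : IsPoly Λ F) : IsObs F := by
  induction hF with
  | one => exact .one
  | ann j _ => exact .ann j
  | cre j _ => exact .cre j
  | add F G _ _ hF hG => exact .add _ _ hF hG
  | smul c F _ hF => exact .smul _ _ hF
  | mul F G _ _ hF hG => exact .mul _ _ hF hG

/-! ### Derivations -/

theorem delta_apply (X f : Op d) (m n : Cfg d) :
    delta X f m n = Complex.I * (mul X f m n - mul f X m n) := rfl

theorem adj_delta (X f : Op d) : adj (delta X f) = delta (adj X) (adj f) := by
  rw [delta, adj_smul, adj_sub, adj_mul, adj_mul, delta, Complex.conj_I, neg_smul, ← smul_neg,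
    neg_sub]

theorem delta_one (X : Op d) : delta X one = 0 := by
  rw [delta, one_mul_op, mul_one_op, sub_self, smul_zero]

theorem delta_smul_left (c : ℂ) (X f : Op d) : delta (c • X) f = c • delta X f := by
  rw [delta, smul_mul_op, mul_smul_op, ← smul_sub, smul_comm, delta]

theorem delta_smul_right (c : ℂ) (X f : Op d) : delta X (c • f) = c • delta X f := by
  rw [delta, smul_mul_op, mul_smul_op, ← smul_sub, smul_comm, delta]

theorem LocFin.delta_add_left {f : Op d} (hf : LocFin f) (X X' : Op d) :
    delta (X + X') f = delta X f + delta X' f := by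
  rw [delta, hf.col.add_mul, hf.row.mul_add, add_sub_add_comm, smul_add, delta, delta]

theorem LocFin.delta_add {f g : Op d} (hf : LocFin f) (hg : LocFin g) (X : Op d) :
    delta X (f + g) = delta X f + delta X g := by
  have h1 : mul X (f + g) = mul X f + mul X g := by
    funext m n
    simp only [mul, Pi.add_apply, _root_.mul_add]
    exact (hf.col.summable X m n).tsum_add (hg.col.summable X m n)
  have h2 : mul (f + g) X = mul f X + mul g X := by
    funext m n
    simp only [mul, Pi.add_apply, _root_.add_mul]
    exact (hf.row.summable X m n).tsum_add (hg.row.summable X m n)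
  rw [delta, h1, h2, add_sub_add_comm, smul_add, delta, delta]

/-- `X` is unrestricted: it stands to the left, in the middle and to the right of `f` and `g`, and
each position uses its own criterion for associativity. -/
theorem LocFin.delta_mul {f g : Op d} (hf : LocFin f) (hg : LocFin g) (X : Op d) :
    delta X (mul f g) = mul (delta X f) g + mul f (delta X g) := by
  rw [delta, delta, delta, smul_mul_op, mul_smul_op, hg.col.sub_mul, hf.row.mul_sub, ← smul_add,
    hf.row.mul_assoc hg.row, ← hf.col.mul_assoc hg.col, hf.row.mul_assoc_colFin hg.col]
  congr 1
  abel

/-- The operator `i (g V - V' g)`. -/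
def twist (V V' g : Op d) : Op d := Complex.I • (mul g V - mul V' g)

theorem LocFin.twist_add {f g : Op d} (hf : LocFin f) (hg : LocFin g) (V V' : Op d) :
    twist V V' (f + g) = twist V V' f + twist V V' g := by
  have h1 : mul V' (f + g) = mul V' f + mul V' g := by
    funext m n
    simp only [mul, Pi.add_apply, _root_.mul_add]
    exact (hf.col.summable V' m n).tsum_add (hg.col.summable V' m n)
  have h2 : mul (f + g) V = mul f V + mul g V := by
    funext m n
    simp only [mul, Pi.add_apply, _root_.add_mul]
    exact (hf.row.summable V m n).tsum_add (hg.row.summable V m n)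
  rw [twist, h1, h2, add_sub_add_comm, smul_add, twist, twist]

theorem twist_smul (c : ℂ) (V V' g : Op d) : twist V V' (c • g) = c • twist V V' g := by
  rw [twist, smul_mul_op, mul_smul_op, ← smul_sub, smul_comm, twist]

theorem LocFin.twist_add_left {g : Op d} (hg : LocFin g) (V V' W W' : Op d) :
    twist (V + W) (V' + W') g = twist V V' g + twist W W' g := by
  rw [twist, hg.col.add_mul, hg.row.mul_add, add_sub_add_comm, smul_add, twist, twist]

theorem twist_smul_left (c : ℂ) (V V' g : Op d) :
    twist (c • V) (c • V') g = c • twist V V' g := by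
  rw [twist, smul_mul_op, mul_smul_op, ← smul_sub, smul_comm, twist]

theorem deltaStar_eq_twist (β : ℝ) (X g : Op d) :
    deltaStar β X g =
      twist (modular β (-(Complex.I / 2)) (adj X)) (modular β (Complex.I / 2) (adj X)) g := rfl

/-- The defect of the Leibniz rule for `f ↦ i (δ_X(f) V - V' δ_X(f))`. -/
theorem twist_delta_mul {f g : Op d} (hf : LocFin f) (hg : LocFin g) {X : Op d} (V V' : Op d)
    (hXf : LocFin (delta X f)) (hXg : LocFin (delta X g)) :
    twist V V' (delta X (mul f g)) - mul f (twist V V' (delta X g)) -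
      mul (twist V V' (delta X f)) g =
    -(mul (delta X f) (delta V g) + mul (delta V' f) (delta X g)) := by
  rw [hf.delta_mul hg, (hXf.comp hg).twist_add (hf.comp hXg)]
  simp only [twist, smul_mul_op, mul_smul_op, hg.col.sub_mul, hf.row.mul_sub]
  -- Finiteness is only used for `f`, `g` and their derivatives; `V` and `V'` will be adjoints of
  -- infinite fields.
  rw [hXf.row.mul_assoc hg.row, ← hXf.col.mul_assoc hg.col V', hf.row.mul_assoc hXg.row,
    hXf.row.mul_assoc_colFin hg.col, ← hf.col.mul_assoc hXg.col V']
  rw [delta.eq_def V g, delta.eq_def V' f, mul_smul_op, smul_mul_op, hXf.row.mul_sub,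
    hXg.col.sub_mul, hf.row.mul_assoc_colFin hXg.col]
  simp only [smul_sub, neg_add, neg_sub]
  abel

end
end YFields
-- Locality, ladder operators and the commutation relations.
namespace YFields
noncomputable section
variable {d : ℕ}

/-! ### Local operators -/

theorem IsLocal.adj {Λ : Finset (Site d)} {f : Op d} (hf : IsLocal Λ f) : IsLocal Λ (adj f) := by
  refine ⟨fun m n ⟨j, hj, hne⟩ => ?_, fun m n m' n' h1 h2 h3 h4 => ?_⟩
  · simp [YFields.adj, hf.1 n m ⟨j, hj, hne.symm⟩]
  · simp only [YFields.adj]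
    rw [hf.2 n m n' m' (fun j hj => (h1 j hj).symm) (fun j hj => (h2 j hj).symm) h4 h3]

theorem IsLocal.sub {Λ : Finset (Site d)} {f g : Op d} (hf : IsLocal Λ f) (hg : IsLocal Λ g) :
    IsLocal Λ (f - g) := by
  rw [sub_eq_add_neg, ← neg_one_smul ℂ g]
  exact hf.add (hg.smul _)

theorem isLocal_zero (Λ : Finset (Site d)) : IsLocal Λ (0 : Op d) :=
  ⟨fun _ _ _ => rfl, fun _ _ _ _ _ _ _ _ => rfl⟩

theorem isLocal_of_diagonal {Λ : Finset (Site d)} {φ : Cfg d → ℂ}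
    (hφ : ∀ n n' : Cfg d, (∀ j ∈ Λ, n j = n' j) → φ n = φ n') :
    IsLocal Λ (fun m n => if m = n then φ n else 0) := by
  refine ⟨fun m n ⟨j, hj, hne⟩ => ?_, fun m n m' n' h1 h2 h3 h4 => ?_⟩
  · have : m ≠ n := fun h => hne (by rw [h])
    simp [this]
  · have : m = n ↔ m' = n' := by
      constructor
      · intro h
        ext j
        by_cases hj : j ∈ Λ
        · rw [← h3 j hj, ← h4 j hj, h]
        · exact h2 j hj
      · intro h
        ext j
        by_cases hj : j ∈ Λ
        · rw [h3 j hj, h4 j hj, h]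
        · exact h1 j hj
    simp only [this, hφ n n' h4]

theorem isLocal_one (Λ : Finset (Site d)) : IsLocal Λ one :=
  isLocal_of_diagonal (φ := fun _ => 1) fun _ _ _ => rfl

theorem isLocal_damp (ε δ : ℝ) (Λ : Finset (Site d)) : IsLocal Λ (damp ε δ Λ) :=
  isLocal_of_diagonal
    (φ := fun n => ((Real.exp (-∑ j ∈ Λ, ε * ((n j : ℝ) * (n j : ℝ) ^ δ)) : ℝ) : ℂ))
    fun n n' h => by
      rw [Finset.sum_congr rfl fun j hj => by rw [h j hj]]

theorem isLocal_ann {Λ : Finset (Site d)} {l : Site d} (hl : l ∈ Λ) : IsLocal Λ (ann l) := by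
  refine ⟨fun m n ⟨j, hj, hne⟩ => ?_, fun m n m' n' h1 h2 h3 h4 => ?_⟩
  · refine if_neg ?_
    rintro rfl
    have : l ≠ j := fun h => hj (h ▸ hl)
    simp [this] at hne
  · have : n = m + Finsupp.single l 1 ↔ n' = m' + Finsupp.single l 1 := by
      constructor
      · intro h
        ext j
        by_cases hj : j ∈ Λ
        · rw [← h4 j hj, h, Finsupp.add_apply, Finsupp.add_apply, h3 j hj]
        · have : l ≠ j := fun h => hj (h ▸ hl)
          simp [this, h2 j hj]
      · intro h
        ext j
        by_cases hj : j ∈ Λ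
        · rw [h4 j hj, h, Finsupp.add_apply, Finsupp.add_apply, h3 j hj]
        · have : l ≠ j := fun h => hj (h ▸ hl)
          simp [this, h1 j hj]
    simp only [ann, this, h4 l hl]

theorem IsLocal.eqOn_compl {Λ : Finset (Site d)} {f : Op d} (hf : IsLocal Λ f) {m n : Cfg d}
    (h : f m n ≠ 0) {j : Site d} (hj : j ∉ Λ) : m j = n j := by
  by_contra hne
  exact h (hf.1 m n ⟨j, hj, hne⟩)

theorem FinCfg.apply_eq_zero {Λ : Finset (Site d)} (q : FinCfg Λ) {j : Site d} (hj : j ∉ Λ) :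
    q.1 j = 0 := by
  by_contra h
  exact hj (q.2 (Finsupp.mem_support_iff.2 h))

/-- A local `f` keeps the occupation numbers outside `Λ`, so the intermediate configuration is that
of `m` there and free in `Λ`. The resulting index set does not depend on `m`, which makes products
comparable in `IsLocal.mul`. -/
theorem IsLocal.mul_apply {Λ : Finset (Site d)} {f : Op d} (hf : IsLocal Λ f) (g : Op d)
    (m n : Cfg d) : mul f g m n = ∑' q : FinCfg Λ,
      f m (q.1 + m.filter fun j => j ∉ Λ) * g (q.1 + m.filter fun j => j ∉ Λ) n := by
  have hinj : Function.Injective fun q : FinCfg Λ => q.1 + m.filter fun j => j ∉ Λ :=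
    fun q q' h => Subtype.ext (add_right_cancel h)
  refine (hinj.tsum_eq (f := fun p => f m p * g p n) fun p hp => ?_).symm
  refine ⟨⟨p.filter fun j => j ∈ Λ, fun j hj => ?_⟩, ?_⟩
  · rw [Finsupp.support_filter, Finset.mem_filter] at hj
    exact hj.2
  · ext j
    by_cases hj : j ∈ Λ
    · simp [hj]
    · simp [hj, hf.eqOn_compl (left_ne_zero_of_mul hp) hj]

theorem IsLocal.mul {Λ : Finset (Site d)} {f g : Op d} (hf : IsLocal Λ f) (hg : IsLocal Λ g) :
    IsLocal Λ (mul f g) := by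
  refine ⟨fun m n ⟨j, hj, hne⟩ => ?_, fun m n m' n' h1 h2 h3 h4 => ?_⟩
  · have h0 : ∀ p, f m p * g p n = 0 := fun p => by
      by_contra h
      exact hne ((hf.eqOn_compl (left_ne_zero_of_mul h) hj).trans
        (hg.eqOn_compl (right_ne_zero_of_mul h) hj))
    simp [YFields.mul, h0]
  · rw [hf.mul_apply, hf.mul_apply]
    refine tsum_congr fun q => ?_
    have e : ∀ (k : Cfg d) j, j ∉ Λ → k j = (q.1 + k.filter fun j => j ∉ Λ) j := fun k j hj => by
      simp [hj, q.apply_eq_zero hj]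
    have e' : ∀ j ∈ Λ, (q.1 + m.filter fun j => j ∉ Λ) j = (q.1 + m'.filter fun j => j ∉ Λ) j :=
      fun j hj => by simp [hj]
    rw [hf.2 m _ m' _ (e m) (e m') h3 e',
      hg.2 (q.1 + m.filter fun j => j ∉ Λ) n (q.1 + m'.filter fun j => j ∉ Λ) n'
        (fun j hj => (e m j hj).symm.trans (h1 j hj))
        (fun j hj => (e m' j hj).symm.trans (h2 j hj)) e' h4]

theorem IsObs.exists_isLocal {f : Op d} (hf : IsObs f) : ∃ Λ, IsLocal Λ f := by
  induction hf with
  | one => exact ⟨∅, isLocal_one _⟩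
  | ann j => exact ⟨{j}, isLocal_ann (Finset.mem_singleton_self j)⟩
  | cre j => exact ⟨{j}, (isLocal_ann (Finset.mem_singleton_self j)).adj⟩
  | damp ε δ _ _ Λ => exact ⟨Λ, isLocal_damp ε δ Λ⟩
  | add F G _ _ hF hG =>
    obtain ⟨Λ, hF⟩ := hF
    obtain ⟨Λ', hG⟩ := hG
    exact ⟨Λ ∪ Λ', (hF.mono Finset.subset_union_left).add (hG.mono Finset.subset_union_right)⟩
  | smul c F _ hF =>
    obtain ⟨Λ, hF⟩ := hF
    exact ⟨Λ, hF.smul c⟩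
  | mul F G _ _ hF hG =>
    obtain ⟨Λ, hF⟩ := hF
    obtain ⟨Λ', hG⟩ := hG
    exact ⟨Λ ∪ Λ', (hF.mono Finset.subset_union_left).mul (hG.mono Finset.subset_union_right)⟩

theorem IsPoly.isLocal {Λ : Finset (Site d)} {F : Op d} (hF : IsPoly Λ F) : IsLocal Λ F := by
  induction hF with
  | one => exact isLocal_one Λ
  | ann j hj => exact isLocal_ann hj
  | cre j hj => exact (isLocal_ann hj).adj
  | add F G _ _ hF hG => exact hF.add hG
  | smul c F _ hF => exact hF.smul c
  | mul F G _ _ hF hG => exact hF.mul hG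

/-! ### Multiplication by ladder operators -/

theorem ann_mul_apply (l : Site d) (f : Op d) (m n : Cfg d) :
    mul (ann l) f m n = (Real.sqrt (m l + 1 : ℝ) : ℂ) * f (m + Finsupp.single l 1) n := by
  rw [mul, tsum_eq_single (m + Finsupp.single l 1)]
  · simp [ann]
  · intro p hp
    simp [ann, hp]

theorem cre_mul_apply (l : Site d) (f : Op d) (m n : Cfg d) :
    mul (adj (ann l)) f (m + Finsupp.single l 1) n =
      (Real.sqrt (m l + 1 : ℝ) : ℂ) * f m n := by
  rw [mul, tsum_eq_single m]
  · simp [ann, adj]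
  · intro p hp
    have : m ≠ p := hp.symm
    simp [ann, adj, this]

theorem cre_mul_apply_of_eq_zero {l : Site d} (f : Op d) {m : Cfg d} (hm : m l = 0) (n : Cfg d) :
    mul (adj (ann l)) f m n = 0 := by
  have h0 : ∀ p, adj (ann l) m p * f p n = 0 := fun p => by
    have : m ≠ p + Finsupp.single l 1 := by
      rintro rfl
      simp at hm
    simp [ann, adj, this]
  simp [mul, h0]

theorem mul_ann_apply (l : Site d) (f : Op d) (m n : Cfg d) :
    mul f (ann l) m (n + Finsupp.single l 1) = (Real.sqrt (n l + 1 : ℝ) : ℂ) * f m n := by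
  rw [mul, tsum_eq_single n]
  · simp [ann, mul_comm]
  · intro p hp
    have : n ≠ p := hp.symm
    simp [ann, this]

theorem mul_ann_apply_of_eq_zero {l : Site d} (f : Op d) (m : Cfg d) {n : Cfg d} (hn : n l = 0) :
    mul f (ann l) m n = 0 := by
  have h0 : ∀ p, f m p * ann l p n = 0 := fun p => by
    have : n ≠ p + Finsupp.single l 1 := by
      rintro rfl
      simp at hn
    simp [ann, this]
  simp [mul, h0]

theorem exists_eq_add_single {l : Site d} {n : Cfg d} (hn : n l ≠ 0) :
    ∃ n', n = n' + Finsupp.single l 1 := by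
  refine ⟨n - Finsupp.single l 1, ?_⟩
  ext j
  by_cases h : l = j
  · subst h
    simp
    omega
  · simp [h]

theorem IsLocal.apply_add_single {Λ : Finset (Site d)} {f : Op d} (hf : IsLocal Λ f)
    {l : Site d} (hl : l ∉ Λ) (m n : Cfg d) :
    f (m + Finsupp.single l 1) (n + Finsupp.single l 1) = f m n := by
  by_cases h : ∀ j, j ∉ Λ → m j = n j
  · refine hf.2 _ _ _ _ (fun j hj => ?_) h (fun j hj => ?_) (fun j hj => ?_)
    · simp [h j hj]
    · have : l ≠ j := fun h => hl (h ▸ hj)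
      simp [this]
    · have : l ≠ j := fun h => hl (h ▸ hj)
      simp [this]
  · push Not at h
    obtain ⟨j, hj, hne⟩ := h
    rw [hf.1 m n ⟨j, hj, hne⟩, hf.1 _ _ ⟨j, hj, by simpa using hne⟩]

/-- The factors `√(m_l + 1)` and `√(n_l + 1)` on the two sides agree because `f` does not change the
occupation number at `l`. -/
theorem IsLocal.ann_mul_comm {Λ : Finset (Site d)} {f : Op d} (hf : IsLocal Λ f)
    {l : Site d} (hl : l ∉ Λ) : YFields.mul (ann l) f = YFields.mul f (ann l) := by
  funext m n
  rw [ann_mul_apply]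
  by_cases hn : n l = 0
  · rw [mul_ann_apply_of_eq_zero f m hn, hf.1 _ _ ⟨l, hl, by simp [hn]⟩, mul_zero]
  · obtain ⟨n, rfl⟩ := exists_eq_add_single hn
    rw [mul_ann_apply, hf.apply_add_single hl]
    by_cases h : f m n = 0
    · rw [h, mul_zero, mul_zero]
    · rw [hf.eqOn_compl h hl]

theorem ccr (l : Site d) : mul (ann l) (adj (ann l)) - mul (adj (ann l)) (ann l) = one := by
  funext m n
  rw [Pi.sub_apply, Pi.sub_apply, ann_mul_apply]
  have h1 : adj (ann l) (m + Finsupp.single l 1) n =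
      if m = n then (Real.sqrt (m l + 1 : ℝ) : ℂ) else 0 := by
    by_cases h : m = n
    · simp [h, adj, ann]
    · simp [h, adj, ann]
  rw [h1]
  by_cases hm : m l = 0
  · rw [cre_mul_apply_of_eq_zero _ hm]
    by_cases h : m = n
    · subst h
      simp [one, hm]
    · simp [one, h]
  · obtain ⟨m, rfl⟩ := exists_eq_add_single hm
    rw [cre_mul_apply]
    by_cases h : m + Finsupp.single l 1 = n
    · subst h
      simp only [if_true, ann, one]
      norm_cast
      simp only [Finsupp.add_apply, Finsupp.single_eq_same]
      rw [Real.mul_self_sqrt (by positivity), Real.mul_self_sqrt (by positivity)]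
      push_cast
      ring
    · have h' : n ≠ m + Finsupp.single l 1 := Ne.symm h
      simp [h, h', ann, one]

/-- The sign of the modular frequency of a ladder operator. -/
def sgn (s : Bool) : ℝ := cond s 1 (-1)

theorem sgn_not (s : Bool) : sgn (!s) = -sgn s := by
  cases s <;> simp [sgn]

/-- The annihilation operator (`s = true`) or the creation operator (`s = false`). -/
def ladder (s : Bool) (l : Site d) : Op d := cond s (ann l) (adj (ann l))

theorem adj_ladder (s : Bool) (l : Site d) : adj (ladder s l) = ladder (!s) l := by
  cases s <;> simp [ladder, adj_adj]

theorem isObs_ladder (s : Bool) (l : Site d) : IsObs (ladder s l) := by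
  cases s
  · exact .cre l
  · exact .ann l

theorem isLocal_ladder (s : Bool) {Λ : Finset (Site d)} {l : Site d} (hl : l ∈ Λ) :
    IsLocal Λ (ladder s l) := by
  cases s
  · exact (isLocal_ann hl).adj
  · exact isLocal_ann hl

theorem ladder_ne {s : Bool} {l : Site d} {m n : Cfg d} (h : ladder s l m n ≠ 0) : m l ≠ n l := by
  intro he
  refine h ?_
  cases s
  · have : m ≠ n + Finsupp.single l 1 := by
      rintro rfl
      simp at he
    simp [ladder, adj, ann, this]
  · have : n ≠ m + Finsupp.single l 1 := by
      rintro rfl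
      simp at he
    simp [ladder, ann, this]

/-- A ladder operator changes the total particle number by exactly one, so it is an eigenvector of
the modular dynamics, also at complex times. -/
theorem modular_ladder (β : ℝ) (z : ℂ) (s : Bool) (l : Site d) :
    modular β z (ladder s l) = Complex.exp (Complex.I * z * β * sgn s) • ladder s l := by
  funext m n
  simp only [modular, Pi.smul_apply, smul_eq_mul]
  cases s
  · by_cases h : m = n + Finsupp.single l 1
    · subst h
      congr 2
      simp [sgn]
    · simp [ladder, adj, ann, h]
  · by_cases h : n = m + Finsupp.single l 1
    · subst h
      congr 2
      simp [sgn]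
    · simp [ladder, ann, h]

theorem IsLocal.ladder_mul_comm {Λ : Finset (Site d)} {f : Op d} (hf : IsLocal Λ f) (s : Bool)
    {l : Site d} (hl : l ∉ Λ) : YFields.mul (ladder s l) f = YFields.mul f (ladder s l) := by
  cases s
  · have := congrArg YFields.adj (hf.adj.ann_mul_comm hl)
    rw [adj_mul, adj_mul, adj_adj] at this
    exact this.symm
  · exact hf.ann_mul_comm hl

theorem IsLocal.delta_ladder {Λ : Finset (Site d)} {f : Op d} (hf : IsLocal Λ f) (s : Bool)
    {l : Site d} (hl : l ∉ Λ) : delta (ladder s l) f = 0 := by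
  rw [delta, hf.ladder_mul_comm s hl, sub_self, smul_zero]

theorem ladder_ccr (s : Bool) (l : Site d) :
    mul (ladder s l) (ladder (!s) l) - mul (ladder (!s) l) (ladder s l) = (sgn s : ℂ) • one := by
  cases s
  · rw [← neg_sub]
    simp [ladder, sgn, ccr]
  · simp [ladder, sgn, ccr]

theorem IsObs.delta {X f : Op d} (hX : IsObs X) (hf : IsObs f) : IsObs (delta X f) :=
  .smul _ _ ((IsObs.mul _ _ hX hf).sub (.mul _ _ hf hX))

theorem IsLocal.delta {Λ : Finset (Site d)} {X f : Op d} (hX : IsLocal Λ X) (hf : IsLocal Λ f) :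
    IsLocal Λ (delta X f) :=
  .smul _ ((hX.mul hf).sub (hf.mul hX))

/-- Operators of a lattice region stay in this region under derivations by ladder operators. -/
theorem IsLocal.delta_ladder_isLocal {Λ : Finset (Site d)} {f : Op d} (hf : IsLocal Λ f) (s : Bool)
    (l : Site d) : IsLocal Λ (YFields.delta (ladder s l) f) := by
  by_cases hl : l ∈ Λ
  · exact (isLocal_ladder s hl).delta hf
  · rw [hf.delta_ladder s hl]
    exact isLocal_zero Λ

theorem modular_smul (β : ℝ) (z c : ℂ) (X : Op d) : modular β z (c • X) = c • modular β z X := by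
  funext m n
  simp only [modular, Pi.smul_apply, smul_eq_mul]
  ring

theorem modular_add (β : ℝ) (z : ℂ) (X X' : Op d) :
    modular β z (X + X') = modular β z X + modular β z X' := by
  funext m n
  simp only [modular, Pi.add_apply]
  ring

theorem adj_modular (β : ℝ) (z : ℂ) (X : Op d) :
    adj (modular β z X) = modular β ((starRingEnd ℂ) z) (adj X) := by
  funext m n
  simp only [modular, adj, map_mul, ← Complex.exp_conj]
  congr 2
  simp
  ring

theorem deltaStar_ladder (β : ℝ) (s : Bool) (l : Site d) (g : Op d) :
    deltaStar β (ladder s l) g =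
      twist (Complex.exp (-(β * sgn s / 2)) • ladder (!s) l)
        (Complex.exp (β * sgn s / 2) • ladder (!s) l) g := by
  rw [deltaStar_eq_twist, adj_ladder, modular_ladder, modular_ladder, sgn_not]
  congr 3
  · push_cast
    linear_combination (-(β * sgn s : ℂ) / 2) * -Complex.I_mul_I
  · push_cast
    linear_combination (-(β * sgn s : ℂ) / 2) * Complex.I_mul_I

theorem IsObs.twist {V V' f : Op d} (hV : IsObs V) (hV' : IsObs V') (hf : IsObs f) :
    IsObs (twist V V' f) :=
  .smul _ _ ((IsObs.mul _ _ hf hV).sub (.mul _ _ hV' hf))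

theorem IsObs.deltaStar_ladder {f : Op d} (hf : IsObs f) (β : ℝ) (s : Bool) (l : Site d) :
    IsObs (deltaStar β (ladder s l) f) := by
  rw [YFields.deltaStar_ladder]
  exact .twist (.smul _ _ (isObs_ladder _ l)) (.smul _ _ (isObs_ladder _ l)) hf

theorem IsLocal.deltaStar_ladder {Λ : Finset (Site d)} {f : Op d} (hf : IsLocal Λ f) (β : ℝ)
    (s : Bool) {l : Site d} (hl : l ∈ Λ) : IsLocal Λ (deltaStar β (ladder s l) f) := by
  rw [YFields.deltaStar_ladder]
  exact .smul _ ((hf.mul ((isLocal_ladder _ hl).smul _)).sub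
    (((isLocal_ladder _ hl).smul _).mul hf))

/-- By commutation `δ^⋆ (f)` is a multiple of `f` times a ladder operator at `l`, and such a product
changes the occupation number at `l`. -/
theorem IsLocal.deltaStar_ladder_apply {Λ : Finset (Site d)} {f : Op d} (hf : IsLocal Λ f) (β : ℝ)
    (s : Bool) {l : Site d} (hl : l ∉ Λ) {m n : Cfg d} (h : m l = n l) :
    deltaStar β (ladder s l) f m n = 0 := by
  have h1 : YFields.mul f (ladder (!s) l) m n = 0 := by
    have h0 : ∀ p, f m p * ladder (!s) l p n = 0 := fun p => by
      by_contra hne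
      exact ladder_ne (right_ne_zero_of_mul hne)
        ((hf.eqOn_compl (left_ne_zero_of_mul hne) hl).symm.trans h)
    simp [YFields.mul, h0]
  rw [YFields.deltaStar_ladder, YFields.twist, smul_mul_op, mul_smul_op,
    hf.ladder_mul_comm _ hl]
  simp [h1]

/-- A consequence of the canonical commutation relations. -/
theorem IsLocal.delta_deltaStar_ladder {Λ : Finset (Site d)} {f : Op d} (hf : IsLocal Λ f)
    (hf' : LocFin f) (β : ℝ) (s : Bool) {l : Site d} (hl : l ∉ Λ) :
    YFields.delta (ladder s l) (deltaStar β (ladder s l) f) =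
      ((Complex.exp (β * sgn s / 2) - Complex.exp (-(β * sgn s / 2))) * sgn s) • f := by
  have hl1 : LocFin (ladder s l : Op d) := (isObs_ladder s l).locFin
  have hl2 : LocFin (ladder (!s) l : Op d) := (isObs_ladder (!s) l).locFin
  -- Since `f` commutes with both ladder operators at `l`, it can be pulled out; what remains is the
  -- commutator of annihilation and creation operator, a multiple of the identity.
  rw [YFields.deltaStar_ladder, YFields.twist, smul_mul_op, mul_smul_op,
    hf.ladder_mul_comm _ hl, ← sub_smul, smul_smul, delta_smul_right, YFields.delta,
    ← hf'.col.mul_assoc hl2.col, hf.ladder_mul_comm s hl, hf'.row.mul_assoc hl1.row,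
    hf'.row.mul_assoc hl2.row, ← hf'.row.mul_sub, ladder_ccr, mul_smul_op, mul_one_op, smul_smul,
    smul_smul]
  congr 1
  linear_combination (-(Complex.exp (β * sgn s / 2) - Complex.exp (-(β * sgn s / 2))) *
    sgn s : ℂ) * Complex.I_mul_I

end
end YFields
-- Weighted Hilbert–Schmidt sums and their finiteness for observables.
namespace YFields
noncomputable section
variable {d : ℕ}

/-! ### Weighted sums of matrix elements -/

/-- The summand of the weighted sum `∑ exp (-θ (|m| + |n|)) |f m n|²` over `H_Λ`. -/
def wTerm (θ : ℝ) (Λ : Finset (Site d)) (f : Op d) (p : FinCfg Λ × FinCfg Λ) : ℝ :=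
  Real.exp (-(θ * ((p.1.1.degree : ℝ) + p.2.1.degree))) * ‖f p.1 p.2‖ ^ 2

/-- The weighted sum `∑ exp (-θ (|m| + |n|)) |f m n|²` over `H_Λ`. -/
def wSum (θ : ℝ) (Λ : Finset (Site d)) (f : Op d) : ℝ := ∑' p, wTerm θ Λ f p

/-- All weighted sums of `f` over `H_Λ` are finite. -/
def Tame (Λ : Finset (Site d)) (f : Op d) : Prop := ∀ θ, 0 < θ → Summable (wTerm θ Λ f)

theorem wTerm_nonneg (θ : ℝ) (Λ : Finset (Site d)) (f : Op d) (p : FinCfg Λ × FinCfg Λ) :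
    0 ≤ wTerm θ Λ f p := by
  unfold wTerm
  positivity

theorem wSum_nonneg (θ : ℝ) (Λ : Finset (Site d)) (f : Op d) : 0 ≤ wSum θ Λ f :=
  tsum_nonneg fun p => wTerm_nonneg θ Λ f p

theorem wTerm_add_le (θ : ℝ) (Λ : Finset (Site d)) (f g : Op d) (p : FinCfg Λ × FinCfg Λ) :
    wTerm θ Λ (f + g) p ≤ 2 * wTerm θ Λ f p + 2 * wTerm θ Λ g p := by
  have h1 : ‖f p.1 p.2 + g p.1 p.2‖ ^ 2 ≤ 2 * ‖f p.1 p.2‖ ^ 2 + 2 * ‖g p.1 p.2‖ ^ 2 := by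
    have := norm_add_le (f p.1 p.2) (g p.1 p.2)
    nlinarith [norm_nonneg (f p.1 p.2 + g p.1 p.2), sq_nonneg (‖f p.1 p.2‖ - ‖g p.1 p.2‖)]
  have := mul_le_mul_of_nonneg_left h1
    (Real.exp_pos (-(θ * ((p.1.1.degree : ℝ) + p.2.1.degree)))).le
  simp only [wTerm, Pi.add_apply]
  linarith

theorem wTerm_smul (θ : ℝ) (Λ : Finset (Site d)) (c : ℂ) (f : Op d) (p : FinCfg Λ × FinCfg Λ) :
    wTerm θ Λ (c • f) p = ‖c‖ ^ 2 * wTerm θ Λ f p := by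
  simp only [wTerm, Pi.smul_apply, smul_eq_mul, norm_mul]
  ring

theorem wTerm_adj (θ : ℝ) (Λ : Finset (Site d)) (f : Op d) (p : FinCfg Λ × FinCfg Λ) :
    wTerm θ Λ (adj f) p = wTerm θ Λ f p.swap := by
  simp only [wTerm, adj, RCLike.norm_conj, Prod.fst_swap, Prod.snd_swap]
  rw [add_comm]

theorem summable_wTerm_adj {θ : ℝ} {Λ : Finset (Site d)} {f : Op d}
    (hf : Summable (wTerm θ Λ f)) : Summable (wTerm θ Λ (adj f)) := by
  have h : wTerm θ Λ (adj f) = wTerm θ Λ f ∘ Equiv.prodComm _ _ :=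
    funext fun p => wTerm_adj θ Λ f p
  rw [h]
  exact (Equiv.prodComm _ _).summable_iff.2 hf

theorem wSum_adj (θ : ℝ) (Λ : Finset (Site d)) (f : Op d) :
    wSum θ Λ (adj f) = wSum θ Λ f := by
  unfold wSum
  rw [← (Equiv.prodComm _ _).tsum_eq (wTerm θ Λ f)]
  exact tsum_congr fun p => wTerm_adj θ Λ f p

theorem summable_wTerm_add {θ : ℝ} {Λ : Finset (Site d)} {f g : Op d}
    (hf : Summable (wTerm θ Λ f)) (hg : Summable (wTerm θ Λ g)) :
    Summable (wTerm θ Λ (f + g)) :=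
  .of_nonneg_of_le (wTerm_nonneg θ Λ _) (wTerm_add_le θ Λ f g)
    ((hf.mul_left 2).add (hg.mul_left 2))

theorem wSum_add_le {θ : ℝ} {Λ : Finset (Site d)} {f g : Op d}
    (hf : Summable (wTerm θ Λ f)) (hg : Summable (wTerm θ Λ g)) :
    wSum θ Λ (f + g) ≤ 2 * wSum θ Λ f + 2 * wSum θ Λ g := by
  unfold wSum
  rw [← tsum_mul_left, ← tsum_mul_left, ← (hf.mul_left 2).tsum_add (hg.mul_left 2)]
  exact (summable_wTerm_add hf hg).tsum_le_tsum (wTerm_add_le θ Λ f g)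
    ((hf.mul_left 2).add (hg.mul_left 2))

theorem summable_wTerm_smul {θ : ℝ} {Λ : Finset (Site d)} {f : Op d} (c : ℂ)
    (hf : Summable (wTerm θ Λ f)) : Summable (wTerm θ Λ (c • f)) :=
  (hf.mul_left (‖c‖ ^ 2)).congr fun p => (wTerm_smul θ Λ c f p).symm

theorem wSum_smul (θ : ℝ) (Λ : Finset (Site d)) (c : ℂ) (f : Op d) :
    wSum θ Λ (c • f) = ‖c‖ ^ 2 * wSum θ Λ f := by
  unfold wSum
  rw [← tsum_mul_left]
  exact tsum_congr fun p => wTerm_smul θ Λ c f p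

theorem summable_wTerm_sub {θ : ℝ} {Λ : Finset (Site d)} {f g : Op d}
    (hf : Summable (wTerm θ Λ f)) (hg : Summable (wTerm θ Λ g)) :
    Summable (wTerm θ Λ (f - g)) := by
  rw [sub_eq_add_neg, ← neg_one_smul ℂ g]
  exact summable_wTerm_add hf (summable_wTerm_smul _ hg)

theorem wTerm_le_of_le {θ θ' : ℝ} (h : θ' ≤ θ) (Λ : Finset (Site d)) (f : Op d)
    (p : FinCfg Λ × FinCfg Λ) : wTerm θ Λ f p ≤ wTerm θ' Λ f p := by
  unfold wTerm
  gcongr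

theorem wSum_le_of_le {θ θ' : ℝ} (h : θ' ≤ θ) {Λ : Finset (Site d)} {f : Op d}
    (hf : Summable (wTerm θ' Λ f)) : wSum θ Λ f ≤ wSum θ' Λ f :=
  (Summable.of_nonneg_of_le (wTerm_nonneg θ Λ f) (wTerm_le_of_le h Λ f) hf).tsum_le_tsum
    (wTerm_le_of_le h Λ f) hf

theorem summable_wTerm_mono {θ : ℝ} {Λ Λ' : Finset (Site d)} (h : Λ ⊆ Λ') {f : Op d}
    (hf : Summable (wTerm θ Λ' f)) : Summable (wTerm θ Λ f) := by
  have hinj : Function.Injective fun p : FinCfg Λ × FinCfg Λ =>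
      ((⟨p.1.1, p.1.2.trans h⟩, ⟨p.2.1, p.2.2.trans h⟩) : FinCfg Λ' × FinCfg Λ') := by
    rintro ⟨⟨m, hm⟩, ⟨n, hn⟩⟩ ⟨⟨m', hm'⟩, ⟨n', hn'⟩⟩ he
    simpa using he
  exact (hf.comp_injective hinj).congr fun p => by simp only [wTerm, Function.comp]

/-! ### Multiplication by ladder operators in weighted norms -/

/-- Adding a particle at a site of `Λ`. -/
def FinCfg.succ {Λ : Finset (Site d)} {l : Site d} (hl : l ∈ Λ) (m : FinCfg Λ) : FinCfg Λ :=
  ⟨m.1 + Finsupp.single l 1, Finsupp.support_add.trans (Finset.union_subset m.2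
    (Finsupp.support_single_subset.trans (Finset.singleton_subset_iff.2 hl)))⟩

theorem succ_prod_injective {Λ : Finset (Site d)} {l : Site d} (hl : l ∈ Λ) :
    Function.Injective fun p : FinCfg Λ × FinCfg Λ => (p.1.succ hl, p.2) := by
  rintro ⟨⟨m, hm⟩, n⟩ ⟨⟨m', hm'⟩, n'⟩ h
  simpa [FinCfg.succ] using h

theorem eq_zero_of_notMem_range_succ {Λ : Finset (Site d)} {l : Site d} (hl : l ∈ Λ)
    {p : FinCfg Λ × FinCfg Λ}
    (hp : p ∉ Set.range fun p : FinCfg Λ × FinCfg Λ => (p.1.succ hl, p.2)) : p.1.1 l = 0 := by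
  by_contra h
  obtain ⟨m, hm⟩ := exists_eq_add_single h
  refine hp ⟨(⟨m, fun j hj => p.1.2 ?_⟩, p.2), Prod.ext (Subtype.ext hm.symm) rfl⟩
  rw [hm, Finsupp.mem_support_iff]
  simp at hj ⊢
  tauto

/-- Half of the exponential decay pays for a linear factor. The factor is the square of the `√(m_l +
1)` produced by a ladder operator. -/
theorem exp_mul_le {θ x y : ℝ} (hθ : 0 < θ) (hx : x ≤ y) :
    Real.exp (-(θ * y)) * x ≤ 2 / θ * Real.exp (-(θ / 2 * y)) := by
  have h1 : y ≤ 2 / θ * Real.exp (θ / 2 * y) := by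
    have := Real.add_one_le_exp (θ / 2 * y)
    rw [div_mul_eq_mul_div, le_div_iff₀ hθ]
    linarith
  calc Real.exp (-(θ * y)) * x ≤ Real.exp (-(θ * y)) * (2 / θ * Real.exp (θ / 2 * y)) := by
        gcongr
        exact hx.trans h1
    _ = 2 / θ * Real.exp (-(θ / 2 * y)) := by
        rw [mul_left_comm, ← Real.exp_add]
        ring_nf

/-- The matrix element of `A_l f` at `m` involves `f` at `m + δ_l`; rewriting the weight at the
shifted configuration costs `exp θ`. -/
theorem wTerm_ann_mul_le {θ : ℝ} (hθ : 0 < θ) {Λ : Finset (Site d)} {l : Site d} (hl : l ∈ Λ)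
    (f : Op d) (p : FinCfg Λ × FinCfg Λ) :
    wTerm θ Λ (mul (ann l) f) p ≤ 2 / θ * Real.exp θ * wTerm (θ / 2) Λ f (p.1.succ hl, p.2) := by
  obtain ⟨m, n⟩ := p
  have hle : (m.1 l : ℝ) ≤ m.1.degree := by exact_mod_cast Finsupp.le_degree l m.1
  have hd : ((m.succ hl).1.degree : ℝ) = m.1.degree + 1 := by simp [FinCfg.succ]
  have h1 : (m.1 l + 1 : ℝ) ≤ m.1.degree + 1 + n.1.degree := by
    have : (0 : ℝ) ≤ n.1.degree := Nat.cast_nonneg _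
    linarith
  have h2 := exp_mul_le hθ h1
  simp only [wTerm, ann_mul_apply, norm_mul, Complex.norm_real, mul_pow, Real.norm_eq_abs, sq_abs]
  rw [Real.sq_sqrt (by positivity), hd]
  have h3 : Real.exp (-(θ * (m.1.degree + n.1.degree : ℝ))) =
      Real.exp θ * Real.exp (-(θ * (m.1.degree + 1 + n.1.degree))) := by
    rw [← Real.exp_add]
    ring_nf
  rw [h3]
  have h4 : (m.succ hl).1 = m.1 + Finsupp.single l 1 := rfl
  rw [h4]
  have h5 : 0 ≤ Real.exp θ * ‖f (m.1 + Finsupp.single l 1) n‖ ^ 2 := by positivity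
  nlinarith [mul_le_mul_of_nonneg_left h2 h5]

theorem wTerm_cre_mul_le {θ : ℝ} (hθ : 0 < θ) {Λ : Finset (Site d)} {l : Site d} (hl : l ∈ Λ)
    (f : Op d) (p : FinCfg Λ × FinCfg Λ) :
    wTerm θ Λ (mul (adj (ann l)) f) (p.1.succ hl, p.2) ≤
      2 / θ * Real.exp θ * wTerm (θ / 2) Λ f p := by
  obtain ⟨m, n⟩ := p
  have hle : (m.1 l : ℝ) ≤ m.1.degree := by exact_mod_cast Finsupp.le_degree l m.1
  have hd : ((m.succ hl).1.degree : ℝ) = m.1.degree + 1 := by simp [FinCfg.succ]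
  have h1 : (m.1 l + 1 : ℝ) ≤ m.1.degree + 1 + n.1.degree := by
    have : (0 : ℝ) ≤ n.1.degree := Nat.cast_nonneg _
    linarith
  have h2 := exp_mul_le hθ h1
  have h4 : (m.succ hl).1 = m.1 + Finsupp.single l 1 := rfl
  simp only [wTerm, h4, cre_mul_apply, norm_mul, Complex.norm_real, mul_pow, Real.norm_eq_abs,
    sq_abs]
  rw [Real.sq_sqrt (by positivity), ← h4, hd]
  have h3 : Real.exp (-(θ / 2 * (m.1.degree + 1 + n.1.degree))) ≤
      Real.exp θ * Real.exp (-(θ / 2 * (m.1.degree + n.1.degree : ℝ))) := by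
    rw [← Real.exp_add]
    apply Real.exp_le_exp.2
    linarith
  have h5 : 0 ≤ ‖f m n‖ ^ 2 := by positivity
  have h6 : Real.exp (-(θ * (m.1.degree + 1 + n.1.degree))) * (m.1 l + 1) ≤
      2 / θ * (Real.exp θ * Real.exp (-(θ / 2 * (m.1.degree + n.1.degree : ℝ)))) :=
    h2.trans (by gcongr)
  nlinarith [mul_le_mul_of_nonneg_left h6 h5]

theorem wSum_ladder_mul {θ : ℝ} (hθ : 0 < θ) {Λ : Finset (Site d)} {l : Site d} (hl : l ∈ Λ)
    (s : Bool) {f : Op d} (hf : Summable (wTerm (θ / 2) Λ f)) :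
    Summable (wTerm θ Λ (mul (ladder s l) f)) ∧
      wSum θ Λ (mul (ladder s l) f) ≤ 2 / θ * Real.exp θ * wSum (θ / 2) Λ f := by
  have hC : 0 ≤ 2 / θ * Real.exp θ := by positivity
  have hinj := succ_prod_injective hl
  cases s
  -- A creation operator produces only configurations with a particle at `l`, so the sum can be
  -- reindexed by adding that particle.
  · have hr : ∀ p ∉ Set.range fun p : FinCfg Λ × FinCfg Λ => (p.1.succ hl, p.2),
        wTerm θ Λ (mul (adj (ann l)) f) p = 0 := fun p hp => by
      rw [wTerm, cre_mul_apply_of_eq_zero f (eq_zero_of_notMem_range_succ hl hp)]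
      simp
    have h1 : Summable (wTerm θ Λ (mul (adj (ann l)) f) ∘
        fun p : FinCfg Λ × FinCfg Λ => (p.1.succ hl, p.2)) :=
      .of_nonneg_of_le (fun p => wTerm_nonneg _ _ _ _) (wTerm_cre_mul_le hθ hl f)
        (hf.mul_left _)
    refine ⟨(hinj.summable_iff hr).1 h1, ?_⟩
    unfold wSum
    simp only [ladder, cond_false]
    rw [← hinj.tsum_eq (f := wTerm θ Λ (mul (adj (ann l)) f))
      (fun p hp => by_contra fun h => hp (hr p h)), ← tsum_mul_left]
    exact h1.tsum_le_tsum (wTerm_cre_mul_le hθ hl f) (hf.mul_left _)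
  · have h1 := (hf.comp_injective hinj).mul_left (2 / θ * Real.exp θ)
    have h2 : Summable (wTerm θ Λ (mul (ann l) f)) :=
      .of_nonneg_of_le (wTerm_nonneg _ _ _) (wTerm_ann_mul_le hθ hl f) h1
    refine ⟨h2, ?_⟩
    calc wSum θ Λ (mul (ann l) f)
        ≤ ∑' p : FinCfg Λ × FinCfg Λ, 2 / θ * Real.exp θ *
            (wTerm (θ / 2) Λ f ∘ fun p : FinCfg Λ × FinCfg Λ => (p.1.succ hl, p.2)) p :=
          h2.tsum_le_tsum (wTerm_ann_mul_le hθ hl f) h1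
      _ ≤ _ := by
          rw [tsum_mul_left]
          exact mul_le_mul_of_nonneg_left
            (tsum_comp_le_tsum_of_inj hf (wTerm_nonneg _ _ _) hinj) hC

theorem mul_ladder_eq (f : Op d) (s : Bool) (l : Site d) :
    mul f (ladder s l) = adj (mul (ladder (!s) l) (adj f)) := by
  rw [adj_mul, adj_adj, adj_ladder, Bool.not_not]

theorem wSum_mul_ladder {θ : ℝ} (hθ : 0 < θ) {Λ : Finset (Site d)} {l : Site d} (hl : l ∈ Λ)
    (s : Bool) {f : Op d} (hf : Summable (wTerm (θ / 2) Λ f)) :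
    Summable (wTerm θ Λ (mul f (ladder s l))) ∧
      wSum θ Λ (mul f (ladder s l)) ≤ 2 / θ * Real.exp θ * wSum (θ / 2) Λ f := by
  obtain ⟨h1, h2⟩ := wSum_ladder_mul hθ hl (!s) (summable_wTerm_adj hf)
  rw [mul_ladder_eq, wSum_adj]
  rw [wSum_adj] at h2
  exact ⟨summable_wTerm_adj h1, h2⟩

/-- Continuity of the derivation from the stronger norm (weight `θ/2`) to the weaker one (weight
`θ`); the core property rests on it. -/
theorem wSum_delta_ladder {θ : ℝ} (hθ : 0 < θ) {Λ : Finset (Site d)} {l : Site d} (hl : l ∈ Λ)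
    (s : Bool) {f : Op d} (hf : Summable (wTerm (θ / 2) Λ f)) :
    wSum θ Λ (delta (ladder s l) f) ≤ 4 * (2 / θ * Real.exp θ) * wSum (θ / 2) Λ f := by
  obtain ⟨h1, h2⟩ := wSum_ladder_mul hθ hl s hf
  obtain ⟨h3, h4⟩ := wSum_mul_ladder hθ hl s hf
  rw [delta, sub_eq_add_neg, ← neg_one_smul ℂ (mul f _), wSum_smul]
  have h5 := wSum_add_le h1 (summable_wTerm_smul (-1) h3)
  rw [wSum_smul] at h5
  simp only [Complex.norm_I, norm_neg, norm_one, one_pow, one_mul] at h5 ⊢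
  linarith

theorem damp_mul_apply (ε δ : ℝ) (Λ : Finset (Site d)) (f : Op d) (m n : Cfg d) :
    mul (damp ε δ Λ) f m n =
      ((Real.exp (-∑ j ∈ Λ, ε * ((m j : ℝ) * (m j : ℝ) ^ δ)) : ℝ) : ℂ) * f m n := by
  rw [mul, tsum_eq_single m]
  · simp [damp]
  · intro p hp
    simp [damp, hp.symm]

theorem mul_damp_apply (ε δ : ℝ) (Λ : Finset (Site d)) (f : Op d) (m n : Cfg d) :
    mul f (damp ε δ Λ) m n =
      f m n * ((Real.exp (-∑ j ∈ Λ, ε * ((n j : ℝ) * (n j : ℝ) ^ δ)) : ℝ) : ℂ) := by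
  rw [mul, tsum_eq_single n]
  · simp [damp]
  · intro p hp
    simp [damp, hp]

theorem Tame.damp_mul {ε δ : ℝ} (hε : 0 < ε) (Λ₀ : Finset (Site d)) {Λ : Finset (Site d)}
    {f : Op d} (hf : Tame Λ f) : Tame Λ (mul (damp ε δ Λ₀) f) := fun θ hθ => by
  refine .of_nonneg_of_le (wTerm_nonneg _ _ _) (fun p => ?_) (hf θ hθ)
  rw [wTerm, damp_mul_apply, norm_mul, wTerm, Complex.norm_real, Real.norm_eq_abs, Real.abs_exp]
  gcongr
  refine mul_le_of_le_one_left (norm_nonneg _) (Real.exp_le_one_iff.2 ?_)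
  rw [neg_nonpos]
  exact Finset.sum_nonneg fun j _ => by positivity

/-! ### Density matrices -/

theorem density_eq {β : ℝ} (Λ : Finset (Site d)) (m : FinCfg Λ) :
    density β Λ m = Real.exp (-β * m.1.degree) / partition β ^ Λ.card := by
  have h2 : m.1.degree = ∑ j ∈ Λ, m.1 j :=
    Finset.sum_subset m.2 fun j _ hj => by simpa using hj
  rw [density, Finset.prod_div_distrib, Finset.prod_const, ← Real.exp_sum, ← Finset.mul_sum, h2]
  push_cast
  rfl

theorem sqrt_density {β : ℝ} (Λ : Finset (Site d)) (m : FinCfg Λ) :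
    Real.sqrt (density β Λ m) =
      Real.exp (-(β / 2) * m.1.degree) / Real.sqrt (partition β ^ Λ.card) := by
  rw [density_eq, Real.sqrt_div (Real.exp_pos _).le,
    show -β * (m.1.degree : ℝ) = -(β / 2) * m.1.degree + -(β / 2) * m.1.degree by ring,
    Real.exp_add, Real.sqrt_mul_self (Real.exp_pos _).le]

theorem sqrt_density_mul {β : ℝ} (hβ : 0 < β) (Λ : Finset (Site d)) (m n : FinCfg Λ) :
    Real.sqrt (density β Λ m) * Real.sqrt (density β Λ n) =
      (partition β ^ Λ.card)⁻¹ * Real.exp (-(β / 2 * ((m.1.degree : ℝ) + n.1.degree))) := by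
  have hp : 0 ≤ partition β ^ Λ.card := (pow_pos (partition_pos hβ).1 _).le
  rw [sqrt_density, sqrt_density, div_mul_div_comm, Real.mul_self_sqrt hp, ← Real.exp_add]
  ring_nf

theorem ipTerm_self_eq {β : ℝ} (hβ : 0 < β) (Λ : Finset (Site d)) (f : Op d)
    (p : FinCfg Λ × FinCfg Λ) :
    ipTerm β Λ f f p = (((partition β ^ Λ.card)⁻¹ * wTerm (β / 2) Λ f p : ℝ) : ℂ) := by
  rw [ipTerm_self, sqrt_density_mul hβ, wTerm, mul_assoc]

theorem summable_ipTerm_iff {β : ℝ} (hβ : 0 < β) {Λ : Finset (Site d)} {f : Op d} :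
    Summable (ipTerm β Λ f f) ↔ Summable (wTerm (β / 2) Λ f) := by
  have h : ipTerm β Λ f f = fun p => (((partition β ^ Λ.card)⁻¹ * wTerm (β / 2) Λ f p : ℝ) : ℂ) :=
    funext (ipTerm_self_eq hβ Λ f)
  have hp : (partition β ^ Λ.card)⁻¹ ≠ 0 := inv_ne_zero (pow_pos (partition_pos hβ).1 _).ne'
  rw [h, Complex.summable_ofReal, summable_mul_left_iff hp]

/-- The weight `θ` is that of a product state at inverse temperature `2θ`. There the norm of the
identity is the same for all regions, and the empty region has a single configuration. -/
theorem tame_one (Λ : Finset (Site d)) : Tame Λ one := fun θ hθ => by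
  have h2 : (0 : ℝ) < 2 * θ := by positivity
  have h0 : Summable (ipTerm (d := d) (2 * θ) ∅ one one) := by
    have : Subsingleton (FinCfg (∅ : Finset (Site d))) :=
      ⟨fun a b => Subtype.ext (by
        rw [Finsupp.support_eq_empty.1 (Finset.subset_empty.1 a.2),
          Finsupp.support_eq_empty.1 (Finset.subset_empty.1 b.2)])⟩
    exact summable_of_hasFiniteSupport (Set.toFinite _)
  have h1 := (summable_ipTerm_iff h2).1
    (ipTerm_mono h2 (Finset.empty_subset Λ) (isLocal_one ∅) (isLocal_one ∅) h0.hasSum).summable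
  rwa [mul_div_cancel_left₀ θ two_ne_zero] at h1

/-- The induction is on the left factor acting on an arbitrary tame matrix, since tameness of two
factors says nothing evident about their product. Each ladder operator halves `θ`, which is harmless
because tameness asks for all `θ > 0`. -/
theorem exists_tame_mul {F : Op d} (hF : IsObs F) :
    ∃ Λ₀ : Finset (Site d), ∀ Λ, Λ₀ ⊆ Λ → ∀ f, LocFin f → Tame Λ f → Tame Λ (mul F f) := by
  induction hF with
  | one => exact ⟨∅, fun Λ _ f _ hf => by rwa [one_mul_op]⟩
  | ann j =>
    exact ⟨{j}, fun Λ hΛ f _ hf θ hθ => (wSum_ladder_mul hθ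
      (hΛ (Finset.mem_singleton_self j)) true (hf (θ / 2) (half_pos hθ))).1⟩
  | cre j =>
    exact ⟨{j}, fun Λ hΛ f _ hf θ hθ => (wSum_ladder_mul hθ
      (hΛ (Finset.mem_singleton_self j)) false (hf (θ / 2) (half_pos hθ))).1⟩
  | damp ε δ hε hδ Λ₀ => exact ⟨∅, fun Λ _ f _ hf => hf.damp_mul hε Λ₀⟩
  | add F G _ _ hF hG =>
    obtain ⟨Λ₁, hF⟩ := hF
    obtain ⟨Λ₂, hG⟩ := hG
    refine ⟨Λ₁ ∪ Λ₂, fun Λ hΛ f hf hf' θ hθ => ?_⟩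
    rw [hf.col.add_mul]
    exact summable_wTerm_add (hF Λ (Finset.union_subset_left hΛ) f hf hf' θ hθ)
      (hG Λ (Finset.union_subset_right hΛ) f hf hf' θ hθ)
  | smul c F _ hF =>
    obtain ⟨Λ₁, hF⟩ := hF
    refine ⟨Λ₁, fun Λ hΛ f hf hf' θ hθ => ?_⟩
    rw [smul_mul_op]
    exact summable_wTerm_smul c (hF Λ hΛ f hf hf' θ hθ)
  | mul F G hF' hG' hF hG =>
    obtain ⟨Λ₁, hF⟩ := hF
    obtain ⟨Λ₂, hG⟩ := hG
    refine ⟨Λ₁ ∪ Λ₂, fun Λ hΛ f hf hf' => ?_⟩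
    rw [hF'.locFin.row.mul_assoc hG'.locFin.row]
    exact hF Λ (Finset.union_subset_left hΛ) _ (hG'.locFin.comp hf)
      (hG Λ (Finset.union_subset_right hΛ) f hf hf')

theorem tame_of_isObs {f : Op d} (hf : IsObs f) (Λ : Finset (Site d)) : Tame Λ f := fun θ hθ => by
  obtain ⟨Λ₀, h⟩ := exists_tame_mul hf
  have := h (Λ ∪ Λ₀) Finset.subset_union_right one locFin_one (tame_one _) θ hθ
  rw [mul_one_op] at this
  exact summable_wTerm_mono Finset.subset_union_left this

theorem sqrt_density_succ {β : ℝ} {Λ : Finset (Site d)} {l : Site d} (hl : l ∈ Λ) (m : FinCfg Λ) :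
    Real.sqrt (density β Λ m) = Real.exp (β / 2) * Real.sqrt (density β Λ (m.succ hl)) := by
  have hd : ((m.succ hl).1.degree : ℝ) = m.1.degree + 1 := by simp [FinCfg.succ]
  rw [sqrt_density, sqrt_density, hd, mul_div, ← Real.exp_add]
  ring_nf

end
end YFields
-- Classes in `L²(ω₀)`, and duality between `δ` and `δ^⋆`.
namespace YFields
noncomputable section
variable {d : ℕ}

/-! ### Elements of `L²(ω₀)` -/

theorem isLocal_localize (Λ : Finset (Site d)) (K : Op d) : IsLocal Λ (localize Λ K) := by
  have key : ∀ m n : Cfg d, (m.filter (fun j => j ∉ Λ) = n.filter fun j => j ∉ Λ) ↔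
      ∀ j, j ∉ Λ → m j = n j := by
    intro m n
    refine ⟨fun h j hj => by simpa [hj] using DFunLike.congr_fun h j, fun h => ?_⟩
    ext j
    by_cases hj : j ∈ Λ
    · simp [hj]
    · simp [hj, h j hj]
  have key2 : ∀ m n : Cfg d, (∀ j ∈ Λ, m j = n j) →
      (m.filter (fun j => j ∈ Λ) = n.filter fun j => j ∈ Λ) := by
    intro m n h
    ext j
    by_cases hj : j ∈ Λ
    · simp [hj, h j hj]
    · simp [hj]
  refine ⟨fun m n ⟨j, hj, hne⟩ => if_neg fun h => hne ((key m n).1 h j hj),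
    fun m n m' n' h1 h2 h3 h4 => ?_⟩
  rw [localize, localize, if_pos ((key m n).2 h1), if_pos ((key m' n').2 h2), key2 m m' h3,
    key2 n n' h4]

theorem localize_apply {Λ : Finset (Site d)} (K : Op d) (p : FinCfg Λ × FinCfg Λ) :
    localize Λ K p.1 p.2 = K p.1 p.2 := by
  have h1 : ∀ m : FinCfg Λ, m.1.filter (fun j => j ∉ Λ) = 0 := fun m => by
    ext j
    by_cases hj : j ∈ Λ
    · simp [hj]
    · simp [hj, m.apply_eq_zero hj]
  have h2 : ∀ m : FinCfg Λ, m.1.filter (fun j => j ∈ Λ) = m.1 := fun m => by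
    ext j
    by_cases hj : j ∈ Λ
    · simp [hj]
    · simp [hj, m.apply_eq_zero hj]
  rw [localize, if_pos (by rw [h1, h1]), h2, h2]

theorem localize_add (Λ : Finset (Site d)) (K K' : Op d) :
    localize Λ (K + K') = localize Λ K + localize Λ K' := by
  funext m n
  simp only [localize, Pi.add_apply]
  split_ifs <;> simp

theorem localize_smul (Λ : Finset (Site d)) (c : ℂ) (K : Op d) :
    localize Λ (c • K) = c • localize Λ K := by
  funext m n
  simp only [localize, Pi.smul_apply]
  split_ifs <;> simp

variable {β : ℝ} [hβ : Fact (0 < β)]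

theorem localize_mem {Λ : Finset (Site d)} {K : Op d} (h : Summable (wTerm (β / 2) Λ K)) :
    localize Λ K ∈ localL2 d β := by
  refine ⟨Λ, isLocal_localize Λ K, (summable_ipTerm_iff hβ.out).2 (h.congr fun p => ?_)⟩
  rw [wTerm, wTerm, localize_apply]

theorem summable_wTerm_of_mem {f : Op d} (hf : f ∈ localL2 d β) (Λ : Finset (Site d)) :
    Summable (wTerm (β / 2) Λ f) := by
  obtain ⟨Λ', hf⟩ := hf
  have := hf.mono hβ.out (Finset.subset_union_right (s₁ := Λ))
  exact summable_wTerm_mono Finset.subset_union_left ((summable_ipTerm_iff hβ.out).1 this.2)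

theorem mem_localL2_of_isLocal {Λ : Finset (Site d)} {f : Op d} (hf : IsLocal Λ f)
    (h : Summable (wTerm (β / 2) Λ f)) : f ∈ localL2 d β :=
  ⟨Λ, hf, (summable_ipTerm_iff hβ.out).2 h⟩

theorem IsObs.mem_localL2 {f : Op d} (hf : IsObs f) : f ∈ localL2 d β := by
  obtain ⟨Λ, hΛ⟩ := hf.exists_isLocal
  exact mem_localL2_of_isLocal hΛ (tame_of_isObs hf Λ _ (half_pos hβ.out))

theorem ofLocal_congr {f g : Op d} (h : f = g) (hf : f ∈ localL2 d β) (hg : g ∈ localL2 d β) :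
    ofLocal β f hf = ofLocal β g hg := by
  subst h
  rfl

theorem ofLocal_add {f g : Op d} (hf : f ∈ localL2 d β) (hg : g ∈ localL2 d β) :
    ofLocal β (f + g) ((localL2 d β).add_mem hf hg) = ofLocal β f hf + ofLocal β g hg :=
  UniformSpace.Completion.coe_add (show LocalSpace d β from ⟨f, hf⟩)
    (show LocalSpace d β from ⟨g, hg⟩)

theorem ofLocal_smul (c : ℂ) {f : Op d} (hf : f ∈ localL2 d β) :
    ofLocal β (c • f) ((localL2 d β).smul_mem c hf) = c • ofLocal β f hf :=
  UniformSpace.Completion.coe_smul c (show LocalSpace d β from ⟨f, hf⟩)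

theorem inner_ofLocal {f g : Op d} (hf : f ∈ localL2 d β) (hg : g ∈ localL2 d β) :
    inner ℂ (ofLocal β f hf) (ofLocal β g hg) = ip β f g :=
  UniformSpace.Completion.inner_coe (𝕜 := ℂ) (E := LocalSpace d β) _ _

theorem rep_ofLocal {f : Op d} (hf : f ∈ localL2 d β) : Rep β f (ofLocal β f hf) := by
  refine ⟨fun Λ => localize_mem (summable_wTerm_of_mem hf Λ), ?_⟩
  obtain ⟨Λ₀, h⟩ := id hf
  refine tendsto_const_nhds.congr' ((eventually_ge_atTop Λ₀).mono fun Λ hΛ => ?_)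
  exact ofLocal_congr (localize_eq_self hΛ h.1).symm _ _

theorem cls_ofLocal {f : Op d} (hf : f ∈ localL2 d β) : cls β f = ofLocal β f hf :=
  (rep_ofLocal hf).cls_eq

theorem inL2_of_mem {f : Op d} (hf : f ∈ localL2 d β) : InL2 β f := ⟨_, rep_ofLocal hf⟩

theorem IsObs.inL2 {f : Op d} (hf : IsObs f) : InL2 β f := inL2_of_mem hf.mem_localL2

theorem Rep.add {K K' : Op d} {Ψ Ψ' : L2 d β} (h : Rep β K Ψ) (h' : Rep β K' Ψ') :
    Rep β (K + K') (Ψ + Ψ') := by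
  obtain ⟨h1, h2⟩ := h
  obtain ⟨h1', h2'⟩ := h'
  refine ⟨fun Λ => ?_, (h2.add h2').congr fun Λ => ?_⟩
  · rw [localize_add]
    exact (localL2 d β).add_mem (h1 Λ) (h1' Λ)
  · rw [← ofLocal_add]
    exact ofLocal_congr (localize_add Λ K K').symm _ _

theorem Rep.smul {K : Op d} {Ψ : L2 d β} (c : ℂ) (h : Rep β K Ψ) : Rep β (c • K) (c • Ψ) := by
  obtain ⟨h1, h2⟩ := h
  refine ⟨fun Λ => ?_, (h2.const_smul c).congr fun Λ => ?_⟩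
  · rw [localize_smul]
    exact (localL2 d β).smul_mem c (h1 Λ)
  · rw [← ofLocal_smul]
    exact ofLocal_congr (localize_smul Λ c K).symm _ _

theorem InL2.rep_cls {K : Op d} (h : InL2 β K) : Rep β K (cls β K) := by
  obtain ⟨Ψ, h⟩ := h
  rwa [h.cls_eq]

theorem InL2.add {K K' : Op d} (h : InL2 β K) (h' : InL2 β K') : InL2 β (K + K') :=
  ⟨_, h.rep_cls.add h'.rep_cls⟩

theorem InL2.smul {K : Op d} (c : ℂ) (h : InL2 β K) : InL2 β (c • K) :=
  ⟨_, h.rep_cls.smul c⟩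

theorem InL2.cls_add {K K' : Op d} (h : InL2 β K) (h' : InL2 β K') :
    cls β (K + K') = cls β K + cls β K' := (h.rep_cls.add h'.rep_cls).cls_eq

theorem InL2.cls_smul {K : Op d} (c : ℂ) (h : InL2 β K) : cls β (c • K) = c • cls β K :=
  (h.rep_cls.smul c).cls_eq

theorem inL2_zero : InL2 β (0 : Op d) := inL2_of_mem (localL2 d β).zero_mem

theorem cls_zero : cls β (0 : Op d) = 0 := by
  have := (inL2_zero (d := d) (β := β)).cls_smul 0
  rwa [zero_smul, zero_smul] at this

theorem InL2.sub {K K' : Op d} (h : InL2 β K) (h' : InL2 β K') : InL2 β (K - K') := by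
  rw [sub_eq_add_neg, ← neg_one_smul ℂ K']
  exact h.add (h'.smul _)

theorem InL2.cls_sub {K K' : Op d} (h : InL2 β K) (h' : InL2 β K') :
    cls β (K - K') = cls β K - cls β K' := by
  rw [sub_eq_add_neg, ← neg_one_smul ℂ K', h.cls_add (h'.smul _), h'.cls_smul, neg_one_smul,
    ← sub_eq_add_neg]

theorem inL2_sum {ι : Type*} (s : Finset ι) {K : ι → Op d} (h : ∀ i ∈ s, InL2 β (K i)) :
    InL2 β (∑ i ∈ s, K i) :=
  Finset.sum_induction K (InL2 β) (fun _ _ h h' => h.add h') inL2_zero h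

theorem cls_sum {ι : Type*} (s : Finset ι) {K : ι → Op d} (h : ∀ i ∈ s, InL2 β (K i)) :
    cls β (∑ i ∈ s, K i) = ∑ i ∈ s, cls β (K i) := by
  classical
  induction s using Finset.induction_on with
  | empty => simp [cls_zero]
  | insert a s ha ih =>
    have h1 := h a (Finset.mem_insert_self a s)
    have h2 : ∀ i ∈ s, InL2 β (K i) := fun i hi => h i (Finset.mem_insert_of_mem hi)
    rw [Finset.sum_insert ha, Finset.sum_insert ha, h1.cls_add (inL2_sum s h2), ih h2]

/-! ### The scalar product -/

theorem conj_scal (f g : Op d) : (starRingEnd ℂ) (scal β f g) = scal β g f :=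
  inner_conj_symm _ _

theorem InL2.scal_smul_right {g : Op d} (hg : InL2 β g) (c : ℂ) (f : Op d) :
    scal β f (c • g) = c * scal β f g := by
  rw [scal, hg.cls_smul, inner_smul_right, scal]

theorem InL2.scal_smul_left {f : Op d} (hf : InL2 β f) (c : ℂ) (g : Op d) :
    scal β (c • f) g = (starRingEnd ℂ) c * scal β f g := by
  rw [scal, hf.cls_smul, inner_smul_left, scal]

theorem InL2.scal_sub_right {g g' : Op d} (hg : InL2 β g) (hg' : InL2 β g') (f : Op d) :
    scal β f (g - g') = scal β f g - scal β f g' := by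
  rw [scal, hg.cls_sub hg', inner_sub_right, scal, scal]

theorem InL2.scal_sub_left {f f' : Op d} (hf : InL2 β f) (hf' : InL2 β f') (g : Op d) :
    scal β (f - f') g = scal β f g - scal β f' g := by
  rw [scal, hf.cls_sub hf', inner_sub_left, scal, scal]

theorem scal_sum_sum {ι ι' : Type*} (s : Finset ι) (s' : Finset ι') {f : ι → Op d}
    {g : ι' → Op d} (a : ι → ℂ) (b : ι' → ℂ) (hf : ∀ i ∈ s, InL2 β (f i))
    (hg : ∀ i ∈ s', InL2 β (g i)) :
    scal β (∑ i ∈ s, a i • f i) (∑ k ∈ s', b k • g k) =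
      ∑ i ∈ s, ∑ k ∈ s', (starRingEnd ℂ) (a i) * b k * scal β (f i) (g k) := by
  rw [scal, cls_sum s fun i hi => (hf i hi).smul _, cls_sum s' fun i hi => (hg i hi).smul _,
    sum_inner]
  refine Finset.sum_congr rfl fun i hi => ?_
  rw [inner_sum]
  refine Finset.sum_congr rfl fun k hk => ?_
  rw [(hf i hi).cls_smul, (hg k hk).cls_smul, inner_smul_left, inner_smul_right, ← mul_assoc, scal]

/-- The limit over regions is stationary from `Λ` on, so the abstract scalar product can be computed
as one concrete sum. -/
theorem scal_eq_tsum {Λ : Finset (Site d)} {f g : Op d} (hf : IsLocal Λ f) (hg : IsLocal Λ g)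
    (hf' : Summable (wTerm (β / 2) Λ f)) (hg' : Summable (wTerm (β / 2) Λ g)) :
    scal β f g = ∑' p, ipTerm β Λ f g p := by
  have h1 := mem_localL2_of_isLocal hf hf'
  have h2 := mem_localL2_of_isLocal hg hg'
  rw [scal, cls_ofLocal h1, cls_ofLocal h2, inner_ofLocal]
  obtain ⟨Λ₀, h, -⟩ := tendsto_ip h1 h2
  have h3 := (ipTerm_summable ((summable_ipTerm_iff hβ.out).2 hf')
    ((summable_ipTerm_iff hβ.out).2 hg')).hasSum
  exact (h (Λ ∪ Λ₀) Finset.subset_union_right).unique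
    (ipTerm_mono hβ.out Finset.subset_union_left hf hg h3)

/-- The weight `β/2` comes from the square roots of the two density matrices; the partition
functions only contribute a constant depending on `Λ`. -/
theorem norm_cls_sq {Λ : Finset (Site d)} {f : Op d} (hf : IsLocal Λ f)
    (hf' : Summable (wTerm (β / 2) Λ f)) :
    ‖cls β f‖ ^ 2 = (partition β ^ Λ.card)⁻¹ * wSum (β / 2) Λ f := by
  have h1 := scal_eq_tsum hf hf hf' hf'
  simp_rw [ipTerm_self_eq hβ.out] at h1
  rw [← Complex.ofReal_tsum, tsum_mul_left, scal, inner_self_eq_norm_sq_to_K] at h1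
  exact Complex.ofReal_injective (by simpa [wSum] using h1)

theorem IsObs.scal_eq_tsum {Λ : Finset (Site d)} {f g : Op d} (hf : IsObs f) (hg : IsObs g)
    (hfΛ : IsLocal Λ f) (hgΛ : IsLocal Λ g) : scal β f g = ∑' p, ipTerm β Λ f g p :=
  YFields.scal_eq_tsum hfΛ hgΛ (tame_of_isObs hf Λ _ (half_pos hβ.out))
    (tame_of_isObs hg Λ _ (half_pos hβ.out))

theorem exists_isLocal₂ {f g : Op d} (hf : IsObs f) (hg : IsObs g) (l : Site d) :
    ∃ Λ, IsLocal Λ f ∧ IsLocal Λ g ∧ l ∈ Λ := by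
  obtain ⟨Λ₁, h1⟩ := hf.exists_isLocal
  obtain ⟨Λ₂, h2⟩ := hg.exists_isLocal
  refine ⟨Λ₁ ∪ Λ₂ ∪ {l}, h1.mono ?_, h2.mono ?_, ?_⟩
  · exact Finset.subset_union_left.trans Finset.subset_union_left
  · exact Finset.subset_union_right.trans Finset.subset_union_left
  · exact Finset.mem_union_right _ (Finset.mem_singleton_self l)

theorem scal_adj_adj {f g : Op d} (hf : IsObs f) (hg : IsObs g) :
    scal β (adj f) (adj g) = scal β g f := by
  obtain ⟨Λ, h1, h2, -⟩ := exists_isLocal₂ hf hg 0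
  rw [hf.adj.scal_eq_tsum hg.adj h1.adj h2.adj, hg.scal_eq_tsum hf h2 h1,
    ← (Equiv.prodComm _ _).tsum_eq]
  refine tsum_congr fun p => ?_
  simp only [ipTerm, adj, Equiv.prodComm_apply, Prod.fst_swap, Prod.snd_swap, Complex.conj_conj]
  rw [mul_comm (Real.sqrt _), mul_comm (f _ _)]

/-- Moving `A_l` to the other side means passing it through `ρ^{1/2}`. In coordinates this is the
reindexing `m ↦ m + δ_l`, under which the square root of the density changes by `e^{β/2}`. -/
theorem scal_ann_mul {f g : Op d} (hf : IsObs f) (hg : IsObs g) (l : Site d) :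
    scal β (mul (ann l) f) g = Complex.exp (β / 2) * scal β f (mul (adj (ann l)) g) := by
  obtain ⟨Λ, h1, h2, hl⟩ := exists_isLocal₂ hf hg l
  rw [(IsObs.mul _ _ (.ann l) hf).scal_eq_tsum hg ((isLocal_ann hl).mul h1) h2,
    hf.scal_eq_tsum (.mul _ _ (.cre l) hg) h1 ((isLocal_ann hl).adj.mul h2), ← tsum_mul_left]
  rw [← (succ_prod_injective hl).tsum_eq (f := fun p : FinCfg Λ × FinCfg Λ =>
    Complex.exp (β / 2) * ipTerm β Λ f (mul (adj (ann l)) g) p)]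
  · refine tsum_congr fun p => ?_
    have h4 : (p.1.succ hl).1 = p.1.1 + Finsupp.single l 1 := rfl
    have h5 : Complex.exp (β / 2) = (Real.exp (β / 2) : ℝ) := by push_cast; rfl
    simp only [ipTerm]
    rw [sqrt_density_succ hl p.1, h4, cre_mul_apply, ann_mul_apply, map_mul, Complex.conj_ofReal,
      h5]
    push_cast
    ring
  · intro p hp
    by_contra h
    refine hp ?_
    simp [ipTerm, cre_mul_apply_of_eq_zero g (eq_zero_of_notMem_range_succ hl h)]

theorem scal_ladder_mul {f g : Op d} (hf : IsObs f) (hg : IsObs g) (s : Bool) (l : Site d) :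
    scal β (mul (ladder s l) f) g =
      Complex.exp (β * sgn s / 2) * scal β f (mul (ladder (!s) l) g) := by
  cases s
  · have h := scal_ann_mul (β := β) hg hf l
    have h' := congrArg (starRingEnd ℂ) h
    rw [conj_scal, map_mul, conj_scal, ← Complex.exp_conj] at h'
    simp only [ladder, cond_false, cond_true, Bool.not_false, h', ← mul_assoc, ← Complex.exp_add]
    simp [sgn, Complex.conj_ofNat]
    rw [neg_div, neg_add_cancel, Complex.exp_zero, one_mul]
  · simpa [ladder, sgn] using scal_ann_mul (β := β) hf hg l

theorem scal_mul_ladder {f g : Op d} (hf : IsObs f) (hg : IsObs g) (s : Bool) (l : Site d) :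
    scal β (mul f (ladder s l)) g =
      Complex.exp (-(β * sgn s / 2)) * scal β f (mul g (ladder (!s) l)) := by
  have hl : ∀ s, IsObs (ladder s l) := fun s => isObs_ladder s l
  rw [mul_ladder_eq f, mul_ladder_eq g, Bool.not_not]
  have e1 := scal_adj_adj (β := β) (.mul _ _ (hl (!s)) hf.adj) hg.adj
  have e2 := scal_adj_adj (β := β) hf.adj (.mul _ _ (hl s) hg.adj)
  rw [adj_adj] at e1 e2
  rw [e1, e2, scal_ladder_mul hg.adj hf.adj, ← mul_assoc, ← Complex.exp_add, neg_add_cancel,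
    Complex.exp_zero, one_mul]

/-- `δ_X^⋆` is the adjoint of `δ_X`, for ladder operators `X`. -/
theorem scal_delta_ladder {f g : Op d} (hf : IsObs f) (hg : IsObs g) (s : Bool) (l : Site d) :
    scal β (delta (ladder s l) f) g = scal β f (deltaStar β (ladder s l) g) := by
  have hl : ∀ s, IsObs (ladder s l) := fun s => isObs_ladder s l
  have h1 : InL2 β (mul (ladder s l) f) := (IsObs.mul _ _ (hl s) hf).inL2
  have h2 : InL2 β (mul f (ladder s l)) := (IsObs.mul _ _ hf (hl s)).inL2
  have h3 : InL2 β (mul (ladder (!s) l) g) := (IsObs.mul _ _ (hl _) hg).inL2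
  have h4 : InL2 β (mul g (ladder (!s) l)) := (IsObs.mul _ _ hg (hl _)).inL2
  rw [delta, (h1.sub h2).scal_smul_left, h1.scal_sub_left h2, deltaStar_ladder, twist,
    smul_mul_op, mul_smul_op, ((h4.smul _).sub (h3.smul _)).scal_smul_right,
    (h4.smul _).scal_sub_right (h3.smul _), h4.scal_smul_right, h3.scal_smul_right,
    scal_ladder_mul hf hg, scal_mul_ladder hf hg, Complex.conj_I]
  ring

/-- By duality `‖δ^⋆ f‖² = ⟨δ δ^⋆ f, f⟩`, and outside the region of `f` the commutation relations
make `δ δ^⋆ f` a scalar multiple of `f`. The scalar does not depend on the site. -/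
theorem IsLocal.norm_deltaStar_ladder {Λ : Finset (Site d)} {f : Op d} (hf : IsLocal Λ f)
    (hf' : IsObs f) (s : Bool) {l : Site d} (hl : l ∉ Λ) :
    ‖cls β (YFields.deltaStar β (ladder s l) f)‖ ^ 2 =
      ‖(Complex.exp (β * sgn s / 2) - Complex.exp (-(β * sgn s / 2))) * sgn s‖ *
        ‖cls β f‖ ^ 2 := by
  have h1 := scal_delta_ladder (β := β) (hf'.deltaStar_ladder β s l) hf' s l
  rw [hf.delta_deltaStar_ladder hf'.locFin β s hl, hf'.inL2.scal_smul_left, scal, scal,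
    inner_self_eq_norm_sq_to_K, inner_self_eq_norm_sq_to_K] at h1
  have h2 := congrArg (fun z : ℂ => ‖z‖) h1
  simp only [norm_mul, norm_pow, RCLike.norm_conj, RCLike.norm_ofReal, abs_norm] at h2 ⊢
  exact h2.symm

/-- The norms of the operators `δ_{A_l}^⋆ (f)`, `δ_{A_l^*}^⋆ (f)` are bounded uniformly in `l`. -/
theorem exists_norm_deltaStar_le {f : Op d} (hf : IsObs f) (s : Bool) :
    ∃ C : ℝ, ∀ l, ‖cls β (deltaStar β (ladder s l) f)‖ ≤ C := by
  obtain ⟨Λ, hΛ⟩ := hf.exists_isLocal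
  set γ := ‖(Complex.exp (β * sgn s / 2) - Complex.exp (-(β * sgn s / 2))) * sgn s‖
  -- The first term is the common norm for all sites outside `Λ`; the finitely many sites in `Λ` are
  -- covered by adding up their norms.
  refine ⟨Real.sqrt (γ * ‖cls β f‖ ^ 2) +
    ∑ l ∈ Λ, ‖cls β (deltaStar β (ladder s l) f)‖, fun l => ?_⟩
  by_cases hl : l ∈ Λ
  · exact (Finset.single_le_sum (f := fun l => ‖cls β (deltaStar β (ladder s l) f)‖)
      (fun _ _ => norm_nonneg _) hl).trans (le_add_of_nonneg_left (Real.sqrt_nonneg _))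
  · rw [← hΛ.norm_deltaStar_ladder hf s hl, Real.sqrt_sq (norm_nonneg _)]
    exact le_add_of_nonneg_right (Finset.sum_nonneg fun _ _ => norm_nonneg _)

/-- Series of local operators `δ_{A_l}^⋆ (f)` in `L²(ω₀)`. -/
theorem rep_tsum_deltaStar {f : Op d} (hf : IsObs f) (s : Bool) {c : Site d → ℂ}
    (hc : Summable fun l => ‖c l‖) :
    Summable (fun l => c l • cls β (deltaStar β (ladder s l) f)) ∧
    Rep β (fun m n => ∑' l, c l * deltaStar β (ladder s l) f m n)
      (∑' l, c l • cls β (deltaStar β (ladder s l) f)) := by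
  obtain ⟨C, hC⟩ := exists_norm_deltaStar_le (β := β) hf s
  obtain ⟨Λ, hΛ⟩ := hf.exists_isLocal
  have hs : Summable fun l => c l • cls β (deltaStar β (ladder s l) f) := by
    refine .of_norm_bounded (hc.mul_right C) fun l => ?_
    rw [norm_smul]
    exact mul_le_mul_of_nonneg_left (hC l) (norm_nonneg _)
  refine ⟨hs, ?_⟩
  have hobs : ∀ l, IsObs (deltaStar β (ladder s l) f) := fun l => hf.deltaStar_ladder β s l
  set K : Op d := fun m n => ∑' l, c l * deltaStar β (ladder s l) f m n with hK
  -- Compressing to `H_Λ'` removes exactly the terms with `l ∉ Λ'`, as these change the occupation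
  -- number at `l`. Compressions are therefore the finite partial sums, and their convergence is the
  -- unconditional convergence of the series.
  have hloc : ∀ Λ', Λ ⊆ Λ' → localize Λ' K = ∑ l ∈ Λ', c l • deltaStar β (ladder s l) f := by
    intro Λ' h
    have hfin : ∀ l ∈ Λ', localize Λ' (deltaStar β (ladder s l) f) =
        deltaStar β (ladder s l) f := fun l hl =>
      localize_eq_self (Finset.Subset.refl Λ') ((hΛ.mono h).deltaStar_ladder β s hl)
    funext m n
    rw [Finset.sum_apply, Finset.sum_apply,
      ← Finset.sum_congr rfl fun l hl => by rw [← hfin l hl]]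
    unfold localize
    by_cases hmn : m.filter (fun j => j ∉ Λ') = n.filter fun j => j ∉ Λ'
    · simp only [hmn, if_true, hK, Pi.smul_apply, smul_eq_mul]
      refine tsum_eq_sum fun l hl => ?_
      rw [hΛ.deltaStar_ladder_apply β s (fun hl' => hl (h hl')) (by simp [hl]), mul_zero]
    · simp [hmn]
  have hmem : ∀ Λ', Λ ⊆ Λ' → localize Λ' K ∈ localL2 d β := fun Λ' h => by
    rw [hloc Λ' h]
    exact (localL2 d β).sum_mem fun l _ => (localL2 d β).smul_mem _ (hobs l).mem_localL2
  refine ⟨fun Λ' => ?_, ?_⟩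
  · refine localize_mem (summable_wTerm_mono (Finset.subset_union_left (s₂ := Λ)) ?_)
    refine (summable_wTerm_of_mem (hmem (Λ' ∪ Λ) Finset.subset_union_right) (Λ' ∪ Λ)).congr
      fun p => ?_
    rw [wTerm, localize_apply, wTerm]
  · refine hs.hasSum.congr' ((eventually_ge_atTop Λ).mono fun Λ' h => ?_)
    have e : cls β (localize Λ' K) = _ := cls_ofLocal (hmem Λ' h)
    refine Eq.trans ?_ e
    rw [hloc Λ' h, cls_sum _ fun l _ => (hobs l).inL2.smul _]
    exact Finset.sum_congr rfl fun l _ => ((hobs l).inL2.cls_smul _).symm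

end
end YFields
-- Linear fields and the explicit evaluation of the Dirichlet forms.
namespace YFields
noncomputable section
variable {d : ℕ}

/-! ### Linear fields -/

/-- The field `∑_l c_l A_l` (`s = true`) or `∑_l c_l A_l^*` (`s = false`). -/
def lin (s : Bool) (c : Site d → ℂ) : Op d := fun m n => ∑' l, c l * ladder s l m n

/-- The complex conjugate of a coefficient function. -/
def conjFun (c : Site d → ℂ) : Site d → ℂ := fun l => (starRingEnd ℂ) (c l)

theorem adj_lin (s : Bool) (c : Site d → ℂ) : adj (lin s c) = lin (!s) (conjFun c) := by
  funext m n
  simp only [adj, lin, Complex.conj_tsum, map_mul, ← adj_ladder]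
  rfl

theorem lin_neg (s : Bool) (c : Site d → ℂ) : lin s (-c) = -lin s c := by
  funext m n
  simp only [lin, Pi.neg_apply, neg_mul, tsum_neg]

theorem modular_lin (β : ℝ) (z : ℂ) (s : Bool) (c : Site d → ℂ) :
    modular β z (lin s c) = Complex.exp (Complex.I * z * β * sgn s) • lin s c := by
  funext m n
  simp only [modular, lin, Pi.smul_apply, smul_eq_mul, ← tsum_mul_left]
  refine tsum_congr fun l => ?_
  have := congrFun (congrFun (modular_ladder β z s l) m) n
  simp only [modular, Pi.smul_apply, smul_eq_mul] at this
  rw [mul_left_comm, this, mul_left_comm]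

theorem finite_ladder (s : Bool) (m n : Cfg d) : {l : Site d | ladder s l m n ≠ 0}.Finite := by
  classical
  refine (m.support ∪ n.support).finite_toSet.subset fun l hl => ?_
  have := ladder_ne hl
  rw [Finset.mem_coe, Finset.mem_union, Finsupp.mem_support_iff, Finsupp.mem_support_iff]
  by_contra h
  push Not at h
  exact this (h.1.trans h.2.symm)

/-- For fixed `m`, `p` only finitely many sites have a ladder operator with a non-zero entry, and
the column of `f` is finite. The double sum is finite, so no decay of `c` is required. -/
theorem hasSum_lin_mul {f : Op d} (hf : ColFin f) (s : Bool) (c : Site d → ℂ) (m n : Cfg d) :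
    HasSum (fun l => c l * mul (ladder s l) f m n) (mul (lin s c) f m n) := by
  have h1 : Summable (Function.uncurry fun (p : Cfg d) (l : Site d) =>
      c l * (ladder s l m p * f p n)) := by
    refine summable_of_hasFiniteSupport
      (((hf n).biUnion fun p _ => (Set.finite_singleton p).prod (finite_ladder s m p)).subset ?_)
    rintro ⟨p, l⟩ h
    have h' := right_ne_zero_of_mul h
    simp only [Set.mem_iUnion]
    exact ⟨p, right_ne_zero_of_mul h', rfl, left_ne_zero_of_mul h'⟩
  have h2 : mul (lin s c) f m n = ∑' l, c l * mul (ladder s l) f m n := by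
    calc mul (lin s c) f m n = ∑' p, ∑' l, c l * (ladder s l m p * f p n) := by
          refine tsum_congr fun p => ?_
          rw [lin, ← tsum_mul_right]
          exact tsum_congr fun l => mul_assoc _ _ _
      _ = ∑' l, ∑' p, c l * (ladder s l m p * f p n) := h1.tsum_comm.symm
      _ = _ := tsum_congr fun l => tsum_mul_left
  rw [h2]
  have h3 : Summable fun l => ∑' p, c l * (ladder s l m p * f p n) := h1.prod_symm.prod
  simp only [tsum_mul_left] at h3
  exact h3.hasSum

theorem hasSum_mul_lin {f : Op d} (hf : RowFin f) (s : Bool) (c : Site d → ℂ) (m n : Cfg d) :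
    HasSum (fun l => c l * mul f (ladder s l) m n) (mul f (lin s c) m n) := by
  have h := hasSum_lin_mul (colFin_adj.2 hf) (!s) (conjFun c) n m
  rw [← adj_lin, ← adj_mul] at h
  have h' := h.map (starRingEnd ℂ) Complex.continuous_conj
  rw [show (starRingEnd ℂ) (adj (mul f (lin s c)) n m) = mul f (lin s c) m n by simp [adj]] at h'
  refine h'.congr_fun fun l => ?_
  rw [Function.comp_apply, ← adj_ladder, ← adj_mul]
  simp [adj, conjFun]

theorem LocFin.hasSum_delta_lin {f : Op d} (hf : LocFin f) (s : Bool) (c : Site d → ℂ)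
    (m n : Cfg d) :
    HasSum (fun l => c l * delta (ladder s l) f m n) (delta (lin s c) f m n) := by
  refine (((hasSum_lin_mul hf.col s c m n).sub (hasSum_mul_lin hf.row s c m n)).mul_left
    Complex.I).congr_fun fun l => ?_
  rw [delta_apply]
  ring

/-- Ladder operators outside `Λ` commute with `f`. This reduces derivations along infinite fields to
local ones. -/
theorem IsLocal.delta_lin {Λ : Finset (Site d)} {f : Op d} (hΛ : IsLocal Λ f) (hf : LocFin f)
    (s : Bool) (c : Site d → ℂ) :
    YFields.delta (lin s c) f = ∑ l ∈ Λ, c l • YFields.delta (ladder s l) f := by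
  funext m n
  rw [← (hf.hasSum_delta_lin s c m n).tsum_eq, Finset.sum_apply, Finset.sum_apply]
  refine tsum_eq_sum fun l hl => ?_
  rw [hΛ.delta_ladder s hl]
  simp

/-- Unlike `IsLocal.delta_lin`, the series does not in general reduce to the region of `f`: the two
modular factors in `δ^⋆` differ, so no cancellation occurs outside. The coefficients are conjugated
because `δ^⋆` is antilinear in the field. -/
theorem LocFin.hasSum_deltaStar_lin {f : Op d} (hf : LocFin f) (β : ℝ) (s : Bool)
    (c : Site d → ℂ) (m n : Cfg d) :
    HasSum (fun l => (starRingEnd ℂ) (c l) * deltaStar β (ladder s l) f m n)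
      (deltaStar β (lin s c) f m n) := by
  have h := (((hasSum_mul_lin hf.row (!s) (conjFun c) m n).mul_left
      (Complex.exp (Complex.I * -(Complex.I / 2) * β * sgn (!s)))).sub
    ((hasSum_lin_mul hf.col (!s) (conjFun c) m n).mul_left
      (Complex.exp (Complex.I * (Complex.I / 2) * β * sgn (!s))))).mul_left Complex.I
  simp only [deltaStar, adj_lin, modular_lin, adj_ladder, modular_ladder, smul_mul_op, mul_smul_op]
  refine h.congr_fun fun l => ?_
  simp only [Pi.smul_apply, Pi.sub_apply, smul_eq_mul, conjFun]
  ring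

theorem isObs_delta_lin {f : Op d} (hf : IsObs f) (s : Bool) (c : Site d → ℂ) :
    IsObs (delta (lin s c) f) := by
  obtain ⟨Λ, hΛ⟩ := hf.exists_isLocal
  rw [hΛ.delta_lin hf.locFin]
  exact isObs_sum _ fun l _ => .smul _ _ ((isObs_ladder s l).delta hf)

/-- The field `∑_l (a_l A_l + a'_l A_l^*)`, with `a = a true` and `a' = a false`. -/
def fieldOf (a : Bool → Site d → ℂ) : Op d := lin true (a true) + lin false (a false)

/-- The translates of a field. -/
def fields (a : Bool → Site d → ℂ) (j : Site d) : Op d := fieldOf fun s => shift j (a s)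

/-- The coefficients of the adjoint field. -/
def adjCoef (a : Bool → Site d → ℂ) : Bool → Site d → ℂ := fun s => conjFun (a (!s))

theorem adjCoef_adjCoef (a : Bool → Site d → ℂ) : adjCoef (adjCoef a) = a := by
  funext s l
  simp [adjCoef, conjFun]

theorem adj_fieldOf (a : Bool → Site d → ℂ) : adj (fieldOf a) = fieldOf (adjCoef a) := by
  rw [fieldOf, adj_add, adj_lin, adj_lin, add_comm]
  rfl

theorem adj_fields (a : Bool → Site d → ℂ) (j : Site d) :
    adj (fields a j) = fields (adjCoef a) j := by
  rw [fields, adj_fieldOf]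
  rfl

theorem yField_shift (κ ξ : Site d → ℂ) (j : Site d) :
    yField (shift j κ) (shift j ξ) = fields (fun s => cond s κ (-conjFun ξ)) j := by
  rw [yField, sub_eq_add_neg, fields, fieldOf]
  congr 1
  rw [show shift j (cond false κ (-conjFun ξ)) = -conjFun (shift j ξ) from rfl, lin_neg]
  congr 1
  exact adj_lin true _

theorem delta_modular_fieldOf {f : Op d} (hf : LocFin f) (β : ℝ) (z : ℂ)
    (a : Bool → Site d → ℂ) :
    delta (modular β z (fieldOf a)) f =
      ∑ s, Complex.exp (Complex.I * z * β * sgn s) • delta (lin s (a s)) f := by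
  rw [fieldOf, modular_add, hf.delta_add_left, modular_lin, modular_lin, delta_smul_left,
    delta_smul_left, Fintype.sum_bool]

theorem deltaStar_smul_left (β : ℝ) (c : ℂ) (X g : Op d) :
    deltaStar β (c • X) g = (starRingEnd ℂ) c • deltaStar β X g := by
  rw [deltaStar_eq_twist, adj_smul, modular_smul, modular_smul, twist_smul_left,
    deltaStar_eq_twist]

theorem LocFin.deltaStar_add_left {g : Op d} (hg : LocFin g) (β : ℝ) (X X' : Op d) :
    deltaStar β (X + X') g = deltaStar β X g + deltaStar β X' g := by
  rw [deltaStar_eq_twist, adj_add, modular_add, modular_add, hg.twist_add_left,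
    deltaStar_eq_twist, deltaStar_eq_twist]

theorem LocFin.deltaStar_add {f g : Op d} (hf : LocFin f) (hg : LocFin g) (β : ℝ) (X : Op d) :
    deltaStar β X (f + g) = deltaStar β X f + deltaStar β X g :=
  hf.twist_add hg _ _

theorem deltaStar_smul (β : ℝ) (X : Op d) (c : ℂ) (g : Op d) :
    deltaStar β X (c • g) = c • deltaStar β X g := twist_smul _ _ _ _

/-- The modular frequencies. -/
def freq (β : ℝ) (s s' : Bool) : ℝ := β * (sgn s - sgn s')

theorem conj_exp_mul_exp (β t : ℝ) (s s' : Bool) :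
    (starRingEnd ℂ) (Complex.exp (Complex.I * t * β * sgn s')) *
      Complex.exp (Complex.I * t * β * sgn s) = Complex.exp (Complex.I * freq β s s' * t) := by
  rw [← Complex.exp_conj, ← Complex.exp_add]
  congr 1
  simp [freq]
  ring

/-! ### Admissible functions -/

theorem Admissible.continuous {η : ℂ → ℂ} (hη : Admissible η) {s : ℝ} (hs : |s| ≤ 1 / 4) :
    Continuous fun t : ℝ => η (t + s * Complex.I) := by
  refine hη.analytic.continuousOn.comp_continuous (by fun_prop) fun t => ?_
  simpa using hs

theorem Admissible.integrable {η : ℂ → ℂ} (hη : Admissible η) {s : ℝ} (hs : |s| ≤ 1 / 4) :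
    Integrable fun t : ℝ => η (t + s * Complex.I) := by
  obtain ⟨M, p, -, hp, h⟩ := hη.decay
  have h1 : Integrable fun t : ℝ => M * (1 + ‖t‖) ^ (-p) :=
    (integrable_one_add_norm (by simpa using hp)).const_mul M
  exact h1.mono' (hη.continuous hs).aestronglyMeasurable (.of_forall fun t => h t s hs)

theorem Admissible.integrable_mul_exp {η : ℂ → ℂ} (hη : Admissible η) {s : ℝ} (hs : |s| ≤ 1 / 4)
    (w : ℝ) : Integrable fun t : ℝ => η (t + s * Complex.I) * Complex.exp (Complex.I * w * t) := by
  refine (hη.integrable hs).mul_bdd (c := 1) (by fun_prop) (.of_forall fun t => ?_)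
  rw [show Complex.I * w * t = ((w * t : ℝ) : ℂ) * Complex.I by push_cast; ring,
    Complex.norm_exp_ofReal_mul_I]

theorem Admissible.integrable_real {η : ℂ → ℂ} (hη : Admissible η) (w : ℝ) :
    Integrable fun t : ℝ => η t * Complex.exp (Complex.I * w * t) := by
  simpa using hη.integrable_mul_exp (s := 0) (by norm_num) w

theorem Admissible.conj {η : ℂ → ℂ} (hη : Admissible η) (t : ℝ) :
    (starRingEnd ℂ) (η t) = η t := Complex.conj_eq_iff_im.2 (hη.nonneg t).1

/-! ### Correlations of summable functions on the lattice -/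

/-- The correlation `∑_j conj (c'_{l' - j}) c_{l - j}`. -/
def corr (c c' : Site d → ℂ) (l l' : Site d) : ℂ :=
  ∑' j, (starRingEnd ℂ) (shift j c' l') * shift j c l

/-- For fixed `l`, the map `(l', j) ↦ (l' - j, l - j)` is injective, so the family is a subfamily of
the summable product `‖c'‖ ⊗ ‖c‖`. -/
theorem summable_corr_prod {c c' : Site d → ℂ} (hc : Summable fun l => ‖c l‖)
    (hc' : Summable fun l => ‖c' l‖) (l : Site d) :
    Summable fun p : Site d × Site d =>
      ‖(starRingEnd ℂ) (shift p.2 c' p.1) * shift p.2 c l‖ := by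
  have h1 := hc'.mul_of_nonneg hc (fun _ => norm_nonneg _) fun _ => norm_nonneg _
  have hinj : Function.Injective fun p : Site d × Site d => (p.1 - p.2, l - p.2) := by
    rintro ⟨x, y⟩ ⟨x', y'⟩ h
    simp only [Prod.mk.injEq, sub_right_inj] at h
    obtain ⟨h, rfl⟩ := h
    rw [sub_left_inj] at h
    rw [h]
  refine (h1.comp_injective hinj).congr fun p => ?_
  simp [shift]

theorem summable_corr_term {c c' : Site d → ℂ} (hc : Summable fun l => ‖c l‖)
    (hc' : Summable fun l => ‖c' l‖) (l l' : Site d) :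
    Summable fun j => (starRingEnd ℂ) (shift j c' l') * shift j c l :=
  ((summable_corr_prod hc hc' l).prod_factor l').of_norm

theorem summable_norm_corr {c c' : Site d → ℂ} (hc : Summable fun l => ‖c l‖)
    (hc' : Summable fun l => ‖c' l‖) (l : Site d) : Summable fun l' => ‖corr c c' l l'‖ :=
  .of_nonneg_of_le (fun _ => norm_nonneg _)
    (fun l' => norm_tsum_le_tsum_norm ((summable_corr_prod hc hc' l).prod_factor l'))
    (summable_corr_prod hc hc' l).prod

/-! ### Dirichlet forms -/

variable {β : ℝ} [hβ : Fact (0 < β)]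

theorem hasSum_scal_lin {Λ : Finset (Site d)} {f g : Op d} (hf : IsObs f) (hg : IsObs g)
    (hfΛ : IsLocal Λ f) (hgΛ : IsLocal Λ g) {c c' : Site d → ℂ} (hc : Summable fun l => ‖c l‖)
    (hc' : Summable fun l => ‖c' l‖) (s s' : Bool) :
    HasSum (fun j => scal β (delta (lin s' (shift j c')) g) (delta (lin s (shift j c)) f))
      (∑ l' ∈ Λ, ∑ l ∈ Λ, corr c c' l l' *
        scal β (delta (ladder s' l') g) (delta (ladder s l) f)) := by
  have h : ∀ j, scal β (delta (lin s' (shift j c')) g) (delta (lin s (shift j c)) f) =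
      ∑ l' ∈ Λ, ∑ l ∈ Λ, (starRingEnd ℂ) (shift j c' l') * shift j c l *
        scal β (delta (ladder s' l') g) (delta (ladder s l) f) := fun j => by
    rw [hgΛ.delta_lin hg.locFin, hfΛ.delta_lin hf.locFin, scal_sum_sum]
    · exact fun l _ => ((isObs_ladder s' l).delta hg).inL2
    · exact fun l _ => ((isObs_ladder s l).delta hf).inL2
  simp_rw [h]
  exact hasSum_sum fun l' _ => hasSum_sum fun l _ =>
    (summable_corr_term hc hc' l l').hasSum.mul_right _

theorem summable_scal_lin {f g : Op d} (hf : IsObs f) (hg : IsObs g) {c c' : Site d → ℂ}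
    (hc : Summable fun l => ‖c l‖) (hc' : Summable fun l => ‖c' l‖) (s s' : Bool) :
    Summable fun j => scal β (delta (lin s' (shift j c')) g) (delta (lin s (shift j c)) f) := by
  obtain ⟨Λ, h1, h2, -⟩ := exists_isLocal₂ hf hg 0
  exact (hasSum_scal_lin hf hg h1 h2 hc hc' s s').summable

/-- The whole dependence on `t` sits in the phases of the annihilation and creation parts; only the
frequencies `0` and `±2β` occur. -/
theorem formIntegrand_fieldOf {f g : Op d} (hf : IsObs f) (hg : IsObs g) (η : ℂ → ℂ)
    (a : Bool → Site d → ℂ) :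
    formIntegrand β η (fieldOf a) g f = fun t : ℝ => ∑ s', ∑ s,
      scal β (delta (lin s' (a s')) g) (delta (lin s (a s)) f) *
        (η t * Complex.exp (Complex.I * freq β s s' * t)) := by
  funext t
  rw [formIntegrand, delta_modular_fieldOf hf.locFin, delta_modular_fieldOf hg.locFin,
    scal_sum_sum, Finset.sum_mul]
  · refine Finset.sum_congr rfl fun s' _ => ?_
    rw [Finset.sum_mul]
    refine Finset.sum_congr rfl fun s _ => ?_
    rw [conj_exp_mul_exp]
    ring
  · exact fun s _ => (isObs_delta_lin hg s _).inL2
  · exact fun s _ => (isObs_delta_lin hf s _).inL2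

theorem integrable_formIntegrand {η : ℂ → ℂ} (hη : Admissible η) {f g : Op d} (hf : IsObs f)
    (hg : IsObs g) (a : Bool → Site d → ℂ) :
    Integrable (formIntegrand β η (fieldOf a) g f) := by
  rw [formIntegrand_fieldOf hf hg]
  exact integrable_finsetSum _ fun s' _ => integrable_finsetSum _ fun s _ =>
    (hη.integrable_real _).const_mul _

theorem integral_formIntegrand {η : ℂ → ℂ} (hη : Admissible η) {f g : Op d} (hf : IsObs f)
    (hg : IsObs g) (a : Bool → Site d → ℂ) :
    ∫ t, formIntegrand β η (fieldOf a) g f t = ∑ s', ∑ s, etaHat η (freq β s s') *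
      scal β (delta (lin s' (a s')) g) (delta (lin s (a s)) f) := by
  rw [formIntegrand_fieldOf hf hg, integral_finsetSum _ fun s' _ =>
    integrable_finsetSum _ fun s _ => (hη.integrable_real _).const_mul _]
  refine Finset.sum_congr rfl fun s' _ => ?_
  rw [integral_finsetSum _ fun s _ => (hη.integrable_real _).const_mul _]
  refine Finset.sum_congr rfl fun s _ => ?_
  rw [integral_const_mul, etaHat, mul_comm]

theorem hasSum_form {η : ℂ → ℂ} (hη : Admissible η) {f g : Op d} (hf : IsObs f)
    (hg : IsObs g) {a : Bool → Site d → ℂ} (ha : ∀ s, Summable fun l => ‖a s l‖) :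
    HasSum (fun j => ∫ t, formIntegrand β η (fields a j) g f t)
      (∑ s', ∑ s, etaHat η (freq β s s') * ∑' j,
        scal β (delta (lin s' (shift j (a s'))) g) (delta (lin s (shift j (a s))) f)) := by
  simp_rw [fields, integral_formIntegrand hη hf hg]
  exact hasSum_sum fun s' _ => hasSum_sum fun s _ =>
    (summable_scal_lin hf hg (ha s) (ha s') s s').hasSum.mul_left _

theorem form_eq_sum {η : ℂ → ℂ} (hη : Admissible η) {f g : Op d} (hf : IsObs f)
    (hg : IsObs g) {a : Bool → Site d → ℂ} (ha : ∀ s, Summable fun l => ‖a s l‖) :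
    form β η (fields a) g f = ∑ s', ∑ s, etaHat η (freq β s s') * ∑' j,
        scal β (delta (lin s' (shift j (a s'))) g) (delta (lin s (shift j (a s))) f) :=
  (hasSum_form hη hf hg ha).tsum_eq

/-- A finite expression in local derivatives. It is matched with the generator in `genSum_inL2`, and
it makes the form continuous along local sequences in `tendsto_form`. -/
theorem form_eq_corr {η : ℂ → ℂ} (hη : Admissible η) {Λ : Finset (Site d)} {f g : Op d}
    (hf : IsObs f) (hg : IsObs g) (hfΛ : IsLocal Λ f) (hgΛ : IsLocal Λ g)
    {a : Bool → Site d → ℂ} (ha : ∀ s, Summable fun l => ‖a s l‖) :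
    form β η (fields a) g f = ∑ s', ∑ s, etaHat η (freq β s s') *
      ∑ l' ∈ Λ, ∑ l ∈ Λ, corr (a s) (a s') l l' *
        scal β (delta (ladder s' l') g) (delta (ladder s l) f) := by
  rw [form_eq_sum hη hf hg ha]
  refine Finset.sum_congr rfl fun s' _ => Finset.sum_congr rfl fun s _ => ?_
  rw [(hasSum_scal_lin hf hg hfΛ hgΛ (ha s) (ha s') s s').tsum_eq]

theorem formConverges_fields {η : ℂ → ℂ} (hη : Admissible η) {f g : Op d} (hf : IsObs f)
    (hg : IsObs g) {a : Bool → Site d → ℂ} (ha : ∀ s, Summable fun l => ‖a s l‖) :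
    FormConverges β η (fields a) g f := by
  have h : ∀ {f : Op d}, IsObs f → ∀ j (t : ℝ), InL2 β (delta (modular β t (fields a j)) f) := by
    intro f hf j t
    rw [fields, delta_modular_fieldOf hf.locFin]
    exact inL2_sum _ fun s _ => (isObs_delta_lin hf s _).inL2.smul _
  exact ⟨h hg, h hf, fun j => integrable_formIntegrand hη hf hg _,
    (hasSum_form hη hf hg ha).summable⟩

theorem pairingConverges_lin {f : Op d} (hf : IsObs f) {c c' : Site d → ℂ}
    (hc : Summable fun l => ‖c l‖) (hc' : Summable fun l => ‖c' l‖) (s s' : Bool) :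
    PairingConverges β (fun j => lin s' (shift j c')) (fun j => lin s (shift j c)) f :=
  ⟨fun _ => (isObs_delta_lin hf _ _).inL2, fun _ => (isObs_delta_lin hf _ _).inL2,
    summable_scal_lin hf hf hc hc' s s'⟩

theorem conj_formIntegrand {η : ℂ → ℂ} (hη : Admissible η) (X f g : Op d) (t : ℝ) :
    (starRingEnd ℂ) (formIntegrand β η X g f t) = formIntegrand β η X f g t := by
  rw [formIntegrand, map_mul, conj_scal, hη.conj, formIntegrand]

theorem conj_form {η : ℂ → ℂ} (hη : Admissible η) (X : Site d → Op d) (f g : Op d) :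
    (starRingEnd ℂ) (form β η X g f) = form β η X f g := by
  rw [form, Complex.conj_tsum]
  refine tsum_congr fun j => ?_
  rw [← integral_conj]
  simp only [conj_formIntegrand hη]

theorem form_self_re_nonneg {η : ℂ → ℂ} (hη : Admissible η) {f : Op d} (hf : IsObs f)
    {a : Bool → Site d → ℂ} (ha : ∀ s, Summable fun l => ‖a s l‖) :
    0 ≤ (form β η (fields a) f f).re := by
  have h := Complex.hasSum_re (hasSum_form (β := β) hη hf hf ha)
  rw [← form_eq_sum hη hf hf ha] at h
  refine h.nonneg fun j => ?_
  have h1 : ∀ t, 0 ≤ (formIntegrand β η (fields a j) f f t).re := fun t => by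
    rw [formIntegrand, scal, inner_self_eq_norm_sq_to_K]
    have : ∀ x : ℝ, (((x : ℝ) : ℂ) ^ 2 * η t).re = x ^ 2 * (η t).re := fun x => by
      rw [← Complex.ofReal_pow, Complex.re_ofReal_mul]
    exact (this _).symm ▸ mul_nonneg (sq_nonneg _) (hη.nonneg t).2
  have h2 := integral_re (𝕜 := ℂ) (integrable_formIntegrand (β := β) hη hf hf
    fun s => shift j (a s))
  exact (integral_nonneg h1).trans_eq h2

end
end YFields
-- The generator, by matrix elements and as a vector in `L²(ω₀)`.
namespace YFields
noncomputable section
variable {d : ℕ}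

/-! ### The generator -/

theorem locFin_delta_lin {f : Op d} (hf : IsObs f) (s : Bool) (c : Site d → ℂ) :
    LocFin (delta (lin s c) f) := (isObs_delta_lin hf s c).locFin

theorem deltaStar_zero (β : ℝ) (X : Op d) : deltaStar β X 0 = 0 := by
  have := deltaStar_smul β X 0 0
  rwa [zero_smul, zero_smul] at this

theorem deltaStar_sum {ι : Type*} (β : ℝ) (X : Op d) (S : Finset ι) {f : ι → Op d}
    (hf : ∀ i ∈ S, IsObs (f i)) :
    deltaStar β X (∑ i ∈ S, f i) = ∑ i ∈ S, deltaStar β X (f i) := by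
  classical
  induction S using Finset.induction_on with
  | empty => simp [deltaStar_zero]
  | insert a S ha ih =>
    have h2 : ∀ i ∈ S, IsObs (f i) := fun i hi => hf i (Finset.mem_insert_of_mem hi)
    rw [Finset.sum_insert ha, Finset.sum_insert ha, ← ih h2]
    exact (hf a (Finset.mem_insert_self a S)).locFin.deltaStar_add (isObs_sum S h2).locFin β X

theorem deltaStar_fieldOf {g : Op d} (hg : LocFin g) (β : ℝ) (z : ℂ) (a : Bool → Site d → ℂ) :
    deltaStar β (modular β z (fieldOf a)) g =
      ∑ s, (starRingEnd ℂ) (Complex.exp (Complex.I * z * β * sgn s)) •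
        deltaStar β (lin s (a s)) g := by
  rw [fieldOf, modular_add, hg.deltaStar_add_left, modular_lin, modular_lin, deltaStar_smul_left,
    deltaStar_smul_left, Fintype.sum_bool]

theorem deltaStar_delta_fieldOf {f : Op d} (hf : IsObs f) (β t : ℝ) (a : Bool → Site d → ℂ) :
    deltaStar β (modular β t (fieldOf a)) (delta (modular β t (fieldOf a)) f) =
      ∑ s', ∑ s, Complex.exp (Complex.I * freq β s s' * t) •
        deltaStar β (lin s' (a s')) (delta (lin s (a s)) f) := by
  have h : ∀ s, IsObs (Complex.exp (Complex.I * t * β * sgn s) • delta (lin s (a s)) f) :=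
    fun s => .smul _ _ (isObs_delta_lin hf _ _)
  rw [delta_modular_fieldOf hf.locFin,
    deltaStar_fieldOf (isObs_sum _ fun s _ => h s).locFin]
  refine Finset.sum_congr rfl fun s' _ => ?_
  rw [deltaStar_sum _ _ _ fun s _ => h s, Finset.smul_sum]
  refine Finset.sum_congr rfl fun s _ => ?_
  rw [deltaStar_smul, smul_smul, conj_exp_mul_exp]

/-- The contribution of one translate of a field to the generator. -/
def genPart (β : ℝ) (η : ℂ → ℂ) (a : Bool → Site d → ℂ) (j : Site d) (f : Op d) : Op d :=
  ∑ s', ∑ s, etaHat η (freq β s s') •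
    deltaStar β (lin s' (shift j (a s'))) (delta (lin s (shift j (a s))) f)

/-- The contribution of a field to the generator. -/
def genSum (β : ℝ) (η : ℂ → ℂ) (a : Bool → Site d → ℂ) (f : Op d) : Op d :=
  fun m n => ∑' j, genPart β η a j f m n

theorem integral_deltaStar_delta {η : ℂ → ℂ} (hη : Admissible η) {f : Op d} (hf : IsObs f)
    (β : ℝ) (a : Bool → Site d → ℂ) (j : Site d) (m n : Cfg d) :
    Integrable (fun t : ℝ => deltaStar β (modular β t (fields a j))
      (delta (modular β t (fields a j)) f) m n * η t) ∧
    ∫ t : ℝ, deltaStar β (modular β t (fields a j))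
      (delta (modular β t (fields a j)) f) m n * η t = genPart β η a j f m n := by
  have h : (fun t : ℝ => deltaStar β (modular β t (fields a j))
      (delta (modular β t (fields a j)) f) m n * η t) = fun t : ℝ => ∑ s', ∑ s,
        deltaStar β (lin s' (shift j (a s'))) (delta (lin s (shift j (a s))) f) m n *
          (η t * Complex.exp (Complex.I * freq β s s' * t)) := by
    funext t
    rw [fields, deltaStar_delta_fieldOf hf]
    simp only [Finset.sum_apply, Pi.smul_apply, smul_eq_mul, Finset.sum_mul]
    exact Finset.sum_congr rfl fun s' _ => Finset.sum_congr rfl fun s _ => by ring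
  have hi : ∀ s' s, Integrable fun t : ℝ =>
      deltaStar β (lin s' (shift j (a s'))) (delta (lin s (shift j (a s))) f) m n *
          (η t * Complex.exp (Complex.I * freq β s s' * t)) :=
    fun s' s => (hη.integrable_real _).const_mul _
  rw [h]
  refine ⟨integrable_finsetSum _ fun s' _ => integrable_finsetSum _ fun s _ => hi s' s, ?_⟩
  rw [integral_finsetSum _ fun s' _ => integrable_finsetSum _ fun s _ => hi s' s, genPart]
  simp only [Finset.sum_apply, Pi.smul_apply, smul_eq_mul]
  refine Finset.sum_congr rfl fun s' _ => ?_
  rw [integral_finsetSum _ fun s _ => hi s' s]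
  refine Finset.sum_congr rfl fun s _ => ?_
  rw [integral_const_mul, etaHat, mul_comm]

theorem integral_genIntegrand {η : ℂ → ℂ} (hη : Admissible η) {f : Op d} (hf : IsObs f)
    (β : ℝ) (a : Bool → Site d → ℂ) (j : Site d) (m n : Cfg d) :
    Integrable (genIntegrand β η (fields a j) f m n) ∧
    ∫ t : ℝ, genIntegrand β η (fields a j) f m n t =
      genPart β η a j f m n + genPart β η (adjCoef a) j f m n := by
  obtain ⟨h1, h2⟩ := integral_deltaStar_delta hη hf β a j m n
  obtain ⟨h3, h4⟩ := integral_deltaStar_delta hη hf β (adjCoef a) j m n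
  have h : genIntegrand β η (fields a j) f m n = fun t : ℝ =>
      deltaStar β (modular β t (fields a j)) (delta (modular β t (fields a j)) f) m n * η t +
      deltaStar β (modular β t (fields (adjCoef a) j))
        (delta (modular β t (fields (adjCoef a) j)) f) m n * η t := by
    funext t
    rw [genIntegrand, adj_fields, _root_.add_mul]
  rw [h]
  exact ⟨h1.add h3, by rw [integral_add h1 h3, h2, h4]⟩

theorem hasSum_deltaStar_delta_lin {Λ : Finset (Site d)} {f : Op d} (hf : IsObs f)
    (hfΛ : IsLocal Λ f) (β : ℝ) {c c' : Site d → ℂ} (hc : Summable fun l => ‖c l‖)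
    (hc' : Summable fun l => ‖c' l‖) (s s' : Bool) (m n : Cfg d) :
    HasSum (fun j => deltaStar β (lin s' (shift j c')) (delta (lin s (shift j c)) f) m n)
      (∑ l ∈ Λ, ∑' l', corr c c' l l' *
        deltaStar β (ladder s' l') (delta (ladder s l) f) m n) := by
  -- For a fixed matrix element only finitely many sites `l'` matter: at a site outside `Λ` and
  -- outside both supports, `m` and `n` agree and `deltaStar_ladder_apply` gives zero.
  set T := Λ ∪ (m.support ∪ n.support) with hT
  have hD : ∀ l, IsObs (delta (ladder s l) f) := fun l => (isObs_ladder s l).delta hf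
  have h0 : ∀ l, ∀ l' ∉ T, deltaStar β (ladder s' l') (delta (ladder s l) f) m n = 0 := by
    intro l l' hl'
    simp only [hT, Finset.mem_union, not_or, Finsupp.mem_support_iff, not_not] at hl'
    exact (hfΛ.delta_ladder_isLocal s l).deltaStar_ladder_apply β s' hl'.1
      (hl'.2.1.trans hl'.2.2.symm)
  have h1 : ∀ j, deltaStar β (lin s' (shift j c')) (delta (lin s (shift j c)) f) m n =
      ∑ l ∈ Λ, ∑ l' ∈ T, ((starRingEnd ℂ) (shift j c' l') * shift j c l) *
        deltaStar β (ladder s' l') (delta (ladder s l) f) m n := fun j => by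
    rw [hfΛ.delta_lin hf.locFin, deltaStar_sum _ _ _ fun l _ => .smul _ _ (hD l),
      Finset.sum_apply, Finset.sum_apply]
    refine Finset.sum_congr rfl fun l _ => ?_
    rw [deltaStar_smul, Pi.smul_apply, Pi.smul_apply, smul_eq_mul,
      ← ((hD l).locFin.hasSum_deltaStar_lin β s' (shift j c') m n).tsum_eq,
      tsum_eq_sum fun l' hl' => by rw [h0 l l' hl', mul_zero], Finset.mul_sum]
    exact Finset.sum_congr rfl fun l' _ => by ring
  simp_rw [h1]
  refine hasSum_sum fun l _ => ?_
  rw [tsum_eq_sum fun l' hl' => by rw [h0 l l' hl', mul_zero]]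
  exact hasSum_sum fun l' _ => (summable_corr_term hc hc' l l').hasSum.mul_right _

theorem hasSum_genPart {Λ : Finset (Site d)} {f : Op d} (hf : IsObs f) (hfΛ : IsLocal Λ f)
    (β : ℝ) (η : ℂ → ℂ) {a : Bool → Site d → ℂ} (ha : ∀ s, Summable fun l => ‖a s l‖)
    (m n : Cfg d) :
    HasSum (fun j => genPart β η a j f m n) (∑ s', ∑ s, etaHat η (freq β s s') *
      ∑ l ∈ Λ, ∑' l', corr (a s) (a s') l l' *
        deltaStar β (ladder s' l') (delta (ladder s l) f) m n) := by
  simp only [genPart, Finset.sum_apply, Pi.smul_apply, smul_eq_mul]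
  exact hasSum_sum fun s' _ => hasSum_sum fun s _ =>
    (hasSum_deltaStar_delta_lin hf hfΛ β (ha s) (ha s') s s' m n).mul_left _

theorem hasSum_genSum {f : Op d} (hf : IsObs f) (β : ℝ) (η : ℂ → ℂ) {a : Bool → Site d → ℂ}
    (ha : ∀ s, Summable fun l => ‖a s l‖) (m n : Cfg d) :
    HasSum (fun j => genPart β η a j f m n) (genSum β η a f m n) := by
  obtain ⟨Λ, hΛ⟩ := hf.exists_isLocal
  exact (hasSum_genPart hf hΛ β η ha m n).summable.hasSum

theorem summable_adjCoef {a : Bool → Site d → ℂ} (ha : ∀ s, Summable fun l => ‖a s l‖)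
    (s : Bool) : Summable fun l => ‖adjCoef a s l‖ :=
  (ha (!s)).congr fun l => by simp [adjCoef, conjFun]

theorem generator_eq {η : ℂ → ℂ} (hη : Admissible η) {f : Op d} (hf : IsObs f) (β : ℝ)
    {a : Bool → Site d → ℂ} (ha : ∀ s, Summable fun l => ‖a s l‖) :
    generator β η (fields a) f = -(genSum β η a f + genSum β η (adjCoef a) f) := by
  funext m n
  simp only [generator, Pi.neg_apply, Pi.add_apply, genSum, (integral_genIntegrand hη hf β a _ m n).2]
  rw [((hasSum_genSum hf β η ha m n).summable).tsum_add
    (hasSum_genSum hf β η (summable_adjCoef ha) m n).summable]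

theorem generatorConverges_fields {η : ℂ → ℂ} (hη : Admissible η) {f : Op d} (hf : IsObs f)
    (β : ℝ) {a : Bool → Site d → ℂ} (ha : ∀ s, Summable fun l => ‖a s l‖) :
    GeneratorConverges β η (fields a) f := by
  refine fun m n => ⟨fun j => (integral_genIntegrand hη hf β a j m n).1, ?_⟩
  simp only [(integral_genIntegrand hη hf β a _ m n).2]
  exact (hasSum_genSum hf β η ha m n).summable.add
    (hasSum_genSum hf β η (summable_adjCoef ha) m n).summable

theorem genPart_add {f g : Op d} (hf : IsObs f) (hg : IsObs g) (β : ℝ) (η : ℂ → ℂ)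
    (a : Bool → Site d → ℂ) (j : Site d) :
    genPart β η a j (f + g) = genPart β η a j f + genPart β η a j g := by
  simp only [genPart, ← Finset.sum_add_distrib]
  refine Finset.sum_congr rfl fun s' _ => Finset.sum_congr rfl fun s _ => ?_
  rw [hf.locFin.delta_add hg.locFin,
    (locFin_delta_lin hf _ _).deltaStar_add (locFin_delta_lin hg _ _), smul_add]

theorem genPart_smul (c : ℂ) (f : Op d) (β : ℝ) (η : ℂ → ℂ)
    (a : Bool → Site d → ℂ) (j : Site d) :
    genPart β η a j (c • f) = c • genPart β η a j f := by
  simp only [genPart, Finset.smul_sum]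
  refine Finset.sum_congr rfl fun s' _ => Finset.sum_congr rfl fun s _ => ?_
  rw [delta_smul_right, deltaStar_smul, smul_comm]

theorem genPart_one (β : ℝ) (η : ℂ → ℂ) (a : Bool → Site d → ℂ) (j : Site d) :
    genPart β η a j one = 0 := by
  simp [genPart, delta_one, deltaStar_zero]

theorem adj_sum {ι : Type*} (S : Finset ι) (f : ι → Op d) :
    adj (∑ i ∈ S, f i) = ∑ i ∈ S, adj (f i) := by
  funext m n
  simp [adj, Finset.sum_apply]

theorem adj_twist (V V' g : Op d) : adj (twist V V' g) = twist (adj V') (adj V) (adj g) := by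
  rw [twist, adj_smul, adj_sub, adj_mul, adj_mul, twist, Complex.conj_I, neg_smul, ← smul_neg,
    neg_sub]

theorem adj_deltaStar (β : ℝ) (X g : Op d) :
    adj (deltaStar β X g) = deltaStar β (adj X) (adj g) := by
  rw [deltaStar_eq_twist, adj_twist, adj_modular, adj_modular, deltaStar_eq_twist]
  congr 2
  · simp [Complex.conj_ofNat, neg_div]
  · simp [Complex.conj_ofNat, neg_div]

theorem conj_etaHat {η : ℂ → ℂ} (hη : Admissible η) (w : ℝ) :
    (starRingEnd ℂ) (etaHat η w) = etaHat η (-w) := by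
  rw [etaHat, ← integral_conj, etaHat]
  refine integral_congr_ae (.of_forall fun t => ?_)
  beta_reduce
  rw [map_mul, hη.conj, ← Complex.exp_conj]
  congr 2
  simp

theorem adj_genPart {η : ℂ → ℂ} (hη : Admissible η) (f : Op d) (β : ℝ)
    (a : Bool → Site d → ℂ) (j : Site d) :
    adj (genPart β η a j f) = genPart β η (adjCoef a) j (adj f) := by
  simp only [genPart, adj_sum]
  -- The adjoint exchanges annihilation and creation parts. This reverses the frequencies, in
  -- agreement with `conj η̂(w) = η̂(-w)`.
  rw [← Equiv.sum_comp Equiv.boolNot]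
  refine Finset.sum_congr rfl fun s' _ => ?_
  rw [← Equiv.sum_comp Equiv.boolNot]
  refine Finset.sum_congr rfl fun s _ => ?_
  simp only [Equiv.boolNot_apply]
  rw [adj_smul, conj_etaHat hη, adj_deltaStar, adj_delta, adj_lin, adj_lin, Bool.not_not,
    Bool.not_not]
  congr 2
  simp only [freq, sgn_not]
  ring

theorem adj_genSum {η : ℂ → ℂ} (hη : Admissible η) (f : Op d) (β : ℝ)
    (a : Bool → Site d → ℂ) :
    adj (genSum β η a f) = genSum β η (adjCoef a) (adj f) := by
  funext m n
  simp only [genSum, adj, Complex.conj_tsum]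
  refine tsum_congr fun j => ?_
  rw [show (starRingEnd ℂ) (genPart β η a j f n m) = adj (genPart β η a j f) m n from rfl,
    adj_genPart hη]

variable {β : ℝ} [hβ : Fact (0 < β)]

/-- The generator maps observables to `L²(ω₀)`, and gives back the form. -/
theorem genSum_inL2 {η : ℂ → ℂ} (hη : Admissible η) {f : Op d} (hf : IsObs f)
    {a : Bool → Site d → ℂ} (ha : ∀ s, Summable fun l => ‖a s l‖) :
    InL2 β (genSum β η a f) ∧
      ∀ g, IsObs g → scal β g (genSum β η a f) = form β η (fields a) g f := by
  have key : ∀ Λ, IsLocal Λ f → genSum β η a f = ∑ s', ∑ s, etaHat η (freq β s s') •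
      ∑ l ∈ Λ, fun m n => ∑' l', corr (a s) (a s') l l' *
        deltaStar β (ladder s' l') (delta (ladder s l) f) m n := by
    intro Λ hΛ
    funext m n
    rw [genSum, (hasSum_genPart hf hΛ β η ha m n).tsum_eq]
    simp only [Finset.sum_apply, Pi.smul_apply, smul_eq_mul]
  have hD : ∀ s l, IsObs (delta (ladder s l) f) := fun s l => (isObs_ladder s l).delta hf
  have hK : ∀ s s' l, Rep β (fun m n => ∑' l', corr (a s) (a s') l l' *
      deltaStar β (ladder s' l') (delta (ladder s l) f) m n) _ := fun s s' l =>
    (rep_tsum_deltaStar (hD s l) s' (summable_norm_corr (ha s) (ha s') l)).2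
  have hK' := fun s s' l => (⟨_, hK s s' l⟩ : InL2 β _)
  refine ⟨?_, fun g hg => ?_⟩
  · obtain ⟨Λ, hΛ⟩ := hf.exists_isLocal
    rw [key Λ hΛ]
    exact inL2_sum _ fun s' _ => inL2_sum _ fun s _ => (inL2_sum _ fun l _ => hK' s s' l).smul _
  · obtain ⟨Λ, hfΛ, hgΛ, -⟩ := exists_isLocal₂ hf hg 0
    rw [key Λ hfΛ, form_eq_corr hη hf hg hfΛ hgΛ ha, scal,
      cls_sum _ fun s' _ => inL2_sum _ fun s _ => (inL2_sum _ fun l _ => hK' s s' l).smul _,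
      inner_sum]
    refine Finset.sum_congr rfl fun s' _ => ?_
    rw [cls_sum _ fun s _ => (inL2_sum _ fun l _ => hK' s s' l).smul _, inner_sum]
    refine Finset.sum_congr rfl fun s _ => ?_
    rw [(inL2_sum _ fun l _ => hK' s s' l).cls_smul, cls_sum _ fun l _ => hK' s s' l,
      inner_smul_right, inner_sum, Finset.sum_comm]
    congr 1
    refine Finset.sum_congr rfl fun l _ => ?_
    have hs := (rep_tsum_deltaStar (β := β) (hD s l) s' (summable_norm_corr (ha s) (ha s') l)).1
    -- The series over `l'` converges in `L²(ω₀)`, since the correlations are summable and the norms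
    -- of the `δ^⋆` terms bounded; the scalar product with `g` may thus be taken term by term.
    rw [(hK s s' l).cls_eq]
    have h1 := (innerSL ℂ (cls β g)).map_tsum hs
    simp only [innerSL_apply_apply] at h1
    rw [h1]
    have h2 : ∀ l', inner ℂ (cls β g) (corr (a s) (a s') l l' •
        cls β (deltaStar β (ladder s' l') (delta (ladder s l) f))) =
        corr (a s) (a s') l l' * scal β (delta (ladder s' l') g) (delta (ladder s l) f) :=
      fun l' => by
        rw [inner_smul_right, scal_delta_ladder hg (hD s l), scal]
    simp_rw [h2]
    -- After moving `δ^⋆` onto `g` as `δ`, locality of `g` leaves only the sites of `Λ`, as in the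
    -- form.
    refine tsum_eq_sum fun l' hl' => ?_
    rw [hgΛ.delta_ladder s' hl', scal, cls_zero, inner_zero_left, mul_zero]

end
end YFields
-- Contour shift for `η̂` and dissipativity of the generator.
namespace YFields
noncomputable section
variable {d : ℕ}

/-! ### Shifting the contour of integration -/

/-- Cauchy's theorem on the rectangle with vertices `±T` and `±T + is`; the uniform decay of `η` in
the strip removes the vertical sides as `T → ∞`. -/
theorem Admissible.etaHat_eq_shift {η : ℂ → ℂ} (hη : Admissible η) {s : ℝ} (hs : |s| ≤ 1 / 4)
    (w : ℝ) : etaHat η w =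
      Complex.exp (-(w * s)) * ∫ t : ℝ, η (t + s * Complex.I) * Complex.exp (Complex.I * w * t) := by
  set F : ℂ → ℂ := fun z => η z * Complex.exp (Complex.I * w * z) with hF
  have hF' : ∀ t y : ℝ, F (t + y * Complex.I) = Complex.exp (-(w * y)) *
      (η (t + y * Complex.I) * Complex.exp (Complex.I * w * t)) := fun t y => by
    have : Complex.exp (Complex.I * w * (t + y * Complex.I)) =
        Complex.exp (-(w * y)) * Complex.exp (Complex.I * w * t) := by
      rw [← Complex.exp_add]
      congr 1
      linear_combination (w * y : ℂ) * Complex.I_mul_I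
    rw [hF]
    beta_reduce
    rw [this]
    ring
  have hint : ∀ y : ℝ, |y| ≤ 1 / 4 → Integrable fun t : ℝ => F (t + y * Complex.I) := fun y hy => by
    simp_rw [hF']
    exact (hη.integrable_mul_exp hy w).const_mul _
  have hlim : ∀ y : ℝ, |y| ≤ 1 / 4 → Tendsto (fun T : ℝ => ∫ t in (-T)..T, F (t + y * Complex.I))
      atTop (𝓝 (∫ t : ℝ, F (t + y * Complex.I))) := fun y hy =>
    intervalIntegral_tendsto_integral (hint y hy) tendsto_neg_atTop_atBot tendsto_id
  obtain ⟨M, p, hM, hp, hdec⟩ := hη.decay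
  have hmem : ∀ y ∈ Set.uIcc 0 s, |y| ≤ 1 / 4 := fun y hy => by
    have := Set.abs_sub_left_of_mem_uIcc hy
    simp only [sub_zero] at this
    exact this.trans hs
  have hvert : ∀ u : ℝ → ℝ, (∀ T, |u T| = |T|) → Tendsto (fun T : ℝ =>
      ∫ y in (0 : ℝ)..s, F (u T + y * Complex.I)) atTop (𝓝 0) := by
    intro u hu
    have hb : ∀ T : ℝ, ‖∫ y in (0 : ℝ)..s, F (u T + y * Complex.I)‖ ≤
        Real.exp (|w|) * (M * (1 + |T|) ^ (-p)) * |s - 0| := fun T => by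
      refine intervalIntegral.norm_integral_le_of_norm_le_const fun y hy => ?_
      have hy' := hmem y (Set.uIoc_subset_uIcc hy)
      rw [hF', norm_mul, norm_mul,
        show Complex.I * w * (u T) = ((w * u T : ℝ) : ℂ) * Complex.I by push_cast; ring,
        Complex.norm_exp_ofReal_mul_I, mul_one, Complex.norm_exp]
      refine mul_le_mul (Real.exp_le_exp.2 ?_) ?_ (norm_nonneg _) (Real.exp_pos _).le
      · have h1 : (-((w : ℂ) * y)).re = -(w * y) := by simp
        rw [h1]
        have h2 := neg_abs_le (w * y)
        rw [abs_mul] at h2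
        nlinarith [abs_nonneg w, abs_nonneg y]
      · rw [← hu T]
        exact hdec _ _ hy'
    refine squeeze_zero_norm hb ?_
    have h1 : Tendsto (fun T : ℝ => 1 + |T|) atTop atTop :=
      tendsto_atTop_add_const_left _ _ tendsto_abs_atTop_atTop
    have h2 := (tendsto_rpow_neg_atTop (zero_lt_one.trans hp)).comp h1
    have h3 := ((h2.const_mul M).const_mul (Real.exp |w|)).mul_const (|s - 0|)
    simpa using h3
  have hrect : ∀ T : ℝ, (∫ t in (-T)..T, F (t + (0 : ℝ) * Complex.I)) =
      (∫ t in (-T)..T, F (t + s * Complex.I)) -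
        Complex.I * (∫ y in (0 : ℝ)..s, F (T + y * Complex.I)) +
        Complex.I * ∫ y in (0 : ℝ)..s, F ((-T : ℝ) + y * Complex.I) := fun T => by
    have h := Complex.integral_boundary_rect_eq_zero_of_differentiableOn F
      ((-T : ℝ) + (0 : ℝ) * Complex.I) ((T : ℝ) + s * Complex.I) ?_
    · simp only [Complex.add_re, Complex.ofReal_re, Complex.mul_re, Complex.I_re, mul_zero,
        Complex.ofReal_im, Complex.I_im, mul_one, sub_self, add_zero, Complex.add_im,
        Complex.mul_im, zero_add, smul_eq_mul] at h
      linear_combination h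
    · intro z hz
      simp only [Complex.add_im, Complex.ofReal_im, Complex.mul_im, Complex.ofReal_re,
        Complex.I_im, mul_one, Complex.I_re, mul_zero, add_zero, zero_add] at hz
      have hz' : |z.im| ≤ 1 / 4 := hmem _ hz.2
      have h1 : DifferentiableAt ℂ η z := (hη.analytic z hz').differentiableAt
      exact (h1.mul (by fun_prop)).differentiableWithinAt
  have h0 := hlim 0 (by norm_num)
  have h1 := ((hlim s hs).sub ((hvert (fun T => T) fun _ => rfl).const_mul Complex.I)).add
    ((hvert (fun T => -T) fun T => abs_neg T).const_mul Complex.I)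
  have h2 := tendsto_nhds_unique h0 (h1.congr fun T => (hrect T).symm)
  rw [mul_zero, sub_zero, add_zero] at h2
  rw [etaHat, ← integral_const_mul]
  simp_rw [← hF', ← h2]
  simp [hF]

theorem Admissible.etaHat_zero {η : ℂ → ℂ} (hη : Admissible η) :
    etaHat η 0 = ((etaHat η 0).re : ℂ) := by
  have h := conj_etaHat hη 0
  rw [neg_zero] at h
  exact (Complex.conj_eq_iff_re.1 h).symm

/-- The inequality for the Fourier transform which makes the generator dissipative. -/
theorem Admissible.norm_etaHat_le {η : ℂ → ℂ} (hη : Admissible η) (b : ℝ) :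
    ‖etaHat η (2 * b) * (Real.exp (b / 2) + Real.exp (-(b / 2)) : ℝ)‖ ≤
      2 * (etaHat η 0).re := by
  have hq : |(1 / 4 : ℝ)| ≤ 1 / 4 := by norm_num [abs_of_pos]
  have hq' : |(-(1 / 4) : ℝ)| ≤ 1 / 4 := by norm_num [abs_of_pos]
  set u : ℝ → ℂ := fun t => η (t + (1 / 4 : ℝ) * Complex.I) + η (t + (-(1 / 4) : ℝ) * Complex.I)
    with hu
  have hu' : ∀ t : ℝ, (u t).im = 0 ∧ 0 ≤ (u t).re := fun t => by
    have h := hη.nonneg_shift t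
    rw [show (t : ℂ) + Complex.I / 4 = t + (1 / 4 : ℝ) * Complex.I by push_cast; ring,
      show (t : ℂ) - Complex.I / 4 = t + (-(1 / 4) : ℝ) * Complex.I by push_cast; ring] at h
    exact h
  have hu1 : Integrable u := (hη.integrable hq).add (hη.integrable hq')
  -- The shifts by `±1/4` contribute `e^{±w/4}`, so the transform of `u` is `2 cosh (w/4) η̂(w)`. As
  -- `u ≥ 0`, its modulus is bounded by the value at `w = 0`; the bound is used at `w = 2b`.
  have hsum : ∀ w : ℝ, (∫ t : ℝ, u t * Complex.exp (Complex.I * w * t)) =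
      etaHat η w * (Real.exp (w / 4) + Real.exp (-(w / 4)) : ℝ) := fun w => by
    simp_rw [hu, _root_.add_mul]
    rw [integral_add (hη.integrable_mul_exp hq w) (hη.integrable_mul_exp hq' w), Complex.ofReal_add,
      _root_.mul_add]
    congr 1
    · rw [hη.etaHat_eq_shift hq w, mul_right_comm, Complex.ofReal_exp, ← Complex.exp_add]
      push_cast
      rw [show -((w : ℂ) * (1 / 4)) + w / 4 = 0 by ring, Complex.exp_zero, one_mul]
    · rw [hη.etaHat_eq_shift hq' w, mul_right_comm, Complex.ofReal_exp, ← Complex.exp_add]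
      push_cast
      rw [show -((w : ℂ) * -(1 / 4)) + -(w / 4) = 0 by ring, Complex.exp_zero, one_mul]
  have h0 := hsum 0
  have h2 := hsum (2 * b)
  rw [show 2 * b / 4 = b / 2 by ring] at h2
  rw [← h2]
  refine (norm_integral_le_integral_norm _).trans_eq ?_
  have hn : ∀ t : ℝ, ‖u t * Complex.exp (Complex.I * (2 * b : ℝ) * t)‖ = (u t).re := fun t => by
    rw [norm_mul, show Complex.I * (2 * b : ℝ) * t = ((2 * b * t : ℝ) : ℂ) * Complex.I by
      push_cast; ring, Complex.norm_exp_ofReal_mul_I, mul_one]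
    have : u t = ((u t).re : ℂ) := Complex.ext rfl (hu' t).1
    rw [this, Complex.norm_real, Complex.ofReal_re, Real.norm_of_nonneg (hu' t).2]
  simp_rw [hn]
  have h3 : ∫ t, (u t).re = (∫ t, u t).re := integral_re (𝕜 := ℂ) hu1
  simp only [Complex.ofReal_zero, mul_zero, zero_mul, Complex.exp_zero, mul_one, zero_div, neg_zero,
    Real.exp_zero] at h0
  rw [h3, h0, Complex.re_mul_ofReal]
  ring

/-! ### Non-negative operators -/

/-- The quadratic form of an operator on finite linear combinations of the `e_m`. -/
def quad (v : Cfg d →₀ ℂ) (X : Op d) : ℂ :=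
  ∑ m ∈ v.support, ∑ n ∈ v.support, (starRingEnd ℂ) (v m) * X m n * v n

theorem nonnegOp_iff {X : Op d} : NonnegOp X ↔ ∀ v, (quad v X).im = 0 ∧ 0 ≤ (quad v X).re :=
  Iff.rfl

/-- Test vectors are finite combinations of the `e_m`, so the quadratic form is a finite sum of
entries and passes to entrywise limits. -/
theorem nonnegOp_of_hasSum {ι : Type*} {X : ι → Op d} {Y : Op d}
    (h : ∀ m n, HasSum (fun j => X j m n) (Y m n)) (hX : ∀ j, NonnegOp (X j)) : NonnegOp Y := by
  rw [nonnegOp_iff]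
  intro v
  have h1 : HasSum (fun j => quad v (X j)) (quad v Y) :=
    hasSum_sum fun m _ => hasSum_sum fun n _ => ((h m n).mul_left _).mul_right _
  have h2 := fun j => nonnegOp_iff.1 (hX j) v
  refine ⟨?_, (Complex.hasSum_re h1).nonneg fun j => (h2 j).2⟩
  have h3 := Complex.hasSum_im h1
  simp only [(h2 _).1] at h3
  exact h3.unique hasSum_zero

theorem NonnegOp.add {X Y : Op d} (hX : NonnegOp X) (hY : NonnegOp Y) : NonnegOp (X + Y) := by
  rw [nonnegOp_iff] at *
  intro v
  have h : quad v (X + Y) = quad v X + quad v Y := by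
    simp only [quad, Pi.add_apply, _root_.mul_add, _root_.add_mul, Finset.sum_add_distrib]
  rw [h, Complex.add_im, Complex.add_re]
  exact ⟨by rw [(hX v).1, (hY v).1, add_zero], add_nonneg (hX v).2 (hY v).2⟩

/-- The components of `X v`. -/
def applyVec (X : Op d) (v : Cfg d →₀ ℂ) (p : Cfg d) : ℂ := ∑ n ∈ v.support, X p n * v n

/-- This is `⟨v, X^* Y v⟩ = ⟨X v, Y v⟩` in coordinates. It reduces positivity of operators to
positivity for each pair of complex numbers `(X v)_p`, `(Y v)_p`. -/
theorem hasSum_quad_adj_mul {Y : Op d} (hY : LocFin Y) (X : Op d)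
    (v : Cfg d →₀ ℂ) :
    HasSum (fun p => (starRingEnd ℂ) (applyVec X v p) * applyVec Y v p)
      (quad v (mul (adj X) Y)) := by
  have h : ∀ p, (starRingEnd ℂ) (applyVec X v p) * applyVec Y v p =
      ∑ m ∈ v.support, ∑ n ∈ v.support,
        (starRingEnd ℂ) (v m) * (adj X m p * Y p n) * v n := fun p => by
    simp only [applyVec, map_sum, map_mul, Finset.sum_mul_sum, adj]
    exact Finset.sum_congr rfl fun m _ => Finset.sum_congr rfl fun n _ => by ring
  simp_rw [h]
  exact hasSum_sum fun m _ => hasSum_sum fun n _ =>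
    ((hY.col.summable (adj X) m n).hasSum.mul_left _).mul_right _

/-- The off-diagonal terms are complex conjugates of each other, so the expression is real; they are
dominated by `p|x|² + q|y|² ≥ 2 √(pq) |x| |y|`. -/
theorem two_by_two_nonneg {p q : ℝ} {c : ℂ} (hp : 0 ≤ p) (hq : 0 ≤ q) (hc : ‖c‖ ^ 2 ≤ p * q)
    (x y : ℂ) :
    (p * ((starRingEnd ℂ) x * x) + q * ((starRingEnd ℂ) y * y) + c * ((starRingEnd ℂ) y * x) +
      (starRingEnd ℂ) c * ((starRingEnd ℂ) x * y)).im = 0 ∧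
    0 ≤ (p * ((starRingEnd ℂ) x * x) + q * ((starRingEnd ℂ) y * y) + c * ((starRingEnd ℂ) y * x) +
      (starRingEnd ℂ) c * ((starRingEnd ℂ) x * y)).re := by
  have h1 : (starRingEnd ℂ) c * ((starRingEnd ℂ) x * y) =
      (starRingEnd ℂ) (c * ((starRingEnd ℂ) y * x)) := by
    simp only [map_mul, Complex.conj_conj]
    ring
  rw [h1, Complex.conj_mul', Complex.conj_mul']
  set z := c * ((starRingEnd ℂ) y * x) with hz
  have hzn : ‖z‖ = ‖c‖ * (‖y‖ * ‖x‖) := by simp [hz]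
  have h2 : |z.re| ≤ ‖c‖ * (‖y‖ * ‖x‖) := hzn ▸ Complex.abs_re_le_norm z
  have h3 : 2 * (‖c‖ * (‖y‖ * ‖x‖)) ≤ p * ‖x‖ ^ 2 + q * ‖y‖ ^ 2 := by
    refine le_of_sq_le_sq ?_ (by positivity)
    have h4 := mul_le_mul_of_nonneg_right hc (sq_nonneg (‖y‖ * ‖x‖))
    nlinarith [sq_nonneg (p * ‖x‖ ^ 2 - q * ‖y‖ ^ 2)]
  have h5 := neg_abs_le z.re
  norm_cast
  simp only [Complex.add_im, Complex.add_re, Complex.conj_re, Complex.conj_im, Complex.ofReal_re,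
    Complex.ofReal_im]
  constructor
  · ring
  · linarith

theorem nonnegOp_two_by_two {X Y : Op d} (hX : LocFin X) (hY : LocFin Y) {p q : ℝ} {c : ℂ}
    (hp : 0 ≤ p) (hq : 0 ≤ q) (hc : ‖c‖ ^ 2 ≤ p * q) :
    NonnegOp ((p : ℂ) • mul (adj X) X + (q : ℂ) • mul (adj Y) Y + c • mul (adj Y) X +
      (starRingEnd ℂ) c • mul (adj X) Y) := by
  rw [nonnegOp_iff]
  intro v
  have hadd : ∀ A B : Op d, quad v (A + B) = quad v A + quad v B := fun A B => by
    simp only [quad, Pi.add_apply, _root_.mul_add, _root_.add_mul, Finset.sum_add_distrib]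
  have hsmul : ∀ (k : ℂ) (A : Op d), quad v (k • A) = k * quad v A := fun k A => by
    simp only [quad, Pi.smul_apply, smul_eq_mul, Finset.mul_sum]
    exact Finset.sum_congr rfl fun m _ => Finset.sum_congr rfl fun n _ => by ring
  simp only [hadd, hsmul]
  have h := ((((hasSum_quad_adj_mul hX X v).mul_left (p : ℂ)).add
    ((hasSum_quad_adj_mul hY Y v).mul_left (q : ℂ))).add
    ((hasSum_quad_adj_mul hX Y v).mul_left c)).add
    ((hasSum_quad_adj_mul hY X v).mul_left ((starRingEnd ℂ) c))
  have h2 := fun i => two_by_two_nonneg hp hq hc (applyVec X v i) (applyVec Y v i)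
  refine ⟨?_, (Complex.hasSum_re h).nonneg fun j => (h2 j).2⟩
  have h3 := Complex.hasSum_im h
  simp only [(h2 _).1] at h3
  exact h3.unique hasSum_zero

/-! ### Dissipativity -/

theorem RowFin.hasSum_mul {f : Op d} (hf : RowFin f) {ι : Type*} {X : ι → Op d} {Y : Op d}
    (h : ∀ m n, HasSum (fun j => X j m n) (Y m n)) (m n : Cfg d) :
    HasSum (fun j => YFields.mul f (X j) m n) (YFields.mul f Y m n) := by
  have h1 : ∀ Z : Op d, YFields.mul f Z m n = ∑ p ∈ (hf m).toFinset, f m p * Z p n := fun Z =>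
    tsum_eq_sum fun p hp => by
      rw [Set.Finite.mem_toFinset, Function.mem_support, not_not] at hp
      rw [hp, zero_mul]
  simp_rw [h1]
  exact hasSum_sum fun p _ => (h p n).mul_left _

theorem ColFin.hasSum_mul {f : Op d} (hf : ColFin f) {ι : Type*} {X : ι → Op d} {Y : Op d}
    (h : ∀ m n, HasSum (fun j => X j m n) (Y m n)) (m n : Cfg d) :
    HasSum (fun j => mul (X j) f m n) (mul Y f m n) := by
  have h1 : ∀ Z : Op d, mul Z f m n = ∑ p ∈ (hf n).toFinset, Z m p * f p n := fun Z =>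
    tsum_eq_sum fun p hp => by
      rw [Set.Finite.mem_toFinset, Function.mem_support, not_not] at hp
      rw [hp, mul_zero]
  simp_rw [h1]
  exact hasSum_sum fun p _ => (h m p).mul_right _

theorem mul_sum_op {ι : Type*} (S : Finset ι) {f : Op d} (hf : RowFin f) (X : ι → Op d) :
    mul f (∑ i ∈ S, X i) = ∑ i ∈ S, mul f (X i) := by
  classical
  induction S using Finset.induction_on with
  | empty => funext m n; simp [mul]
  | insert a S ha ih => rw [Finset.sum_insert ha, Finset.sum_insert ha, hf.mul_add, ih]

theorem sum_mul_op {ι : Type*} (S : Finset ι) {f : Op d} (hf : ColFin f) (X : ι → Op d) :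
    mul (∑ i ∈ S, X i) f = ∑ i ∈ S, mul (X i) f := by
  classical
  induction S using Finset.induction_on with
  | empty => funext m n; simp [mul]
  | insert a S ha ih => rw [Finset.sum_insert ha, Finset.sum_insert ha, hf.add_mul, ih]

theorem deltaStar_lin (β : ℝ) (s : Bool) (c : Site d → ℂ) (g : Op d) :
    deltaStar β (lin s c) g =
      twist ((Real.exp (-(β * sgn s / 2)) : ℂ) • adj (lin s c))
        ((Real.exp (β * sgn s / 2) : ℂ) • adj (lin s c)) g := by
  rw [deltaStar_eq_twist, adj_lin, modular_lin, modular_lin, sgn_not, Complex.ofReal_exp,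
    Complex.ofReal_exp]
  congr 3
  · push_cast
    linear_combination (β * sgn s / 2 : ℂ) * Complex.I_mul_I
  · push_cast
    linear_combination (-(β * sgn s : ℂ) / 2) * Complex.I_mul_I

/-- The Leibniz defect of `δ_{X'}^⋆ δ_X` for linear fields `X`, `X'`. -/
theorem deltaStar_delta_leibniz {f : Op d} (hf : IsObs f) (β : ℝ) (s s' : Bool)
    (c c' : Site d → ℂ) :
    deltaStar β (lin s' c') (delta (lin s c) (mul (adj f) f)) -
      mul (adj f) (deltaStar β (lin s' c') (delta (lin s c) f)) -
      mul (deltaStar β (lin s' c') (delta (lin s c) (adj f))) f =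
    -((Real.exp (-(β * sgn s' / 2)) : ℂ) •
        mul (adj (delta (adj (lin s c)) f)) (delta (adj (lin s' c')) f) +
      (Real.exp (β * sgn s' / 2) : ℂ) •
        mul (adj (delta (lin s' c') f)) (delta (lin s c) f)) := by
  simp only [deltaStar_lin]
  rw [twist_delta_mul hf.adj.locFin hf.locFin _ _ (locFin_delta_lin hf.adj _ _)
    (locFin_delta_lin hf _ _), delta_smul_left, delta_smul_left, adj_delta, adj_delta, adj_adj,
    mul_smul_op, smul_mul_op]

theorem genPart_leibniz {f : Op d} (hf : IsObs f) (β : ℝ) (η : ℂ → ℂ)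
    (a : Bool → Site d → ℂ) (j : Site d) :
    genPart β η a j (mul (adj f) f) - mul (adj f) (genPart β η a j f) -
      mul (genPart β η a j (adj f)) f =
    -∑ s', ∑ s, etaHat η (freq β s s') • ((Real.exp (-(β * sgn s' / 2)) : ℂ) •
        mul (adj (delta (adj (lin s (shift j (a s)))) f))
          (delta (adj (lin s' (shift j (a s')))) f) +
      (Real.exp (β * sgn s' / 2) : ℂ) •
        mul (adj (delta (lin s' (shift j (a s'))) f)) (delta (lin s (shift j (a s))) f)) := by
  simp only [genPart]
  rw [mul_sum_op _ hf.adj.locFin.row, sum_mul_op _ hf.locFin.col, ← Finset.sum_sub_distrib,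
    ← Finset.sum_sub_distrib, ← Finset.sum_neg_distrib]
  refine Finset.sum_congr rfl fun s' _ => ?_
  rw [mul_sum_op _ hf.adj.locFin.row, sum_mul_op _ hf.locFin.col, ← Finset.sum_sub_distrib,
    ← Finset.sum_sub_distrib, ← Finset.sum_neg_distrib]
  refine Finset.sum_congr rfl fun s _ => ?_
  rw [mul_smul_op, smul_mul_op, ← smul_sub, ← smul_sub, deltaStar_delta_leibniz hf, smul_neg]

theorem adj_lin_adjCoef (a : Bool → Site d → ℂ) (s : Bool) (j : Site d) :
    lin s (shift j (adjCoef a s)) = adj (lin (!s) (shift j (a (!s)))) := by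
  rw [adj_lin, Bool.not_not]
  rfl

/-- The mixed terms from one direction alone carry unequal factors `e^{±β/2}` and need not be
Hermitian. Adding the adjoint direction interchanges these factors, so both mixed coefficients
acquire `e^{β/2} + e^{-β/2}`. -/
theorem nonneg_genPart_leibniz {η : ℂ → ℂ} (hη : Admissible η) {f : Op d} (hf : IsObs f)
    (β : ℝ) (a : Bool → Site d → ℂ) (j : Site d) :
    NonnegOp (-(genPart β η a j (mul (adj f) f) - mul (adj f) (genPart β η a j f) -
      mul (genPart β η a j (adj f)) f) -
      (genPart β η (adjCoef a) j (mul (adj f) f) - mul (adj f) (genPart β η (adjCoef a) j f) -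
      mul (genPart β η (adjCoef a) j (adj f)) f)) := by
  rw [genPart_leibniz hf, genPart_leibniz hf, neg_neg, sub_neg_eq_add]
  simp only [adj_lin_adjCoef, adj_adj]
  have hg : ∀ s, LocFin (delta (lin s (shift j (a s))) f) := fun s => locFin_delta_lin hf _ _
  have hk : ∀ s, LocFin (delta (adj (lin s (shift j (a s)))) f) := fun s => by
    rw [adj_lin]
    exact locFin_delta_lin hf _ _
  set g := fun s => delta (lin s (shift j (a s))) f with hgdef
  set k := fun s => delta (adj (lin s (shift j (a s)))) f with hkdef
  have hg' : ∀ s, delta (lin s (shift j (a s))) f = g s := fun s => rfl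
  have hk' : ∀ s, delta (adj (lin s (shift j (a s)))) f = k s := fun s => rfl
  simp only [hg', hk'] at hg hk ⊢
  set e := Real.exp (β / 2) with he
  set e' := Real.exp (-(β / 2)) with he'
  have hee : e * e' = 1 := by rw [he, he', ← Real.exp_add, add_neg_cancel, Real.exp_zero]
  set r := (etaHat η 0).re with hr
  have hr0 : etaHat η 0 = (r : ℂ) := hη.etaHat_zero
  have hn := hη.norm_etaHat_le β
  rw [← he, ← he', ← hr] at hn
  have hr1 : 0 ≤ r := by
    have := (norm_nonneg _).trans hn
    linarith
  set c := etaHat η (2 * β) * (e + e' : ℝ) with hc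
  have hc2 : etaHat η (-(2 * β)) * (e + e' : ℝ) = (starRingEnd ℂ) c := by
    rw [hc, map_mul, conj_etaHat hη, Complex.conj_ofReal]
  -- The diagonal weights `2r e^{β/2}` and `2r e^{-β/2}` have product `(2r)²`, so the determinant
  -- condition is the square of the bound on `η̂(2β)`.
  have hcn : ‖c‖ ^ 2 ≤ (2 * r * e) * (2 * r * e') := by
    have := pow_le_pow_left₀ (norm_nonneg _) hn 2
    calc ‖c‖ ^ 2 ≤ (2 * r) ^ 2 := this
      _ = (2 * r) ^ 2 * (e * e') := by rw [hee, mul_one]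
      _ = _ := by ring
  have hp : 0 ≤ 2 * r * e := by positivity
  have hq : 0 ≤ 2 * r * e' := by positivity
  have h1 := nonnegOp_two_by_two (hg true) (hg false) hp hq hcn
  -- For the derivatives along the adjoint parts, the creation index comes first: the adjoint of a
  -- creation part is an annihilation part, so it carries the weight `e^{β/2}`.
  have h2 := nonnegOp_two_by_two (hk false) (hk true) hp hq (c := c) hcn
  refine cast (congrArg NonnegOp ?_) (h1.add h2)
  have f1 : freq β true true = 0 := by simp [freq]
  have f2 : freq β false false = 0 := by simp [freq]
  have f3 : freq β true false = 2 * β := by simp [freq, sgn]; ring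
  have f4 : freq β false true = -(2 * β) := by simp [freq, sgn]; ring
  have e1 : β * sgn true / 2 = β / 2 := by simp [sgn]
  have e2 : β * sgn false / 2 = -(β / 2) := by simp [sgn]; ring
  simp only [Fintype.sum_bool, f1, f2, f3, f4, e1, e2, neg_neg, ← he, ← he', Bool.not_true,
    Bool.not_false]
  rw [← hc2, hc, hr0]
  funext m n
  simp only [Pi.add_apply, Pi.smul_apply, smul_eq_mul]
  push_cast
  ring

theorem hasSum_genSum_leibniz {f : Op d} (hf : IsObs f) (β : ℝ) (η : ℂ → ℂ)
    {a : Bool → Site d → ℂ} (ha : ∀ s, Summable fun l => ‖a s l‖) (m n : Cfg d) :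
    HasSum (fun j => (genPart β η a j (mul (adj f) f) - mul (adj f) (genPart β η a j f) -
      mul (genPart β η a j (adj f)) f) m n)
    ((genSum β η a (mul (adj f) f) - mul (adj f) (genSum β η a f) -
      mul (genSum β η a (adj f)) f) m n) :=
  ((hasSum_genSum (.mul _ _ hf.adj hf) β η ha m n).sub
    (hf.adj.locFin.row.hasSum_mul (hasSum_genSum hf β η ha) m n)).sub
    (hf.locFin.col.hasSum_mul (hasSum_genSum hf.adj β η ha) m n)

theorem nonneg_carreDuChamp {η : ℂ → ℂ} (hη : Admissible η) {f : Op d} (hf : IsObs f)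
    (β : ℝ) {a : Bool → Site d → ℂ} (ha : ∀ s, Summable fun l => ‖a s l‖) :
    NonnegOp (carreDuChamp (generator β η (fields a)) f) := by
  refine nonnegOp_of_hasSum (fun m n => ?_) (nonneg_genPart_leibniz hη hf β a)
  have h := (hasSum_genSum_leibniz hf β η ha m n).neg.sub
    (hasSum_genSum_leibniz hf β η (summable_adjCoef ha) m n)
  refine cast (congrArg (HasSum _) ?_) h
  rw [carreDuChamp, generator_eq hη hf β ha, generator_eq hη hf.adj β ha,
    generator_eq hη (.mul _ _ hf.adj hf) β ha, mul_neg_op, neg_mul_op, hf.adj.locFin.row.mul_add,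
    hf.locFin.col.add_mul]
  simp only [Pi.add_apply, Pi.sub_apply, Pi.neg_apply]
  ring

end
end YFields
-- Polynomial approximation of matrix units.
namespace YFields
noncomputable section
variable {d : ℕ}

/-! ### Polynomial approximation of point masses on the integers -/

/-- The Taylor polynomials of `sin (π x) / (π x)`. -/
def sincSum (K : ℕ) (x : ℝ) : ℝ :=
  ∑ k ∈ Finset.range K, (-1) ^ k * (Real.pi * x) ^ (2 * k) / (2 * k + 1).factorial

/-- Termwise comparison with the series of `cosh (π|x|)`, using `(2k)! ≤ (2k+1)!`. The bound is
uniform in the degree, as dominated convergence requires. -/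
theorem abs_sincSum_le (K : ℕ) (x : ℝ) : |sincSum K x| ≤ Real.exp (Real.pi * |x|) := by
  have h1 := Real.hasSum_cosh (Real.pi * |x|)
  have h2 : |sincSum K x| ≤
      ∑ k ∈ Finset.range K, (Real.pi * |x|) ^ (2 * k) / (2 * k).factorial := by
    refine (Finset.abs_sum_le_sum_abs _ _).trans (Finset.sum_le_sum fun k _ => ?_)
    rw [abs_div, abs_mul, abs_pow, abs_neg, abs_one, one_pow, one_mul, abs_pow, abs_mul,
      abs_of_pos Real.pi_pos, Nat.abs_cast]
    gcongr
    omega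
  refine h2.trans ((sum_le_hasSum _ (fun k _ => by positivity) h1).trans ?_)
  rw [Real.cosh_eq]
  have : Real.exp (-(Real.pi * |x|)) ≤ Real.exp (Real.pi * |x|) :=
    Real.exp_le_exp.2 (neg_le_self (by positivity))
  linarith

theorem tendsto_sincSum (x : ℤ) :
    Tendsto (fun K => sincSum K x) atTop (𝓝 (if x = 0 then 1 else 0)) := by
  split_ifs with hx
  · subst hx
    refine tendsto_const_nhds.congr' ((eventually_ge_atTop 1).mono fun K hK => ?_)
    beta_reduce
    rw [sincSum, Finset.sum_eq_single_of_mem 0 (Finset.mem_range.2 hK)]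
    · simp
    · intro k _ hk
      simp [hk]
  · have hx' : Real.pi * x ≠ 0 := mul_ne_zero Real.pi_ne_zero (Int.cast_ne_zero.2 hx)
    have h := ((Real.hasSum_sin (Real.pi * x)).mul_right (Real.pi * x)⁻¹).tendsto_sum_nat
    rw [mul_comm Real.pi (x : ℝ), Real.sin_int_mul_pi, zero_mul, mul_comm (x : ℝ)] at h
    refine h.congr fun K => ?_
    rw [sincSum]
    refine Finset.sum_congr rfl fun k _ => ?_
    rw [pow_succ]
    field_simp

theorem exists_exp_bound {ε δ : ℝ} (hε : 0 < ε) (hδ : 0 < δ) (x₀ : ℕ) :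
    ∃ C : ℝ, 0 ≤ C ∧ ∀ (K x : ℕ),
      |sincSum K ((x : ℝ) - x₀)| * Real.exp (-(ε * ((x : ℝ) * (x : ℝ) ^ δ))) ≤ C := by
  -- `R` is the point where `ε x^δ = π`. Beyond it the damping beats the growth `e^{πx}`, below it
  -- `πx ≤ πR`; the existence of such a point uses `δ > 0`.
  set R := (Real.pi / ε) ^ (1 / δ) with hR
  have hR0 : 0 ≤ R := by positivity
  refine ⟨Real.exp (Real.pi * (x₀ + R)), (Real.exp_pos _).le, fun K x => ?_⟩
  refine (mul_le_mul_of_nonneg_right (abs_sincSum_le K _) (Real.exp_pos _).le).trans ?_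
  rw [← Real.exp_add]
  refine Real.exp_le_exp.2 ?_
  have hx : (0 : ℝ) ≤ x := Nat.cast_nonneg x
  have h1 : |(x : ℝ) - x₀| ≤ x + x₀ := by
    rw [abs_le]
    constructor <;> linarith [(Nat.cast_nonneg x₀ : (0 : ℝ) ≤ x₀)]
  have h2 : Real.pi * x - ε * (x * (x : ℝ) ^ δ) ≤ Real.pi * R := by
    by_cases hxR : (x : ℝ) ≤ R
    · have : 0 ≤ ε * (x * (x : ℝ) ^ δ) := by positivity
      nlinarith [Real.pi_pos]
    · have h3 : Real.pi / ε ≤ (x : ℝ) ^ δ := by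
        have := Real.rpow_le_rpow hR0 (not_le.1 hxR).le hδ.le
        rwa [hR, ← Real.rpow_mul (by positivity), one_div, inv_mul_cancel₀ hδ.ne',
          Real.rpow_one] at this
      rw [div_le_iff₀ hε] at h3
      have h4 : 0 ≤ Real.pi * R := by positivity
      nlinarith
  nlinarith [Real.pi_pos]

/-! ### Diagonal polynomials -/

/-- The diagonal operator with eigenvalues `φ n`. -/
def diag (φ : Cfg d → ℂ) : Op d := fun m n => if m = n then φ n else 0

theorem mul_diag_apply (f : Op d) (φ : Cfg d → ℂ) (m n : Cfg d) :
    mul f (diag φ) m n = f m n * φ n := by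
  rw [mul, tsum_eq_single n]
  · simp [diag]
  · intro p hp
    simp [diag, hp]

theorem diag_mul_diag (φ ψ : Cfg d → ℂ) :
    mul (diag φ) (diag ψ) = diag fun n => φ n * ψ n := by
  funext m n
  rw [mul_diag_apply]
  by_cases h : m = n
  · simp [diag, h]
  · simp [diag, h]

theorem number_eq_diag (j : Site d) : mul (adj (ann j)) (ann j) = diag fun n => (n j : ℂ) := by
  funext m n
  by_cases hm : m j = 0
  · rw [cre_mul_apply_of_eq_zero _ hm]
    by_cases h : m = n
    · subst h
      simp [diag, hm]
    · simp [diag, h]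
  · obtain ⟨m, rfl⟩ := exists_eq_add_single hm
    rw [cre_mul_apply]
    by_cases h : m + Finsupp.single j 1 = n
    · subst h
      simp only [if_true, ann, diag]
      norm_cast
      simp only [Finsupp.add_apply, Finsupp.single_eq_same]
      push_cast
      rw [Real.mul_self_sqrt (by positivity)]
    · simp [h, Ne.symm h, ann, diag]

theorem isPoly_const (Λ : Finset (Site d)) (c : ℂ) : IsPoly Λ (diag fun _ => c) := by
  have : (diag fun _ => c : Op d) = c • one := by
    funext m n
    simp [diag, one]
  rw [this]
  exact .smul _ _ .one

theorem isPoly_diag_mul {Λ : Finset (Site d)} {φ ψ : Cfg d → ℂ} (hφ : IsPoly Λ (diag φ))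
    (hψ : IsPoly Λ (diag ψ)) : IsPoly Λ (diag fun n => φ n * ψ n) := by
  rw [← diag_mul_diag]
  exact .mul _ _ hφ hψ

theorem isPoly_diag_add {Λ : Finset (Site d)} {φ ψ : Cfg d → ℂ} (hφ : IsPoly Λ (diag φ))
    (hψ : IsPoly Λ (diag ψ)) : IsPoly Λ (diag fun n => φ n + ψ n) := by
  have : (diag fun n => φ n + ψ n : Op d) = diag φ + diag ψ := by
    funext m n
    by_cases h : m = n <;> simp [diag, h]
  rw [this]
  exact .add _ _ hφ hψ

theorem isPoly_diag_pow {Λ : Finset (Site d)} {φ : Cfg d → ℂ} (hφ : IsPoly Λ (diag φ)) (k : ℕ) :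
    IsPoly Λ (diag fun n => φ n ^ k) := by
  induction k with
  | zero =>
    simp only [pow_zero]
    exact isPoly_const Λ 1
  | succ k ih =>
    simp only [pow_succ]
    exact isPoly_diag_mul ih hφ

theorem isPoly_diag_sum {ι : Type*} (S : Finset ι) {Λ : Finset (Site d)} {φ : ι → Cfg d → ℂ}
    (hφ : ∀ i ∈ S, IsPoly Λ (diag (φ i))) : IsPoly Λ (diag fun n => ∑ i ∈ S, φ i n) := by
  classical
  induction S using Finset.induction_on with
  | empty =>
    simp only [Finset.sum_empty]
    exact isPoly_const Λ 0
  | insert a S ha ih =>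
    simp only [Finset.sum_insert ha]
    exact isPoly_diag_add (hφ a (Finset.mem_insert_self a S))
      (ih fun i hi => hφ i (Finset.mem_insert_of_mem hi))

theorem isPoly_diag_prod {ι : Type*} (S : Finset ι) {Λ : Finset (Site d)} {φ : ι → Cfg d → ℂ}
    (hφ : ∀ i ∈ S, IsPoly Λ (diag (φ i))) : IsPoly Λ (diag fun n => ∏ i ∈ S, φ i n) := by
  classical
  induction S using Finset.induction_on with
  | empty =>
    simp only [Finset.prod_empty]
    exact isPoly_const Λ 1
  | insert a S ha ih =>
    simp only [Finset.prod_insert ha]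
    exact isPoly_diag_mul (hφ a (Finset.mem_insert_self a S))
      (ih fun i hi => hφ i (Finset.mem_insert_of_mem hi))

/-- Polynomials approximating the indicator function of the configuration `n₀` on `Λ`. -/
def bump (Λ : Finset (Site d)) (n₀ : Cfg d) (K : ℕ) (n : Cfg d) : ℝ :=
  ∏ j ∈ Λ, sincSum K ((n j : ℝ) - n₀ j)

theorem isPoly_bump (Λ : Finset (Site d)) (n₀ : Cfg d) (K : ℕ) :
    IsPoly Λ (diag fun n => (bump Λ n₀ K n : ℂ)) := by
  have h : (fun n => (bump Λ n₀ K n : ℂ)) = fun n : Cfg d => ∏ j ∈ Λ, ∑ k ∈ Finset.range K,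
      ((-1) ^ k / (2 * k + 1).factorial * Real.pi ^ (2 * k) : ℂ) *
        ((n j : ℂ) + -(n₀ j : ℂ)) ^ (2 * k) := by
    funext n
    simp only [bump, sincSum]
    push_cast
    refine Finset.prod_congr rfl fun j _ => Finset.sum_congr rfl fun k _ => ?_
    rw [mul_pow]
    ring
  rw [h]
  refine isPoly_diag_prod _ fun j hj => isPoly_diag_sum _ fun k _ =>
    isPoly_diag_mul (isPoly_const Λ _) (isPoly_diag_pow (isPoly_diag_add ?_ (isPoly_const Λ _)) _)
  rw [← number_eq_diag]
  exact .mul _ _ (.cre j hj) (.ann j hj)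

theorem tendsto_bump {Λ : Finset (Site d)} (n₀ n : FinCfg Λ) :
    Tendsto (fun K => bump Λ n₀ K n) atTop (𝓝 (if n = n₀ then 1 else 0)) := by
  have h := tendsto_finsetProd Λ fun j _ => tendsto_sincSum ((n.1 j : ℤ) - n₀.1 j)
  have h1 : (∏ j ∈ Λ, if (n.1 j : ℤ) - n₀.1 j = 0 then (1 : ℝ) else 0) =
      if n = n₀ then 1 else 0 := by
    split_ifs with hn
    · subst hn
      simp
    · have : ∃ j ∈ Λ, n.1 j ≠ n₀.1 j := by
        by_contra hc
        push Not at hc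
        refine hn (Subtype.ext (Finsupp.ext fun j => ?_))
        by_cases hj : j ∈ Λ
        · exact hc j hj
        · rw [n.apply_eq_zero hj, n₀.apply_eq_zero hj]
      obtain ⟨j, hj, hne⟩ := this
      refine Finset.prod_eq_zero hj (if_neg ?_)
      omega
  rw [← h1]
  simpa [bump] using h

theorem exists_bump_bound {ε δ : ℝ} (hε : 0 < ε) (hδ : 0 < δ) (Λ : Finset (Site d))
    (n₀ : Cfg d) : ∃ C : ℝ, ∀ K (n : Cfg d),
      |bump Λ n₀ K n| * Real.exp (-∑ j ∈ Λ, ε * ((n j : ℝ) * (n j : ℝ) ^ δ)) ≤ C := by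
  choose C hC0 hC using fun j => exists_exp_bound hε hδ (n₀ j)
  refine ⟨∏ j ∈ Λ, C j, fun K n => ?_⟩
  rw [bump, Finset.abs_prod, ← Finset.sum_neg_distrib, Real.exp_sum, ← Finset.prod_mul_distrib]
  exact Finset.prod_le_prod (fun j _ => by positivity) fun j _ => hC j K (n j)

/-! ### Polynomials moving one configuration to another -/

/-- Some polynomial maps `e_n` to a non-zero multiple of `e_m`. -/
def Reach (Λ : Finset (Site d)) (n m : Cfg d) : Prop :=
  ∃ (B : Op d) (c : ℂ), IsPoly Λ B ∧ c ≠ 0 ∧ ∀ p, B p n = if p = m then c else 0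

theorem Reach.trans {Λ : Finset (Site d)} {n m k : Cfg d} (h : Reach Λ n m) (h' : Reach Λ m k) :
    Reach Λ n k := by
  obtain ⟨B, c, hB, hc, h⟩ := h
  obtain ⟨B', c', hB', hc', h'⟩ := h'
  refine ⟨mul B' B, c' * c, .mul _ _ hB' hB, mul_ne_zero hc' hc, fun p => ?_⟩
  rw [mul, tsum_eq_single m]
  · rw [h, h']
    by_cases hp : p = k <;> simp [hp]
  · intro q hq
    rw [h, if_neg hq, mul_zero]

theorem reach_ann {Λ : Finset (Site d)} {l : Site d} (hl : l ∈ Λ) (n : Cfg d) :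
    Reach Λ (n + Finsupp.single l 1) n := by
  refine ⟨ann l, Real.sqrt (n l + 1 : ℝ), .ann l hl,
    Complex.ofReal_ne_zero.2 (Real.sqrt_pos.2 (by positivity)).ne', fun p => ?_⟩
  by_cases hp : p = n
  · simp [ann, hp]
  · simp [ann, hp, Ne.symm hp]

theorem reach_cre {Λ : Finset (Site d)} {l : Site d} (hl : l ∈ Λ) (n : Cfg d) :
    Reach Λ n (n + Finsupp.single l 1) := by
  refine ⟨adj (ann l), Real.sqrt (n l + 1 : ℝ), .cre l hl,
    Complex.ofReal_ne_zero.2 (Real.sqrt_pos.2 (by positivity)).ne', fun p => ?_⟩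
  by_cases hp : p = n + Finsupp.single l 1
  · simp [ann, adj, hp]
  · simp [ann, adj, hp]

theorem reach_refl (Λ : Finset (Site d)) (n : Cfg d) : Reach Λ n n :=
  ⟨one, 1, .one, one_ne_zero, fun _ => rfl⟩

/-- Particles are removed or added one at a time, so any two configurations of `Λ` are connected
through the vacuum. -/
theorem reach_zero {Λ : Finset (Site d)} (k : ℕ) : ∀ m : Cfg d, m.degree = k → m.support ⊆ Λ →
    Reach Λ m 0 ∧ Reach Λ 0 m := by
  induction k with
  | zero =>
    intro m hm _
    rw [(Finsupp.degree_eq_zero_iff m).1 hm]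
    exact ⟨reach_refl Λ 0, reach_refl Λ 0⟩
  | succ k ih =>
    intro m hm hΛ
    obtain ⟨l, hl⟩ : ∃ l, m l ≠ 0 := by
      by_contra h
      push Not at h
      have : m = 0 := Finsupp.ext h
      simp [this] at hm
    have hlΛ : l ∈ Λ := hΛ (Finsupp.mem_support_iff.2 hl)
    obtain ⟨m, rfl⟩ := exists_eq_add_single hl
    have hd : m.degree = k := by simpa using hm
    have hs : m.support ⊆ Λ := fun j hj => hΛ (by
      rw [Finsupp.mem_support_iff, Finsupp.add_apply]
      have := Finsupp.mem_support_iff.1 hj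
      omega)
    obtain ⟨h1, h2⟩ := ih m hd hs
    exact ⟨(reach_ann hlΛ m).trans h1, h2.trans (reach_cre hlΛ m)⟩

theorem reach {Λ : Finset (Site d)} (n m : FinCfg Λ) : Reach Λ n.1 m.1 :=
  (reach_zero _ n.1 rfl n.2).1.trans (reach_zero _ m.1 rfl m.2).2

end
end YFields
-- Density of damped polynomials, the core property and the pre-Markov structure.
namespace YFields
noncomputable section
variable {d : ℕ}

/-! ### Density of damped polynomials in weighted `ℓ²` spaces -/

/-- The square-summable families on pairs of configurations of `Λ`. -/
abbrev PairL2 (Λ : Finset (Site d)) := lp (fun _ : FinCfg Λ × FinCfg Λ => ℂ) 2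

/-- The square root of the weight in `wTerm`. -/
def sqrtWeight (θ : ℝ) (Λ : Finset (Site d)) (p : FinCfg Λ × FinCfg Λ) : ℝ :=
  Real.exp (-(θ / 2 * ((p.1.1.degree : ℝ) + p.2.1.degree)))

theorem norm_sqrtWeight_mul_sq (θ : ℝ) (Λ : Finset (Site d)) (f : Op d)
    (p : FinCfg Λ × FinCfg Λ) : ‖(sqrtWeight θ Λ p : ℂ) * f p.1 p.2‖ ^ 2 = wTerm θ Λ f p := by
  rw [norm_mul, mul_pow, Complex.norm_real, sqrtWeight, Real.norm_eq_abs, Real.abs_exp, wTerm,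
    ← Real.exp_nat_mul]
  congr 2
  push_cast
  ring

/-- The weighted matrix elements of `f`. -/
def wVec (θ : ℝ) (Λ : Finset (Site d)) (f : Op d) (hf : Summable (wTerm θ Λ f)) : PairL2 Λ :=
  ⟨fun p => (sqrtWeight θ Λ p : ℂ) * f p.1 p.2, memℓp_gen (hf.congr fun p => by
    rw [← norm_sqrtWeight_mul_sq]
    simp)⟩

theorem wVec_apply (θ : ℝ) (Λ : Finset (Site d)) (f : Op d) (hf : Summable (wTerm θ Λ f))
    (p : FinCfg Λ × FinCfg Λ) :
    wVec θ Λ f hf p = (sqrtWeight θ Λ p : ℂ) * f p.1 p.2 := rfl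

theorem norm_sq_eq_tsum {Λ : Finset (Site d)} (x : PairL2 Λ) : ‖x‖ ^ 2 = ∑' p, ‖x p‖ ^ 2 := by
  simpa using lp.norm_rpow_eq_tsum (by norm_num) x

/-- The weighted matrix elements of the damped polynomials of `Λ`. -/
def dampedPolys (θ ε δ : ℝ) (Λ : Finset (Site d)) : Submodule ℂ (PairL2 Λ) where
  carrier := {x | ∃ F, IsPoly Λ F ∧
    ∀ p, x p = (sqrtWeight θ Λ p : ℂ) * mul F (damp ε δ Λ) p.1 p.2}
  add_mem' := by
    rintro x y ⟨F, hF, hx⟩ ⟨G, hG, hy⟩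
    refine ⟨F + G, .add _ _ hF hG, fun p => ?_⟩
    rw [(locFin_damp ε δ Λ).col.add_mul, lp.coeFn_add, Pi.add_apply, hx, hy, Pi.add_apply,
      Pi.add_apply, _root_.mul_add]
  zero_mem' := ⟨(0 : ℂ) • one, .smul _ _ .one, fun p => by
    rw [smul_mul_op, zero_smul]
    simp⟩
  smul_mem' := by
    rintro c x ⟨F, hF, hx⟩
    refine ⟨c • F, .smul _ _ hF, fun p => ?_⟩
    rw [smul_mul_op, lp.coeFn_smul, Pi.smul_apply, hx, Pi.smul_apply, Pi.smul_apply, smul_eq_mul,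
      smul_eq_mul]
    ring

-- A polynomial `B` carries `e_{n₀}` to a multiple of `e_{m₀}`; composing it with diagonal
-- polynomials converging to the indicator of `n₀` on `Λ` kills all other columns. Damping makes the
-- diagonal factors uniformly bounded, so the tame matrix `B` provides the dominating family in
-- `ℓ²`.
open Classical in
theorem single_mem_closure {θ ε δ : ℝ} (hθ : 0 < θ) (hε : 0 < ε) (hδ : 0 < δ)
    (Λ : Finset (Site d)) (p₀ : FinCfg Λ × FinCfg Λ) :
    lp.single 2 p₀ (1 : ℂ) ∈ (dampedPolys θ ε δ Λ).topologicalClosure := by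
  obtain ⟨B, c, hB, hc, hB'⟩ := reach p₀.2 p₀.1
  obtain ⟨C, hC⟩ := exists_bump_bound hε hδ Λ p₀.2.1
  set D : Cfg d → ℝ := fun n => Real.exp (-∑ j ∈ Λ, ε * ((n j : ℝ) * (n j : ℝ) ^ δ)) with hD
  set F : ℕ → Op d := fun K => mul B (diag fun n => (bump Λ p₀.2 K n : ℂ)) with hF
  have hFpoly : ∀ K, IsPoly Λ (F K) := fun K => .mul _ _ hB (isPoly_bump Λ p₀.2.1 K)
  have hFobs : ∀ K, IsObs (mul (F K) (damp ε δ Λ)) := fun K =>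
    .mul _ _ (hFpoly K).isObs (.damp ε δ hε hδ Λ)
  have hBtame := tame_of_isObs hB.isObs Λ θ hθ
  have hentry : ∀ K (p : FinCfg Λ × FinCfg Λ), mul (F K) (damp ε δ Λ) p.1 p.2 =
      B p.1 p.2 * ((bump Λ p₀.2 K p.2 * D p.2 : ℝ) : ℂ) := fun K p => by
    rw [mul_damp_apply, hF]
    beta_reduce
    rw [mul_diag_apply, Complex.ofReal_mul, ← mul_assoc]
  -- `κ` is the limiting weighted entry at `p₀`; dividing by it normalises the limit to the unit
  -- vector.
  set κ : ℂ := (sqrtWeight θ Λ p₀ : ℂ) * (c * (D p₀.2 : ℂ)) with hκ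
  have hκ0 : κ ≠ 0 := by
    refine mul_ne_zero (Complex.ofReal_ne_zero.2 (Real.exp_pos _).ne') (mul_ne_zero hc ?_)
    exact Complex.ofReal_ne_zero.2 (Real.exp_pos _).ne'
  set x : ℕ → PairL2 Λ := fun K =>
    κ⁻¹ • wVec θ Λ (mul (F K) (damp ε δ Λ)) (tame_of_isObs (hFobs K) Λ θ hθ) with hx
  have hxV : ∀ K, x K ∈ dampedPolys θ ε δ Λ := fun K =>
    (dampedPolys θ ε δ Λ).smul_mem _ ⟨F K, hFpoly K, fun p => rfl⟩
  have hxp : ∀ K p, x K p = κ⁻¹ * ((sqrtWeight θ Λ p : ℂ) *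
      (B p.1 p.2 * ((bump Λ p₀.2 K p.2 * D p.2 : ℝ) : ℂ))) := fun K p => by
    rw [← hentry]
    rfl
  have hlim : Tendsto (fun K => ∑' p, ‖(x K - lp.single 2 p₀ (1 : ℂ) : PairL2 Λ) p‖ ^ 2) atTop
      (𝓝 (∑' _ : FinCfg Λ × FinCfg Λ, (0 : ℝ))) := by
    refine tendsto_tsum_of_dominated_convergence (bound := fun p =>
      2 * ((‖κ‖⁻¹ * C) ^ 2 * wTerm θ Λ B p) + if p = p₀ then 2 else 0) ?_ (fun p => ?_)
      (.of_forall fun K p => ?_)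
    · refine ((hBtame.mul_left _).mul_left 2).add (summable_of_hasFiniteSupport
        ((Set.finite_singleton p₀).subset fun p hp => ?_))
      by_contra h
      exact hp (if_neg h)
    · have h1 : Tendsto (fun K => x K p) atTop (𝓝 (lp.single (E := fun _ => ℂ) 2 p₀ (1 : ℂ) p)) := by
        have h2 := ((((Complex.continuous_ofReal.tendsto _).comp
          ((tendsto_bump p₀.2 p.2).mul_const (D p.2))).const_mul (B p.1 p.2)).const_mul
          (sqrtWeight θ Λ p : ℂ)).const_mul κ⁻¹
        have h3 : κ⁻¹ * ((sqrtWeight θ Λ p : ℂ) * (B p.1 p.2 *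
            (((if p.2 = p₀.2 then 1 else 0) * D p.2 : ℝ) : ℂ))) =
              lp.single (E := fun _ => ℂ) 2 p₀ (1 : ℂ) p := by
          rw [lp.single_apply]
          by_cases hp2 : p.2 = p₀.2
          · have hb := hB' p.1.1
            rw [← hp2] at hb
            by_cases hp1 : p.1 = p₀.1
            · have : p = p₀ := Prod.ext hp1 hp2
              subst this
              rw [hb, if_pos rfl, if_pos rfl, Pi.single_eq_same, one_mul]
              exact inv_mul_cancel₀ hκ0
            · have h1 : p ≠ p₀ := fun h => hp1 (by rw [h])
              have h2 : p.1.1 ≠ p₀.1.1 := fun h => hp1 (Subtype.ext h)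
              rw [hb, if_neg h2, Pi.single_eq_of_ne h1]
              simp
          · have : p ≠ p₀ := fun h => hp2 (by rw [h])
            rw [if_neg hp2, Pi.single_eq_of_ne this]
            simp
        rw [← h3]
        exact h2.congr fun K => (hxp K p).symm
      have h4 := ((h1.sub_const (lp.single (E := fun _ => ℂ) 2 p₀ (1 : ℂ) p)).norm.pow 2)
      simpa using h4
    · rw [Real.norm_of_nonneg (by positivity), lp.coeFn_sub, Pi.sub_apply]
      have h1 : ‖x K p‖ ^ 2 ≤ (‖κ‖⁻¹ * C) ^ 2 * wTerm θ Λ B p := by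
        rw [hxp, ← norm_sqrtWeight_mul_sq, ← mul_pow]
        refine pow_le_pow_left₀ (norm_nonneg _) ?_ 2
        have h2 : ‖((bump Λ p₀.2 K p.2 * D p.2 : ℝ) : ℂ)‖ ≤ C := by
          rw [Complex.norm_real, norm_mul, Real.norm_eq_abs, Real.norm_eq_abs, hD]
          beta_reduce
          rw [Real.abs_exp]
          exact hC K p.2
        rw [norm_mul κ⁻¹, norm_mul (sqrtWeight θ Λ p : ℂ), norm_mul (B p.1 p.2), norm_inv]
        calc ‖κ‖⁻¹ * (‖(sqrtWeight θ Λ p : ℂ)‖ *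
              (‖B p.1 p.2‖ * ‖((bump Λ p₀.2 K p.2 * D p.2 : ℝ) : ℂ)‖))
            ≤ ‖κ‖⁻¹ * (‖(sqrtWeight θ Λ p : ℂ)‖ * (‖B p.1 p.2‖ * C)) := by gcongr
          _ = ‖κ‖⁻¹ * C * ‖(sqrtWeight θ Λ p : ℂ) * B p.1 p.2‖ := by
            rw [norm_mul (sqrtWeight θ Λ p : ℂ)]
            ring
      have h3 : ‖lp.single (E := fun _ => ℂ) 2 p₀ (1 : ℂ) p‖ ^ 2 = if p = p₀ then 1 else 0 := by
        rw [lp.single_apply]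
        by_cases h : p = p₀
        · subst h
          simp
        · simp [h]
      have h4 : ‖x K p - lp.single (E := fun _ => ℂ) 2 p₀ (1 : ℂ) p‖ ^ 2 ≤
          2 * ‖x K p‖ ^ 2 + 2 * ‖lp.single (E := fun _ => ℂ) 2 p₀ (1 : ℂ) p‖ ^ 2 := by
        have := norm_sub_le (x K p) (lp.single (E := fun _ => ℂ) 2 p₀ (1 : ℂ) p)
        nlinarith [norm_nonneg (x K p - lp.single (E := fun _ => ℂ) 2 p₀ (1 : ℂ) p),
          sq_nonneg (‖x K p‖ - ‖lp.single (E := fun _ => ℂ) 2 p₀ (1 : ℂ) p‖)]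
      rw [h3] at h4
      refine h4.trans ?_
      split_ifs <;> linarith
  rw [tsum_zero] at hlim
  simp_rw [← norm_sq_eq_tsum] at hlim
  have hlim' : Tendsto (fun K => ‖x K - lp.single 2 p₀ (1 : ℂ)‖) atTop (𝓝 0) := by
    have := (Real.continuous_sqrt.tendsto 0).comp hlim
    simpa [Function.comp_def, Real.sqrt_sq] using this
  have hlim2 : Tendsto x atTop (𝓝 (lp.single 2 p₀ (1 : ℂ))) :=
    tendsto_iff_norm_sub_tendsto_zero.2 hlim'
  exact mem_closure_of_tendsto hlim2 (.of_forall hxV)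

theorem dampedPolys_dense {θ ε δ : ℝ} (hθ : 0 < θ) (hε : 0 < ε) (hδ : 0 < δ)
    (Λ : Finset (Site d)) (x : PairL2 Λ) : x ∈ (dampedPolys θ ε δ Λ).topologicalClosure := by
  classical
  have h := lp.hasSum_single (p := 2) (by simp) x
  refine (dampedPolys θ ε δ Λ).isClosed_topologicalClosure.mem_of_tendsto h
    (.of_forall fun S => Submodule.sum_mem _ fun p _ => ?_)
  have h1 : lp.single 2 p (x p) = x p • lp.single (E := fun _ => ℂ) 2 p (1 : ℂ) := by
    rw [← lp.single_smul, smul_eq_mul, mul_one]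
  rw [h1]
  refine Submodule.smul_mem _ _ ?_
  convert single_mem_closure hθ hε hδ Λ p

/-- The freedom in `θ` is essential: `θ = β/2` is the norm of `L²(ω₀)` and gives density, while the
stronger norm with `θ = β/4` also controls derivatives. -/
theorem exists_damped_poly {θ ε δ : ℝ} (hθ : 0 < θ) (hε : 0 < ε) (hδ : 0 < δ)
    {Λ : Finset (Site d)} {f : Op d} (hf : Summable (wTerm θ Λ f)) {r : ℝ} (hr : 0 < r) :
    ∃ F, IsPoly Λ F ∧ wSum θ Λ (f - mul F (damp ε δ Λ)) < r := by
  obtain ⟨y, ⟨F, hF, hy⟩, hlt⟩ := Metric.mem_closure_iff.1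
    (dampedPolys_dense hθ hε hδ Λ (wVec θ Λ f hf)) (Real.sqrt r) (Real.sqrt_pos.2 hr)
  refine ⟨F, hF, ?_⟩
  rw [dist_eq_norm] at hlt
  have h1 := (Real.lt_sqrt (norm_nonneg _)).1 hlt
  rw [norm_sq_eq_tsum] at h1
  refine lt_of_eq_of_lt (tsum_congr fun p => ?_) h1
  have e : (wVec θ Λ f hf - y : PairL2 Λ) p =
      (sqrtWeight θ Λ p : ℂ) * (f - mul F (damp ε δ Λ)) p.1 p.2 := by
    rw [lp.coeFn_sub, Pi.sub_apply, hy, wVec_apply, ← _root_.mul_sub]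
    rfl
  rw [e, norm_sqrtWeight_mul_sq]

variable {β : ℝ} [hβ : Fact (0 < β)]

theorem isObs_of_mem_Deps {ε δ : ℝ} (hε : 0 < ε) (hδ : 0 < δ) {f : Op d} (hf : f ∈ Deps ε δ) :
    IsObs f := by
  obtain ⟨Λ, F, hF, rfl⟩ := hf
  exact .mul _ _ hF.isObs (.damp ε δ hε hδ Λ)

theorem dense_Deps {ε δ : ℝ} (hε : 0 < ε) (hδ : 0 < δ) :
    Dense (cls β '' (Deps ε δ : Set (Op d))) := by
  refine Metric.dense_iff.2 fun Ψ r hr => ?_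
  obtain ⟨⟨f, hf⟩, hd⟩ := Metric.denseRange_iff.1
    (UniformSpace.Completion.denseRange_coe (α := LocalSpace d β)) Ψ (r / 2) (half_pos hr)
  have hf' : dist Ψ (cls β f) < r / 2 := by
    rw [cls_ofLocal hf]
    exact hd
  obtain ⟨Λ, hΛ⟩ := id hf
  have hs := (summable_ipTerm_iff hβ.out).1 hΛ.2
  have hpos : 0 < partition β ^ Λ.card := pow_pos (partition_pos hβ.out).1 _
  obtain ⟨F, hF, hlt⟩ := exists_damped_poly (half_pos hβ.out) hε hδ hs
    (r := partition β ^ Λ.card * (r / 2) ^ 2) (by positivity)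
  have hg : IsObs (mul F (damp ε δ Λ)) := .mul _ _ hF.isObs (.damp ε δ hε hδ Λ)
  have hgs := tame_of_isObs hg Λ _ (half_pos hβ.out)
  refine ⟨cls β (mul F (damp ε δ Λ)), ?_, _, ⟨Λ, F, hF, rfl⟩, rfl⟩
  have h1 := norm_cls_sq (β := β) (hΛ.1.sub (hF.isLocal.mul (isLocal_damp ε δ Λ)))
    (summable_wTerm_sub hs hgs)
  have h2 : ‖cls β (f - mul F (damp ε δ Λ))‖ < r / 2 := by
    refine lt_of_pow_lt_pow_left₀ 2 (half_pos hr).le ?_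
    rw [h1, inv_mul_lt_iff₀ hpos]
    exact hlt
  rw [(inL2_of_mem hf).cls_sub hg.inL2, ← dist_eq_norm] at h2
  rw [Metric.mem_ball, dist_comm]
  linarith [dist_triangle Ψ (cls β f) (cls β (mul F (damp ε δ Λ)))]

/-! ### The damped polynomials are a core of the form -/

theorem tendsto_form {η : ℂ → ℂ} (hη : Admissible η) {Λ : Finset (Site d)} {h : ℕ → Op d}
    (hobs : ∀ k, IsObs (h k)) (hloc : ∀ k, IsLocal Λ (h k))
    (hlim : ∀ s l, Tendsto (fun k => cls β (delta (ladder s l) (h k))) atTop (𝓝 0))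
    {a : Bool → Site d → ℂ} (ha : ∀ s, Summable fun l => ‖a s l‖) :
    Tendsto (fun k => form β η (fields a) (h k) (h k)) atTop (𝓝 0) := by
  have h1 : ∀ k, form β η (fields a) (h k) (h k) = _ := fun k =>
    form_eq_corr hη (hobs k) (hobs k) (hloc k) (hloc k) ha
  simp_rw [h1]
  have h2 : ∀ s' s l' l, Tendsto (fun k => corr (a s) (a s') l l' *
      scal β (delta (ladder s' l') (h k)) (delta (ladder s l) (h k))) atTop (𝓝 0) :=
    fun s' s l' l => by
      have := ((hlim s' l').inner (𝕜 := ℂ) (hlim s l)).const_mul (corr (a s) (a s') l l')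
      simpa [scal] using this
  have h3 := tendsto_finsetSum (Finset.univ : Finset Bool) fun s' _ =>
    tendsto_finsetSum (Finset.univ : Finset Bool) fun s _ =>
      (tendsto_finsetSum Λ fun l' _ => tendsto_finsetSum Λ fun l _ => h2 s' s l' l).const_mul
        (etaHat η (freq β s s'))
  simpa using h3

theorem exists_core_approx {η : ℂ → ℂ} (hη : Admissible η) {ε δ : ℝ} (hε : 0 < ε) (hδ : 0 < δ)
    {f : Op d} (hf : IsObs f) {a : Bool → Site d → ℂ} (ha : ∀ s, Summable fun l => ‖a s l‖)
    {r : ℝ} (hr : 0 < r) : ∃ g ∈ Deps ε δ, ‖cls β f - cls β g‖ < r ∧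
      ‖dirichletForm β η (fields a) (f - g) (f - g)‖ < r := by
  obtain ⟨Λ, hΛ⟩ := hf.exists_isLocal
  have hβ4 : 0 < β / 2 / 2 := half_pos (half_pos hβ.out)
  -- Approximation takes place in the weight `β/4`, since a ladder derivation into `L²(ω₀)` halves
  -- the weight `β/2`.
  choose F hF hlt using fun k : ℕ => exists_damped_poly (r := 1 / ((k : ℝ) + 1)) hβ4 hε hδ
    (tame_of_isObs hf Λ _ hβ4) (by positivity)
  have hg : ∀ k, IsObs (mul (F k) (damp ε δ Λ)) := fun k =>
    .mul _ _ (hF k).isObs (.damp ε δ hε hδ Λ)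
  set h : ℕ → Op d := fun k => f - mul (F k) (damp ε δ Λ) with hh
  have hobs : ∀ k, IsObs (h k) := fun k => hf.sub (hg k)
  have hloc : ∀ k, IsLocal Λ (h k) := fun k =>
    hΛ.sub ((hF k).isLocal.mul (isLocal_damp ε δ Λ))
  have hw : Tendsto (fun k => wSum (β / 2 / 2) Λ (h k)) atTop (𝓝 0) :=
    squeeze_zero (fun k => wSum_nonneg _ _ _) (fun k => (hlt k).le)
      tendsto_one_div_add_atTop_nhds_zero_nat
  have hzero : ∀ (y : ℕ → Op d) (C : ℝ), (∀ k, IsObs (y k)) → (∀ k, IsLocal Λ (y k)) →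
      (∀ k, wSum (β / 2) Λ (y k) ≤ C * wSum (β / 2 / 2) Λ (h k)) →
      Tendsto (fun k => cls β (y k)) atTop (𝓝 0) := by
    intro y C hy1 hy2 hy3
    have hpos : 0 ≤ (partition β ^ Λ.card)⁻¹ :=
      inv_nonneg.2 (pow_pos (partition_pos hβ.out).1 _).le
    have h1 : Tendsto (fun k => ‖cls β (y k)‖ ^ 2) atTop (𝓝 0) := by
      refine squeeze_zero (fun k => sq_nonneg _) (fun k => ?_)
        (by simpa using (hw.const_mul C).const_mul (partition β ^ Λ.card)⁻¹)
      rw [norm_cls_sq (hy2 k) (tame_of_isObs (hy1 k) Λ _ (half_pos hβ.out))]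
      exact mul_le_mul_of_nonneg_left (hy3 k) hpos
    rw [tendsto_zero_iff_norm_tendsto_zero]
    have := (Real.continuous_sqrt.tendsto 0).comp h1
    simpa [Function.comp_def, Real.sqrt_sq] using this
  have hlim0 : Tendsto (fun k => cls β (h k)) atTop (𝓝 0) :=
    hzero h 1 hobs hloc fun k => by
      rw [one_mul]
      exact wSum_le_of_le (half_le_self (half_pos hβ.out).le) (tame_of_isObs (hobs k) Λ _ hβ4)
  have hlim : ∀ s l, Tendsto (fun k => cls β (delta (ladder s l) (h k))) atTop (𝓝 0) := by
    intro s l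
    by_cases hl : l ∈ Λ
    · exact hzero _ _ (fun k => (isObs_ladder s l).delta (hobs k))
        (fun k => (hloc k).delta_ladder_isLocal s l)
        fun k => wSum_delta_ladder (half_pos hβ.out) hl s (tame_of_isObs (hobs k) Λ _ hβ4)
    · refine tendsto_const_nhds.congr fun k => ?_
      rw [(hloc k).delta_ladder s hl, cls_zero]
  have hform : Tendsto (fun k => dirichletForm β η (fields a) (h k) (h k)) atTop (𝓝 0) := by
    have h1 := (tendsto_form hη hobs hloc hlim ha).add
      (tendsto_form hη hobs hloc hlim (summable_adjCoef ha))
    rw [add_zero] at h1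
    refine h1.congr fun k => ?_
    rw [dirichletForm]
    congr 2
    exact (funext (adj_fields a)).symm
  have e1 := (tendsto_zero_iff_norm_tendsto_zero.1 hlim0).eventually (gt_mem_nhds hr)
  have e2 := (tendsto_zero_iff_norm_tendsto_zero.1 hform).eventually (gt_mem_nhds hr)
  obtain ⟨k, hk1, hk2⟩ := (e1.and e2).exists
  refine ⟨mul (F k) (damp ε δ Λ), ⟨Λ, F k, hF k, rfl⟩, ?_, hk2⟩
  rw [← hf.inL2.cls_sub (hg k).inL2]
  exact hk1

/-! ### The pre-Markov generator -/

theorem isPreMarkovGenerator_fields {η : ℂ → ℂ} (hη : Admissible η) {a : Bool → Site d → ℂ}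
    (ha : ∀ s, Summable fun l => ‖a s l‖) :
    IsPreMarkovGenerator β (obs d) (dirichletForm β η (fields a))
      (generator β η (fields a)) := by
  have ha' := summable_adjCoef ha
  have hgen : ∀ {f : Op d}, IsObs f → generator β η (fields a) f =
      (-1 : ℂ) • (genSum β η a f + genSum β η (adjCoef a) f) := fun {f} hf => by
    rw [generator_eq hη hf β ha, neg_one_smul]
  have hdir : ∀ f g, dirichletForm β η (fields a) g f =
      form β η (fields a) g f + form β η (fields (adjCoef a)) g f := fun f g => by
    rw [dirichletForm]
    congr 2
    exact funext (adj_fields a)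
  have hform : ∀ f ∈ obs d, ∀ g ∈ obs d, dirichletForm β η (fields a) g f =
      -scal β g (generator β η (fields a) f) := fun f hf g hg => by
    obtain ⟨h1, h2⟩ := genSum_inL2 (β := β) hη hf ha
    obtain ⟨h3, h4⟩ := genSum_inL2 (β := β) hη hf ha'
    rw [hgen hf, (h1.add h3).scal_smul_right, hdir, ← h2 g hg, ← h4 g hg, scal, scal, scal,
      h1.cls_add h3, inner_add_right]
    ring
  have hconj : ∀ f g, (starRingEnd ℂ) (dirichletForm β η (fields a) g f) =
      dirichletForm β η (fields a) f g := fun f g => by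
    rw [dirichletForm, map_add, conj_form hη, conj_form hη, dirichletForm]
  have hsum : ∀ {f : Op d}, IsObs f → ∀ m n, Summable fun j => genPart β η a j f m n :=
    fun hf m n => (hasSum_genSum hf β η ha m n).summable
  have hsum' : ∀ {f : Op d}, IsObs f → ∀ m n, Summable fun j => genPart β η (adjCoef a) j f m n :=
    fun hf m n => (hasSum_genSum hf β η ha' m n).summable
  refine
    { one_mem := .one
      adj_mem := fun f hf => IsObs.adj hf
      mul_mem := fun f hf g hg => .mul _ _ hf hg
      inL2 := fun f hf => IsObs.inL2 hf
      dense := ?_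
      map_inL2 := fun f hf => ?_
      map_add := fun f hf g hg => ?_
      map_smul := fun c f hf => ?_
      form_eq := hform
      symm := fun f hf g hg => ?_
      nonpos := fun f hf => ?_
      map_adj := fun f hf => ?_
      map_one := ?_
      dissipative := fun f hf => nonneg_carreDuChamp hη hf β ha }
  · exact (dense_Deps (β := β) (d := d) one_pos one_pos).mono
      (Set.image_mono fun f hf => isObs_of_mem_Deps one_pos one_pos hf)
  · rw [hgen hf]
    exact ((genSum_inL2 hη hf ha).1.add (genSum_inL2 hη hf ha').1).smul _
  · rw [hgen hf, hgen hg, hgen (.add _ _ hf hg), ← smul_add, add_add_add_comm]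
    congr 2
    · funext m n
      simp only [genSum, genPart_add hf hg, Pi.add_apply]
      exact (hsum hf m n).tsum_add (hsum hg m n)
    · funext m n
      simp only [genSum, genPart_add hf hg, Pi.add_apply]
      exact (hsum' hf m n).tsum_add (hsum' hg m n)
  · rw [hgen hf, hgen (.smul _ _ hf), smul_comm c]
    congr 1
    rw [smul_add]
    congr 1
    · funext m n
      simp only [genSum, genPart_smul, Pi.smul_apply, smul_eq_mul, tsum_mul_left]
    · funext m n
      simp only [genSum, genPart_smul, Pi.smul_apply, smul_eq_mul, tsum_mul_left]
  · have h1 := hform f hf g hg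
    have h2 := hform g hg f hf
    -- Symmetry is the Hermitian symmetry of the form, which holds because `η` is real on the real
    -- line.
    rw [← hconj, h2, map_neg, conj_scal] at h1
    exact neg_injective h1.symm
  · have h1 := form_self_re_nonneg (β := β) hη hf ha
    have h2 := form_self_re_nonneg (β := β) hη hf ha'
    have h3 := congrArg Complex.re (hform f hf f hf)
    rw [hdir, Complex.add_re, Complex.neg_re] at h3
    linarith
  · rw [hgen hf, hgen (IsObs.adj hf), adj_smul, adj_add, adj_genSum hη, adj_genSum hη,
      adjCoef_adjCoef, add_comm]
    simp
  · rw [hgen .one]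
    funext m n
    simp [genSum, genPart_one]

end
end YFields

/-! ### Specialisation of the general fields to `Y = Z_κ - Z_ξ^*`. -/

theorem mainTheorem10 (d : ℕ) (β : ℝ) [Fact (0 < β)] (η : ℂ → ℂ) (hη : Admissible η)
    (κ ξ : Site d → ℂ) (hκ : Summable fun j => ‖κ j‖) (hξ : Summable fun j => ‖ξ j‖)
    (hκ0 : κ ≠ 0) (hξ0 : ξ ≠ 0)
    (Y Zκ Zξ Y' Zκ' Zξ' : Site d → Op d)
    (hY : Y = fun j => yField (shift j κ) (shift j ξ))
    (hZκ : Zκ = fun j => zField (shift j κ)) (hZξ : Zξ = fun j => zField (shift j ξ))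
    (hY' : Y' = fun j => adj (Y j))
    (hZκ' : Zκ' = fun j => adj (Zκ j)) (hZξ' : Zξ' = fun j => adj (Zξ j)) :
    -- the form is well defined on a space which contains the dense set `𝓓_ε`
    (∀ g ∈ obs d, ∀ f ∈ obs d, FormConverges β η Y g f ∧ FormConverges β η Y' g f) ∧
    (∀ ε δ : ℝ, 0 < ε → 0 < δ → Deps ε δ ⊆ (obs d : Set (Op d)) ∧
      Dense (cls β '' (Deps ε δ : Set (Op d)))) ∧
    -- the representation of the form, in the directions `Y` and in the directions `Y` and `Y^*`
    (∀ f ∈ obs d,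
      (PairingConverges β Zκ Zκ f ∧ PairingConverges β Zξ' Zξ' f ∧
        PairingConverges β Zκ Zξ' f ∧ PairingConverges β Zξ' Zκ f) ∧
      (PairingConverges β Zκ' Zκ' f ∧ PairingConverges β Zξ Zξ f ∧
        PairingConverges β Zκ' Zξ f ∧ PairingConverges β Zξ Zκ' f) ∧
      form β η Y f f =
        etaHat η 0 * pairing β Zκ Zκ f + etaHat η 0 * pairing β Zξ' Zξ' f
        - etaHat η (-2 * β) * pairing β Zκ Zξ' f - etaHat η (2 * β) * pairing β Zξ' Zκ f ∧
      dirichletForm β η Y f f =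
        etaHat η 0 * pairing β Zκ Zκ f + etaHat η 0 * pairing β Zξ' Zξ' f
        - etaHat η (-2 * β) * pairing β Zκ Zξ' f - etaHat η (2 * β) * pairing β Zξ' Zκ f
        + etaHat η 0 * pairing β Zκ' Zκ' f + etaHat η 0 * pairing β Zξ Zξ f
        - etaHat η (2 * β) * pairing β Zκ' Zξ f - etaHat η (-2 * β) * pairing β Zξ Zκ' f) ∧
    -- the pre-Markov generator
    (∀ f ∈ obs d, GeneratorConverges β η Y f) ∧
    IsPreMarkovGenerator β (obs d) (dirichletForm β η Y) (generator β η Y) ∧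
    -- `𝓓_ε` is a core of the form
    (∀ ε δ : ℝ, 0 < ε → 0 < δ → ∀ f ∈ obs d, ∀ r : ℝ, 0 < r → ∃ g ∈ Deps ε δ,
      ‖cls β f - cls β g‖ < r ∧ ‖dirichletForm β η Y (f - g) (f - g)‖ < r) := by
  -- The creation part of `Z_κ - Z_ξ^*` has coefficients `-conj ξ`; this sign is the source of the
  -- minus signs before the mixed terms.
  set a : Bool → Site d → ℂ := fun s => cond s κ (-conjFun ξ) with ha_def
  have hconj : ∀ c : Site d → ℂ, (Summable fun l => ‖c l‖) → Summable fun l => ‖conjFun c l‖ :=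
    fun c hc => hc.congr fun l => by simp [conjFun]
  have ha : ∀ s, Summable fun l => ‖a s l‖ := by
    rintro (_ | _)
    · exact (hconj ξ hξ).congr fun l => by simp [a]
    · exact hκ
  have ha' := summable_adjCoef ha
  have eY : Y = fields a := by
    rw [hY]
    exact funext (yField_shift κ ξ)
  have eY' : Y' = fields (adjCoef a) := by
    rw [hY', eY]
    exact funext (adj_fields a)
  have eZκ : Zκ = fun j => lin true (shift j κ) := hZκ
  have eZξ : Zξ = fun j => lin true (shift j ξ) := hZξ
  have eZκ' : Zκ' = fun j => lin false (shift j (conjFun κ)) := by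
    rw [hZκ', eZκ]
    exact funext fun j => adj_lin true _
  have eZξ' : Zξ' = fun j => lin false (shift j (conjFun ξ)) := by
    rw [hZξ', eZξ]
    exact funext fun j => adj_lin true _
  have hκ' := hconj κ hκ
  have hξ' := hconj ξ hξ
  have f1 : freq β true true = 0 := by simp [freq]
  have f2 : freq β false false = 0 := by simp [freq]
  have f3 : freq β true false = 2 * β := by simp [freq, sgn]; ring
  have f4 : freq β false true = -2 * β := by simp [freq, sgn]; ring
  have hneg : ∀ (f : Op d) (s : Bool) (c : Site d → ℂ) (j : Site d),
      delta (lin s (shift j (-c))) f = (-1 : ℂ) • delta (lin s (shift j c)) f :=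
    fun f s c j => by
      rw [show shift j (-c) = -shift j c from rfl, lin_neg, ← delta_smul_left, neg_one_smul]
  have hin : ∀ (f : Op d), IsObs f → ∀ s (c : Site d → ℂ), InL2 β (delta (lin s c) f) :=
    fun f hf s c => (isObs_delta_lin hf s c).inL2
  have hformY : ∀ f, IsObs f → form β η Y f f =
      etaHat η 0 * pairing β Zκ Zκ f + etaHat η 0 * pairing β Zξ' Zξ' f
        - etaHat η (-2 * β) * pairing β Zκ Zξ' f - etaHat η (2 * β) * pairing β Zξ' Zκ f := by
    intro f hf
    rw [eY, form_eq_sum hη hf hf ha, eZκ, eZξ']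
    -- The four pairs of annihilation and creation parts give the four terms. In the term with two
    -- creation parts the signs cancel.
    simp only [Fintype.sum_bool, f1, f2, f3, f4, pairing, a, cond_true, cond_false, hneg,
      (hin f hf _ _).scal_smul_left, (hin f hf _ _).scal_smul_right, tsum_mul_left, map_neg, map_one]
    ring
  have hformY' : ∀ f, IsObs f → form β η Y' f f =
      etaHat η 0 * pairing β Zκ' Zκ' f + etaHat η 0 * pairing β Zξ Zξ f
        - etaHat η (2 * β) * pairing β Zκ' Zξ f - etaHat η (-2 * β) * pairing β Zξ Zκ' f := by
    intro f hf
    have e1 : adjCoef a true = -ξ := by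
      funext l
      simp [adjCoef, conjFun, a]
    have e2 : adjCoef a false = conjFun κ := rfl
    rw [eY', form_eq_sum hη hf hf ha', eZκ', eZξ]
    simp only [Fintype.sum_bool, f1, f2, f3, f4, pairing, e1, e2, hneg,
      (hin f hf _ _).scal_smul_left, (hin f hf _ _).scal_smul_right, tsum_mul_left, map_neg, map_one]
    ring
  refine ⟨fun g hg f hf => ?_, fun ε δ hε hδ => ?_, fun f hf => ⟨?_, ?_, hformY f hf, ?_⟩,
    fun f hf => ?_, ?_, fun ε δ hε hδ f hf r hr => ?_⟩
  · rw [eY, eY']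
    exact ⟨formConverges_fields hη hf hg ha, formConverges_fields hη hf hg ha'⟩
  · exact ⟨fun f hf => isObs_of_mem_Deps hε hδ hf, dense_Deps hε hδ⟩
  · rw [eZκ, eZξ']
    exact ⟨pairingConverges_lin hf hκ hκ true true, pairingConverges_lin hf hξ' hξ' false false,
      pairingConverges_lin hf hξ' hκ false true, pairingConverges_lin hf hκ hξ' true false⟩
  · rw [eZκ', eZξ]
    exact ⟨pairingConverges_lin hf hκ' hκ' false false, pairingConverges_lin hf hξ hξ true true,
      pairingConverges_lin hf hξ hκ' true false, pairingConverges_lin hf hκ' hξ false true⟩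
  · rw [dirichletForm, ← hY', hformY f hf, hformY' f hf]
    ring
  · rw [eY]
    exact generatorConverges_fields hη hf β ha
  · rw [eY]
    exact isPreMarkovGenerator_fields hη ha
  · rw [eY]
    exact exists_core_approx hη hε hδ hf ha hr
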